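/- Notation. For $u\in\mathbb C^n$ put $A(u)=\prod_{1\le i<j\le n}(u_i-u_j)$ and $\bar u=u_1+\dots+u_n$; for $u\in\mathbb C^k$, $v\in\mathbb C^l$ put $A(u,v)=\prod_{i=1}^k\prod_{j=1}^l(u_i-v_j)$; $(\lambda,x)=\sum_i\lambda_ix_i$. For integers $n\ge 0$, $m\ge1$ let $$L^{(n)}_m=-\Delta+\sum_{1\le i<j\le n}\frac{2m(m+1)}{(x_i-x_j)^2},\qquad \Delta=\sum_{i=1}^n\frac{\partial^2}{\partial x_i^2},$$ be the Calogero--Moser operator. The rational Baker--Akhiezer function of type $A_{n-1}$ with multiplicity $m$ is the function $$\Psi^{(n)}_m(x,\lambda)=\frac{P^{(n)}_m(x,\lambda)}{A(x)^mA(\lambda)^m}\,e^{(\lambda,x)},\qquad x,\lambda\in\mathbb C^n,$$ where $P^{(n)}_m$ is a polynomial in $x$ and $\lambda$ with leading term $A(x)^mA(\lambda)^m$ (that is, every monomial of $P^{(n)}_m-A(x)^mA(\lambda)^m$ has degree less than $mn(n-1)/2$ in $x$ and degree less than $mn(n-1)/2$ in $\lambda$), such that $L^{(n)}_m\Psi^{(n)}_m=-(\lambda,\lambda)\Psi^{(n)}_m$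 whenever the $x_i$ are distinct and the $\lambda_i$ are distinct. Theorem. Let $m\ge1$ and $k\ge0$ be integers. The polynomials $P^{(k)}_m$ and $P^{(k+1)}_m$ exist and are unique. Let $x=(x_1,\dots,x_{k+1})\in\mathbb C^{k+1}$ have coordinates with pairwise distinct imaginary parts, and let $\lambda\in\mathbb C^{k+1}$ satisfy $\operatorname{Re}(\lambda_i-\lambda_j)<0$ for all $1\le i<j\le k+1$. Let $\gamma$ be the contour $z_i=x_i+\tau_i$, $\tau_i\in[0,\infty)$, $i=1,\dots,k$, with $dz=d\tau_1\cdots d\tau_k$. Then the following integral converges absolutely, and $$\int_\gamma\frac{A(z,x)^m}{A(x)^mA(z)^m}\,e^{\lambda_{k+1}(\bar x-\bar z)}\,\Psi^{(k)}_m(z,\lambda_1,\dots,\lambda_k)\,dz=C_2\,\Psi^{(k+1)}_m(x,\lambda_1,\dots,\lambda_{k+1}),$$ $$C_2=(-1)^{mk(k-1)/2}\,(m!)^k\prod_{i=1}^k(\lambda_{k+1}-\lambda_i)^{-m-1}.$$ -/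

import Mathlib

open scoped BigOperators

noncomputable section

namespace RationalBA

/-- The product `A(u) = ∏_{i<j} (u_i - u_j)`, over any commutative ring. -/
def vdm {R : Type*} [CommRing R] {n : ℕ} (u : Fin n → R) : R :=
  ∏ i : Fin n, ∏ j ∈ Finset.Ioi i, (u i - u j)

/-- The product `A(u,v) = ∏_{i,j} (u_i - v_j)`. -/
def crossProd {k l : ℕ} (u : Fin k → ℂ) (v : Fin l → ℂ) : ℂ :=
  ∏ i : Fin k, ∏ j : Fin l, (u i - v j)

/-- The Calogero-Moser operator
`L = -Δ + ∑_{i<j} 2m(m+1) / (x_i - x_j)^2` in `n` complex variables. -/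
def calogeroMoser (n m : ℕ) (f : (Fin n → ℂ) → ℂ) (x : Fin n → ℂ) : ℂ :=
  -(∑ i : Fin n, iteratedDeriv 2 (fun t : ℂ => f (Function.update x i t)) (x i))
    + (∑ i : Fin n, ∑ j ∈ Finset.Ioi i,
        2 * (m : ℂ) * ((m : ℂ) + 1) / (x i - x j) ^ 2) * f x

/-- The function `P(x,μ) / (A(x)^m A(μ)^m) * exp (μ,x)` attached to a polynomial `P` in the
`2n` variables `x_i` (indexed by `Sum.inl i`) and `μ_i` (indexed by `Sum.inr i`). -/
def ansatz (n m : ℕ) (P : MvPolynomial (Fin n ⊕ Fin n) ℂ) (x μ : Fin n → ℂ) : ℂ :=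
  MvPolynomial.eval (Sum.elim x μ) P / (vdm x ^ m * vdm μ ^ m)
    * Complex.exp (∑ i : Fin n, μ i * x i)

/-- The polynomial `A(x)^m A(μ)^m`, of degree `m n(n-1)/2` in `x` and in `μ`. -/
def leadingTerm (n m : ℕ) : MvPolynomial (Fin n ⊕ Fin n) ℂ :=
  vdm (fun i : Fin n => MvPolynomial.X (Sum.inl i)) ^ m
    * vdm (fun i : Fin n => MvPolynomial.X (Sum.inr i)) ^ m

/-- `P` is the polynomial of a rational Baker-Akhiezer function of type `A_{n-1}` with
multiplicity `m`: its leading term is `A(x)^m A(μ)^m` (all other terms have smaller degree in `x`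
and smaller degree in `μ`), and the corresponding function satisfies `L Ψ = -(μ,μ) Ψ`. -/
structure IsBAPolynomial (n m : ℕ) (P : MvPolynomial (Fin n ⊕ Fin n) ℂ) : Prop where
  leading : ∀ d ∈ (P - leadingTerm n m).support,
    ∑ i : Fin n, d (Sum.inl i) < m * n.choose 2 ∧ ∑ i : Fin n, d (Sum.inr i) < m * n.choose 2
  schrodinger : ∀ x μ : Fin n → ℂ, Function.Injective x → Function.Injective μ →
    calogeroMoser n m (fun y => ansatz n m P y μ) x = -(∑ i : Fin n, μ i ^ 2) * ansatz n m P x μ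

/-- The polynomial `P_m^{(n)}` of the rational Baker-Akhiezer function. -/
def baPolynomial (n m : ℕ) : MvPolynomial (Fin n ⊕ Fin n) ℂ :=
  Classical.epsilon (IsBAPolynomial n m)

/-- The rational Baker-Akhiezer function `Ψ_m^{(n)}(x, μ)`. -/
def baFunction (n m : ℕ) (x μ : Fin n → ℂ) : ℂ :=
  ansatz n m (baPolynomial n m) x μ

/-- The point `z_i = x_i + τ_i`, `i = 1, …, k`, of the contour of integration. -/
def contourPoint {k : ℕ} (x : Fin (k + 1) → ℂ) (τ : Fin k → ℝ) : Fin k → ℂ :=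
  fun i => x i.castSucc + (τ i : ℂ)

/-- The integrand `A(z,x)^m / (A(x)^m A(z)^m) * exp (μ_{k+1} (x̄ - z̄)) * Ψ_m^{(k)}(z, μ_1, …, μ_k)`,
where a bar denotes the sum of the coordinates. -/
def integrand (k m : ℕ) (x μ : Fin (k + 1) → ℂ) (z : Fin k → ℂ) : ℂ :=
  crossProd z x ^ m / (vdm x ^ m * vdm z ^ m)
    * Complex.exp (μ (Fin.last k) * ((∑ i : Fin (k + 1), x i) - ∑ i : Fin k, z i))
    * baFunction k m z (fun i : Fin k => μ i.castSucc)

/-- The constant `(-1)^{m k(k-1)/2} (m!)^k ∏_{i=1}^k (μ_{k+1} - μ_i)^{-m-1}`. -/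
def constC (k m : ℕ) (μ : Fin (k + 1) → ℂ) : ℂ :=
  (-1) ^ (m * k.choose 2) * (m.factorial : ℂ) ^ k
    * ∏ i : Fin k, ((μ (Fin.last k) - μ i.castSucc) ^ (m + 1))⁻¹

end RationalBA

end

/-! Write `H` for the Calogero-Moser operator plus `(μ, μ)`, and put `N = m * n.choose 2`. Functions
of the form `p / A ^ M * exp (μ, x)` are handled through their numerators: `step` is the action of
`H` on `p`, with the denominator exponent raised by two. If `p` has top-degree part `A ^ M * q`,
then `step` returns top part `A ^ (M + 2) * (-2 ∂_μ q)`, with `∂_μ` the derivative in the direction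
`μ`. So `H` acts to leading order as `-2 ∂_μ`, and lowers the degree.

Uniqueness (`eq_zero_of_step_eq_zero`): if `H` kills `p / A ^ M * exp (μ, x)`, then the top part `q`
of `p` satisfies `A ∂_μ q = M (∂_μ A) q`. Along the line `x + t μ` this forces `q` to have degree `M
* n.choose 2` in `t`, because `A(μ) ≠ 0`. Hence no nonzero solution has numerator of smaller degree,
and a solution is determined by its leading term.

Existence (`exists_berest_sequence`) is Berest's formula: apply `H` repeatedly to `A ^ m * exp (μ,
x)`. Quasi-invariance of the numerators (vanishing odd normal derivatives on each `x_a = x_b`) keeps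
the pole order at `m`. Degrees drop at every step, so the sequence ends in zero. Uniqueness, read
backwards, shows that it is already zero after `N + 1` applications. The `N`-th term is therefore a
solution, and its leading term is the constant `(-2 ∂_μ)^N A ^ m = (-2)^N N! A(μ) ^ m` times `A ^
m`. Running this with generic `μ` makes the solution polynomial in `μ`. The degree bound in `μ`
follows from that in `x` by scaling `x` against `μ`.

Integral formula: the kernel `A(z,x)^m / (A(x)^m A(z)^m)` with its exponential intertwines `H` in `k
+ 1` variables with `H` in `k` variables up to total `τ`-derivatives (`kernel_intertwining`). These
integrate to zero: the boundary terms contain a factor `z_i - x_i = τ_i`, and the exponential decays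
at infinity. So the transform carries the Berest sequence `Q j` in `z` to iterates of `H` in `x`.
For `Q 0` the denominator `A(z)` cancels, and the integral is the Laplace transform of the
polynomial `A(z,x)^m`, with known top part (`contourIntegral_first`,
`laplace_kerCross_sub_mem_degLE`). After `N = m * k.choose 2` steps the left side is a multiple of
the required integral. The right side is annihilated by `H`, since `Q (N + 1) = 0`. Uniqueness
identifies it with the Baker-Akhiezer function, and comparing leading terms gives the constant. -/

noncomputable section

namespace RationalBA

open MvPolynomial

/-! ### Filtration by weighted degree -/

section Filtration

variable {σ R : Type*} [CommRing R]

/-- The polynomials all of whose monomials have `w`-weight at most `d`. -/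
def degLE (R : Type*) [CommRing R] (w : σ → ℕ) (d : ℤ) : Submodule R (MvPolynomial σ R) where
  carrier := {p | ∀ s ∈ p.support, (Finsupp.weight w s : ℤ) ≤ d}
  zero_mem' := by simp
  add_mem' := by
    classical
    intro p q hp hq s hs
    rcases Finset.mem_union.1 (support_add hs) with h | h
    exacts [hp s h, hq s h]
  smul_mem' := fun c p hp s hs => hp s (support_smul hs)

theorem degLE_mono {w : σ → ℕ} {d e : ℤ} (h : d ≤ e) {p : MvPolynomial σ R}
    (hp : p ∈ degLE R w d) : p ∈ degLE R w e := fun s hs => (hp s hs).trans h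

theorem mul_mem_degLE {w : σ → ℕ} {d e : ℤ} {p q : MvPolynomial σ R}
    (hp : p ∈ degLE R w d) (hq : q ∈ degLE R w e) : p * q ∈ degLE R w (d + e) := by
  classical
  intro s hs
  obtain ⟨a, ha, b, hb, rfl⟩ := Finset.mem_add.1 (support_mul p q hs)
  rw [map_add, Nat.cast_add]
  exact add_le_add (hp a ha) (hq b hb)

theorem mul_mem_degLE_of_eq {w : σ → ℕ} {d e f : ℤ} {p q : MvPolynomial σ R}
    (hp : p ∈ degLE R w d) (hq : q ∈ degLE R w e) (h : d + e = f) : p * q ∈ degLE R w f :=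
  h ▸ mul_mem_degLE hp hq

theorem C_mem_degLE {w : σ → ℕ} (c : R) : C c ∈ degLE R w 0 := by
  classical
  intro s hs
  rw [mem_support_iff, coeff_C] at hs
  have : s = 0 := by
    by_contra h
    exact hs (if_neg fun h' => h h'.symm)
  simp [this]

theorem one_mem_degLE {w : σ → ℕ} : (1 : MvPolynomial σ R) ∈ degLE R w 0 := by
  simpa using C_mem_degLE (w := w) (1 : R)

theorem X_mem_degLE (w : σ → ℕ) (i : σ) : (X i : MvPolynomial σ R) ∈ degLE R w (w i) := by
  classical
  intro s hs
  rw [mem_support_iff, coeff_X] at hs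
  have : Finsupp.single i 1 = s := by
    by_contra h
    exact hs (if_neg h)
  rw [← this, Finsupp.weight_single]
  simp

theorem C_mul_mem_degLE {w : σ → ℕ} {d : ℤ} {p : MvPolynomial σ R} (c : R)
    (hp : p ∈ degLE R w d) : C c * p ∈ degLE R w d :=
  mul_mem_degLE_of_eq (C_mem_degLE c) hp (zero_add d)

theorem prod_mem_degLE {ι : Type*} {w : σ → ℕ} (s : Finset ι) {d : ι → ℤ}
    {p : ι → MvPolynomial σ R} (hp : ∀ i ∈ s, p i ∈ degLE R w (d i)) :
    ∏ i ∈ s, p i ∈ degLE R w (∑ i ∈ s, d i) := by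
  classical
  induction s using Finset.induction_on with
  | empty => simpa using one_mem_degLE
  | insert a s ha ih =>
    rw [Finset.prod_insert ha, Finset.sum_insert ha]
    exact mul_mem_degLE (hp a (Finset.mem_insert_self a s))
      (ih fun i hi => hp i (Finset.mem_insert_of_mem hi))

theorem pow_mem_degLE {w : σ → ℕ} {d : ℤ} {p : MvPolynomial σ R} (hp : p ∈ degLE R w d) (n : ℕ) :
    p ^ n ∈ degLE R w (n * d) := by
  simpa using prod_mem_degLE (w := w) (Finset.range n) (d := fun _ => d) (p := fun _ => p)
    (fun _ _ => hp)

theorem pderiv_mem_degLE {w : σ → ℕ} {d : ℤ} {p : MvPolynomial σ R} (hp : p ∈ degLE R w d)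
    (i : σ) : pderiv i p ∈ degLE R w (d - w i) := by
  intro s hs
  rw [mem_support_iff, coeff_pderiv] at hs
  have := hp (s + Finsupp.single i 1) (mem_support_iff.2 (left_ne_zero_of_mul hs))
  rw [map_add, Finsupp.weight_single] at this
  push_cast at this
  simp at this
  linarith

/-- Degree bounds are integers so that they can be lowered without truncation. Once a bound is
negative nothing is left, which is how the Berest sequence terminates. -/
theorem eq_zero_of_mem_degLE_neg {w : σ → ℕ} {d : ℤ} (hd : d < 0) {p : MvPolynomial σ R}
    (hp : p ∈ degLE R w d) : p = 0 := by
  by_contra h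
  obtain ⟨s, hs⟩ := support_nonempty.2 h
  have := hp s hs
  have h2 : (0 : ℤ) ≤ (Finsupp.weight w s : ℤ) := Int.natCast_nonneg _
  linarith

theorem mem_degLE_of_isHomogeneous {d : ℕ} {p : MvPolynomial σ R} (hp : p.IsHomogeneous d) :
    p ∈ degLE R 1 d := by
  intro s hs
  rw [hp (mem_support_iff.1 hs)]

theorem eq_zero_of_isHomogeneous_of_mem_degLE {d : ℕ} {e : ℤ} (hde : e < d) {p : MvPolynomial σ R}
    (hp : p.IsHomogeneous d) (h : p ∈ degLE R 1 e) : p = 0 := by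
  by_contra h0
  obtain ⟨s, hs⟩ := support_nonempty.2 h0
  have := h s hs
  rw [hp (mem_support_iff.1 hs)] at this
  linarith

/-- The homogeneous component of top degree has a nonzero value and lower-order remainder. -/
theorem exists_top_component {p : MvPolynomial σ R} (hp : p ≠ 0) :
    ∃ (d : ℕ) (q : MvPolynomial σ R), q.IsHomogeneous d ∧ q ≠ 0 ∧ p - q ∈ degLE R 1 ((d : ℤ) - 1) ∧
      p ∈ degLE R 1 d ∧ ∃ s ∈ p.support, (Finsupp.weight (1 : σ → ℕ) s : ℤ) = d := by
  classical
  obtain ⟨s, hs, hmax⟩ := Finset.exists_max_image p.support (Finsupp.weight (1 : σ → ℕ))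
    (support_nonempty.2 hp)
  refine ⟨Finsupp.weight (1 : σ → ℕ) s, homogeneousComponent (Finsupp.weight (1 : σ → ℕ) s) p,
    homogeneousComponent_isHomogeneous _ _, ?_, ?_, ?_, s, hs, rfl⟩
  · intro h
    have h1 := congrArg (coeff s) h
    rw [homogeneousComponent, coeff_weightedHomogeneousComponent, if_pos rfl] at h1
    exact mem_support_iff.1 hs (by simpa using h1)
  · intro r hr
    rw [mem_support_iff, coeff_sub, homogeneousComponent, coeff_weightedHomogeneousComponent] at hr
    split_ifs at hr with h
    · simp at hr
    · rw [sub_zero] at hr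
      have h1 := hmax r (mem_support_iff.2 hr)
      have : Finsupp.weight (1 : σ → ℕ) r < Finsupp.weight (1 : σ → ℕ) s := lt_of_le_of_ne h1 h
      omega
  · intro r hr
    exact_mod_cast hmax r hr

/-- Over a domain the top component of `A * Y` is `A` times the top component of `Y`, so a degree
bound survives division by a homogeneous `A`. -/
theorem mem_degLE_of_mul_mem [IsDomain R] {a : ℕ} {d : ℤ} {A Y : MvPolynomial σ R}
    (hA : A.IsHomogeneous a) (hA0 : A ≠ 0) (h : A * Y ∈ degLE R 1 (a + d)) : Y ∈ degLE R 1 d := by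
  rcases eq_or_ne Y 0 with rfl | hY
  · exact zero_mem _
  obtain ⟨e, q, hq, hq0, hr, hYe, -⟩ := exists_top_component hY
  by_contra hcon
  have hde : d < e := by
    by_contra hle
    exact hcon (degLE_mono (not_lt.1 hle) hYe)
  refine mul_ne_zero hA0 hq0 (eq_zero_of_isHomogeneous_of_mem_degLE (e := a + e - 1) (by push_cast; linarith)
    (hA.mul hq) ?_)
  have h1 : A * q = A * Y - A * (Y - q) := by ring
  rw [h1]
  refine sub_mem (degLE_mono (by omega) h) (mul_mem_degLE_of_eq (mem_degLE_of_isHomogeneous hA) hr (by ring))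

end Filtration

/-! ### The conjugated Calogero-Moser operator on numerators -/

section Operators

variable {σ R : Type*} [CommRing R]

/-- The action of `∂_a` on the numerator `p` of a quotient `p / B ^ M * exp (∑ ℓ_a y_a)`; the result
is the numerator of a quotient with denominator `B ^ (M + 1)`. -/
def dOp (B : MvPolynomial σ R) (ℓ : σ → R) (M : ℕ) (a : σ) :
    MvPolynomial σ R →ₗ[R] MvPolynomial σ R :=
  LinearMap.mulLeft R B ∘ₗ (pderiv a : Derivation R _ _).toLinearMap
    - LinearMap.mulLeft R ((M : MvPolynomial σ R) * pderiv a B) + LinearMap.mulLeft R (C (ℓ a) * B)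

theorem dOp_apply (B : MvPolynomial σ R) (ℓ : σ → R) (M : ℕ) (a : σ) (p : MvPolynomial σ R) :
    dOp B ℓ M a p = B * pderiv a p - (M : MvPolynomial σ R) * pderiv a B * p + C (ℓ a) * B * p := rfl

/-- Consistency of the numerator calculus: `p / B ^ M` and `B p / B ^ (M + 1)` are the same
function. -/
theorem dOp_succ_mul (B : MvPolynomial σ R) (ℓ : σ → R) (M : ℕ) (a : σ) (p : MvPolynomial σ R) :
    dOp B ℓ (M + 1) a (B * p) = B * dOp B ℓ M a p := by
  simp only [dOp_apply, pderiv_mul]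
  push_cast
  ring

theorem dOp_dOp (B : MvPolynomial σ R) (ℓ : σ → R) (M : ℕ) (a : σ) (p : MvPolynomial σ R) :
    dOp B ℓ (M + 1) a (dOp B ℓ M a p) =
      B ^ 2 * pderiv a (pderiv a p) - 2 * (M : MvPolynomial σ R) * B * pderiv a B * pderiv a p
        - (M : MvPolynomial σ R) * B * pderiv a (pderiv a B) * p + (M : MvPolynomial σ R) * ((M : MvPolynomial σ R) + 1) * pderiv a B ^ 2 * p
        + 2 * C (ℓ a) * B ^ 2 * pderiv a p - 2 * (M : MvPolynomial σ R) * C (ℓ a) * B * pderiv a B * p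
        + C (ℓ a) ^ 2 * B ^ 2 * p := by
  have hM : pderiv a (M : MvPolynomial σ R) = 0 := by
    rw [← map_natCast C, pderiv_C]
  simp only [dOp_apply, map_add, map_sub, pderiv_mul, pderiv_C, hM]
  push_cast
  ring

theorem natCast_mul_mem_degLE {d : ℤ} {p : MvPolynomial σ R} (k : ℕ) (hp : p ∈ degLE R 1 d) :
    (k : MvPolynomial σ R) * p ∈ degLE R 1 d := by
  rw [← map_natCast C]
  exact C_mul_mem_degLE _ hp

variable [Fintype σ]

/-- The directional derivative `(ν, ∇)`. -/
def dirDeriv (ν : σ → R) : MvPolynomial σ R →ₗ[R] MvPolynomial σ R :=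
  ∑ i, LinearMap.mulLeft R (C (ν i)) ∘ₗ (pderiv i : Derivation R _ _).toLinearMap

theorem dirDeriv_apply (ν : σ → R) (p : MvPolynomial σ R) :
    dirDeriv ν p = ∑ i, C (ν i) * pderiv i p := by
  simp [dirDeriv]

theorem dirDeriv_mul (ν : σ → R) (p q : MvPolynomial σ R) :
    dirDeriv ν (p * q) = dirDeriv ν p * q + p * dirDeriv ν q := by
  simp only [dirDeriv_apply, pderiv_mul, Finset.sum_mul, Finset.mul_sum, ← Finset.sum_add_distrib]
  exact Finset.sum_congr rfl fun i _ => by ring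

theorem dirDeriv_pow (ν : σ → R) (p : MvPolynomial σ R) (k : ℕ) :
    p * dirDeriv ν (p ^ k) = k * p ^ k * dirDeriv ν p := by
  induction k with
  | zero => simp [dirDeriv_apply]
  | succ k ih =>
    rw [pow_succ, dirDeriv_mul, mul_add, ← mul_assoc, ih]
    push_cast
    ring

theorem dirDeriv_mem_degLE {d : ℤ} (ν : σ → R) {p : MvPolynomial σ R} (hp : p ∈ degLE R 1 d) :
    dirDeriv ν p ∈ degLE R 1 (d - 1) := by
  rw [dirDeriv_apply]
  refine sum_mem fun i _ => C_mul_mem_degLE _ ?_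
  simpa using pderiv_mem_degLE hp i

theorem isHomogeneous_dirDeriv {d : ℕ} (ν : σ → R) {p : MvPolynomial σ R} (hp : p.IsHomogeneous d) :
    (dirDeriv ν p).IsHomogeneous (d - 1) := by
  rw [dirDeriv_apply]
  refine IsHomogeneous.sum _ _ _ fun i _ => ?_
  simpa using (isHomogeneous_C σ (ν i)).mul (hp.pderiv (i := i))

/-- The operator on numerators induced by the shifted Schroedinger operator
`-Δ + m (m + 1) ∑ (∂_i A / A) ^ 2 + (ν, ν)` acting on `p / A ^ M * exp (ν, x)`. -/
def step (A : MvPolynomial σ R) (ν : σ → R) (m M : ℕ) : MvPolynomial σ R →ₗ[R] MvPolynomial σ R :=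
  -(∑ i, dOp A ν (M + 1) i ∘ₗ dOp A ν M i)
    + LinearMap.mulLeft R ((m : MvPolynomial σ R) * (m + 1) * ∑ i, pderiv i A ^ 2)
    + LinearMap.mulLeft R ((∑ i, C (ν i) ^ 2) * A ^ 2)

theorem step_apply (A : MvPolynomial σ R) (ν : σ → R) (m M : ℕ) (p : MvPolynomial σ R) :
    step A ν m M p = -(∑ i, dOp A ν (M + 1) i (dOp A ν M i p))
      + (m : MvPolynomial σ R) * ((m : MvPolynomial σ R) + 1) * (∑ i, pderiv i A ^ 2) * p + (∑ i, C (ν i) ^ 2) * A ^ 2 * p := by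
  simp [step, mul_assoc]

theorem step_succ_mul (A : MvPolynomial σ R) (ν : σ → R) (m M : ℕ) (p : MvPolynomial σ R) :
    step A ν m (M + 1) (A * p) = A * step A ν m M p := by
  simp only [step_apply, dOp_succ_mul, ← Finset.mul_sum]
  ring

theorem step_add_pow_mul (A : MvPolynomial σ R) (ν : σ → R) (m M k : ℕ) (p : MvPolynomial σ R) :
    step A ν m (M + k) (A ^ k * p) = A ^ k * step A ν m M p := by
  induction k with
  | zero => simp
  | succ k ih => rw [pow_succ', mul_assoc, ← add_assoc, step_succ_mul, ih, mul_assoc]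

/-- Separates the terms linear in `ν`. The `ν`-quadratic terms cancel against the shift `(ν, ν)`,
and the right-hand side involves two derivatives in each term. -/
theorem step_expand (A : MvPolynomial σ R) (ν : σ → R) (m M : ℕ) (p : MvPolynomial σ R) :
    step A ν m M p + 2 * A ^ 2 * dirDeriv ν p - 2 * M * A * dirDeriv ν A * p =
      -∑ i, (A ^ 2 * pderiv i (pderiv i p) - 2 * M * A * pderiv i A * pderiv i p
        - M * A * pderiv i (pderiv i A) * p
        + (M * (M + 1) - m * (m + 1)) * (pderiv i A ^ 2 * p)) := by
  rw [step_apply, dirDeriv_apply, dirDeriv_apply]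
  simp only [dOp_dOp, Finset.sum_mul, Finset.mul_sum, ← Finset.sum_neg_distrib,
    ← Finset.sum_add_distrib, ← Finset.sum_sub_distrib]
  exact Finset.sum_congr rfl fun i _ => by ring

theorem step_expand_mem {A : MvPolynomial σ R} {a : ℕ} (hA : A.IsHomogeneous a) (ν : σ → R)
    (m M : ℕ) {d : ℤ} {p : MvPolynomial σ R} (hp : p ∈ degLE R 1 d) :
    step A ν m M p + 2 * A ^ 2 * dirDeriv ν p - 2 * M * A * dirDeriv ν A * p
      ∈ degLE R 1 (2 * a + d - 2) := by
  have hA' := mem_degLE_of_isHomogeneous hA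
  have hp1 := fun i => pderiv_mem_degLE hp i
  have hp2 := fun i => pderiv_mem_degLE (hp1 i) i
  have hA1 := fun i => pderiv_mem_degLE hA' i
  have hA2 := fun i => pderiv_mem_degLE (hA1 i) i
  simp only [Pi.one_apply, Nat.cast_one] at hp1 hp2 hA1 hA2
  rw [step_expand]
  refine neg_mem (sum_mem fun i _ => ?_)
  have e1 : A ^ 2 * pderiv i (pderiv i p) ∈ degLE R 1 (2 * a + d - 2) :=
    mul_mem_degLE_of_eq (pow_mem_degLE hA' 2) (hp2 i) (by push_cast; ring)
  have e2 : A * pderiv i A * pderiv i p ∈ degLE R 1 (2 * a + d - 2) :=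
    mul_mem_degLE_of_eq (mul_mem_degLE hA' (hA1 i)) (hp1 i) (by ring)
  have e3 : A * pderiv i (pderiv i A) * p ∈ degLE R 1 (2 * a + d - 2) :=
    mul_mem_degLE_of_eq (mul_mem_degLE hA' (hA2 i)) hp (by ring)
  have e4 : pderiv i A ^ 2 * p ∈ degLE R 1 (2 * a + d - 2) :=
    mul_mem_degLE_of_eq (pow_mem_degLE (hA1 i) 2) hp (by push_cast; ring)
  have key : A ^ 2 * pderiv i (pderiv i p) - 2 * M * A * pderiv i A * pderiv i p
        - M * A * pderiv i (pderiv i A) * p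
        + (M * (M + 1) - m * (m + 1)) * (pderiv i A ^ 2 * p) =
      A ^ 2 * pderiv i (pderiv i p) - ((2 * M : ℕ) : MvPolynomial σ R) * (A * pderiv i A * pderiv i p)
        - (M : ℕ) * (A * pderiv i (pderiv i A) * p)
        + (((M * (M + 1) : ℕ) : MvPolynomial σ R) * (pderiv i A ^ 2 * p)
          - ((m * (m + 1) : ℕ) : MvPolynomial σ R) * (pderiv i A ^ 2 * p)) := by
    push_cast
    ring
  rw [key]
  exact add_mem (sub_mem (sub_mem e1 (natCast_mul_mem_degLE _ e2)) (natCast_mul_mem_degLE _ e3))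
    (sub_mem (natCast_mul_mem_degLE _ e4) (natCast_mul_mem_degLE _ e4))

/-- The effect of `step` on the part of top degree. -/
theorem step_top {A : MvPolynomial σ R} {a : ℕ} (hA : A.IsHomogeneous a) (ν : σ → R)
    (m M : ℕ) {e : ℤ} {p q : MvPolynomial σ R} (hq : q ∈ degLE R 1 e)
    (hp : p - A ^ M * q ∈ degLE R 1 (M * a + e - 1)) :
    step A ν m M p - A ^ (M + 2) * (-2 * dirDeriv ν q)
      ∈ degLE R 1 ((M + 2 : ℕ) * a + (e - 1) - 1) := by
  have hA' := mem_degLE_of_isHomogeneous hA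
  have hAq : A ^ M * q ∈ degLE R 1 (M * a + e) := mul_mem_degLE (pow_mem_degLE hA' M) hq
  have hp' : p ∈ degLE R 1 (M * a + e) := by
    have := add_mem (degLE_mono (by linarith) hp) hAq
    simpa using this
  have h1 := step_expand_mem hA ν m M hp'
  set r := p - A ^ M * q with hr
  have hpr : p = A ^ M * q + r := by rw [hr]; ring
  have h2 : A ^ 2 * dirDeriv ν r ∈ degLE R 1 (2 * a + (M * a + e) - 2) :=
    mul_mem_degLE_of_eq (pow_mem_degLE hA' 2) (dirDeriv_mem_degLE ν hp) (by push_cast; ring)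
  have h3 : A * dirDeriv ν A * r ∈ degLE R 1 (2 * a + (M * a + e) - 2) :=
    mul_mem_degLE_of_eq (mul_mem_degLE hA' (dirDeriv_mem_degLE ν hA')) hp (by ring)
  have key : step A ν m M p - A ^ (M + 2) * (-2 * dirDeriv ν q) =
      (step A ν m M p + 2 * A ^ 2 * dirDeriv ν p - 2 * M * A * dirDeriv ν A * p)
      - (2 : ℕ) * (A ^ 2 * dirDeriv ν r) + ((2 * M : ℕ) : MvPolynomial σ R) * (A * dirDeriv ν A * r) := by
    -- Differentiating the factor `A ^ M` cancels the derivative of the denominator, so only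
    -- `dirDeriv ν q` survives at top degree.
    have h5 := dirDeriv_pow ν A M
    have h6 : dirDeriv ν p = dirDeriv ν (A ^ M) * q + A ^ M * dirDeriv ν q + dirDeriv ν r := by
      rw [hpr, map_add, dirDeriv_mul]
    rw [h6]
    nth_rw 3 [hpr]
    push_cast
    linear_combination (-2 * A * q) * h5
  rw [key]
  refine degLE_mono (le_of_eq ?_) (add_mem (sub_mem h1 (natCast_mul_mem_degLE _ h2)) (natCast_mul_mem_degLE _ h3))
  push_cast
  ring

end Operators

/-! ### Vandermonde products -/

section Vandermonde

theorem map_vdm {R S : Type*} [CommRing R] [CommRing S] {n : ℕ} (f : R →+* S) (u : Fin n → R) :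
    f (vdm u) = vdm (fun i => f (u i)) := by
  simp [vdm, map_prod]

theorem vdm_ne_zero {R : Type*} [CommRing R] [IsDomain R] {n : ℕ} {u : Fin n → R}
    (hu : Function.Injective u) : vdm u ≠ 0 := by
  refine Finset.prod_ne_zero_iff.2 fun i _ => Finset.prod_ne_zero_iff.2 fun j hj => ?_
  exact sub_ne_zero.2 (hu.ne (Finset.mem_Ioi.1 hj).ne)

theorem sum_card_Ioi (n : ℕ) : ∑ i : Fin n, (Finset.Ioi i).card = n.choose 2 := by
  simp only [Fin.card_Ioi]
  rw [Finset.sum_range (fun i => n - 1 - i) |>.symm, Finset.sum_range_reflect (fun i => i) n,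
    Finset.sum_range_id, Nat.choose_two_right]

theorem isHomogeneous_vdm {σ R : Type*} [CommRing R] {n : ℕ} {u : Fin n → MvPolynomial σ R}
    (hu : ∀ i, (u i).IsHomogeneous 1) : (vdm u).IsHomogeneous (n.choose 2) := by
  rw [← sum_card_Ioi]
  refine IsHomogeneous.prod _ _ _ fun i _ => ?_
  rw [Finset.card_eq_sum_ones]
  exact IsHomogeneous.prod _ _ _ fun j _ => (hu i).sub (hu j)

theorem natDegree_vdm_le {R : Type*} [CommRing R] {n : ℕ} {u : Fin n → Polynomial R}
    (hu : ∀ i, (u i).natDegree ≤ 1) : (vdm u).natDegree ≤ n.choose 2 := by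
  rw [← sum_card_Ioi]
  refine (Polynomial.natDegree_prod_le _ _).trans (Finset.sum_le_sum fun i _ => ?_)
  rw [Finset.card_eq_sum_ones]
  exact (Polynomial.natDegree_prod_le _ _).trans
    (Finset.sum_le_sum fun j _ => (Polynomial.natDegree_sub_le _ _).trans (max_le (hu i) (hu j)))

theorem coeff_prod_of_natDegree_le_fun {R ι : Type*} [CommRing R] (s : Finset ι)
    (f : ι → Polynomial R) (d : ι → ℕ) (h : ∀ i ∈ s, (f i).natDegree ≤ d i) :
    (∏ i ∈ s, f i).coeff (∑ i ∈ s, d i) = ∏ i ∈ s, (f i).coeff (d i) := by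
  classical
  induction s using Finset.induction_on with
  | empty => simp
  | insert a s ha ih =>
    have hs : ∀ i ∈ s, (f i).natDegree ≤ d i := fun i hi => h i (Finset.mem_insert_of_mem hi)
    rw [Finset.prod_insert ha, Finset.sum_insert ha, Finset.prod_insert ha, ← ih hs]
    exact Polynomial.coeff_mul_add_eq_of_natDegree_le (h a (Finset.mem_insert_self a s))
      ((Polynomial.natDegree_prod_le _ _).trans (Finset.sum_le_sum hs))

theorem coeff_vdm {R : Type*} [CommRing R] {n : ℕ} {u : Fin n → Polynomial R}
    (hu : ∀ i, (u i).natDegree ≤ 1) :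
    (vdm u).coeff (n.choose 2) = vdm (fun i => (u i).coeff 1) := by
  have h1 : ∀ i j, (u i - u j).natDegree ≤ 1 := fun i j =>
    (Polynomial.natDegree_sub_le _ _).trans (max_le (hu i) (hu j))
  rw [← sum_card_Ioi]
  unfold vdm
  rw [coeff_prod_of_natDegree_le_fun]
  · refine Finset.prod_congr rfl fun i _ => ?_
    rw [Finset.card_eq_sum_ones, coeff_prod_of_natDegree_le_fun]
    · simp
    · exact fun j _ => h1 i j
  · intro i _
    rw [Finset.card_eq_sum_ones]
    exact (Polynomial.natDegree_prod_le _ _).trans (Finset.sum_le_sum fun j _ => h1 i j)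

end Vandermonde

/-! ### Translation in the direction `ν` -/

section Translation

variable {σ R : Type*} [CommRing R]

/-- The substitution `x ↦ x + t ν`. -/
def translate (ν : σ → R) : MvPolynomial σ R →ₐ[R] Polynomial (MvPolynomial σ R) :=
  aeval fun i => Polynomial.C (X i) + Polynomial.X * Polynomial.C (C (ν i))

theorem translate_X (ν : σ → R) (i : σ) :
    translate ν (X i) = Polynomial.C (X i) + Polynomial.X * Polynomial.C (C (ν i)) := by
  simp [translate]

theorem translate_C (ν : σ → R) (c : R) : translate ν (C c) = Polynomial.C (C c) := by
  simp [translate, Polynomial.algebraMap_apply, MvPolynomial.algebraMap_eq]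

theorem natDegree_translate_X_le (ν : σ → R) (i : σ) : (translate ν (X i)).natDegree ≤ 1 := by
  rw [translate_X]
  compute_degree

theorem coeff_one_translate_X (ν : σ → R) (i : σ) : (translate ν (X i)).coeff 1 = C (ν i) := by
  simp [translate_X, Polynomial.coeff_C]

theorem coeff_zero_translate (ν : σ → R) (p : MvPolynomial σ R) : (translate ν p).coeff 0 = p := by
  induction p using MvPolynomial.induction_on with
  | C a => simp
  | add p q hp hq => simp [hp, hq]
  | mul_X p i hp => simp [hp, translate_X, Polynomial.mul_coeff_zero]

theorem derivative_translate [Fintype σ] (ν : σ → R) (p : MvPolynomial σ R) :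
    Polynomial.derivative (translate ν p) = translate ν (dirDeriv ν p) := by
  classical
  induction p using MvPolynomial.induction_on with
  | C a => simp [dirDeriv_apply]
  | add p q hp hq => simp [hp, hq]
  | mul_X p i hp =>
    have : dirDeriv ν (X i) = C (ν i) := by
      simp [dirDeriv_apply, pderiv_X, Pi.single_apply]
    rw [map_mul, Polynomial.derivative_mul, hp, dirDeriv_mul, map_add, map_mul, map_mul, this,
      translate_C, translate_X]
    simp

theorem natDegree_translate_le (ν : σ → R) {d : ℕ} {p : MvPolynomial σ R} (hp : p ∈ degLE R 1 d) :
    (translate ν p).natDegree ≤ d := by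
  rw [p.as_sum, map_sum]
  refine Polynomial.natDegree_sum_le_of_forall_le _ _ fun s hs => ?_
  rw [monomial_eq, map_mul, translate_C, Finsupp.prod, map_prod]
  refine (Polynomial.natDegree_C_mul_le _ _).trans ((Polynomial.natDegree_prod_le _ _).trans ?_)
  have h1 := hp s hs
  rw [Finsupp.weight_apply] at h1
  simp only [Finsupp.sum, Pi.one_apply, smul_eq_mul, mul_one, Nat.cast_le] at h1
  refine le_trans (Finset.sum_le_sum fun i _ => ?_) h1
  rw [map_pow]
  simpa using Polynomial.natDegree_pow_le_of_le (s i) (natDegree_translate_X_le ν i)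

/-- Taylor's formula along the line `x + t ν`: iterated directional derivatives are the coefficients
in `t`. -/
theorem dirDeriv_iterate_eq [Fintype σ] (ν : σ → R) (k : ℕ) (p : MvPolynomial σ R) :
    (dirDeriv ν)^[k] p = k.factorial * (translate ν p).coeff k := by
  have h : ∀ j, (Polynomial.derivative^[j]) (translate ν p) = translate ν ((dirDeriv ν)^[j] p) := by
    intro j
    induction j with
    | zero => rfl
    | succ j ih => rw [Function.iterate_succ_apply', Function.iterate_succ_apply', ih,
        derivative_translate]
  rw [← coeff_zero_translate ν ((dirDeriv ν)^[k] p), ← h, Polynomial.coeff_iterate_derivative]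
  simp [Nat.descFactorial_self]

/-- The number of derivatives equals the degree, so only the top coefficient in `t` survives, and
there `X i` is replaced by `ν i`. The map `ι` allows a Vandermonde product in part of the variables.
-/
theorem dirDeriv_iterate_vdm_pow [Fintype σ] (ν : σ → R) {n : ℕ} (ι : Fin n → σ) (m : ℕ) :
    (dirDeriv ν)^[m * n.choose 2] (vdm (fun i => X (ι i)) ^ m : MvPolynomial σ R) =
      C ((m * n.choose 2).factorial * vdm (fun i => ν (ι i)) ^ m) := by
  rw [dirDeriv_iterate_eq, map_pow]
  have h1 : translate ν (vdm fun i => X (ι i)) = vdm fun i => translate ν (X (ι i)) :=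
    map_vdm (translate ν).toRingHom _
  have h2 : ∀ i, (translate ν (X (ι i))).natDegree ≤ 1 := fun i => natDegree_translate_X_le _ _
  rw [h1, Polynomial.coeff_pow_of_natDegree_le (natDegree_vdm_le h2), coeff_vdm h2]
  simp only [coeff_one_translate_X]
  rw [← map_vdm (C : R →+* MvPolynomial σ R) (fun i => ν (ι i))]
  simp

end Translation

/-! ### Uniqueness of solutions of negative degree -/

section Uniqueness

variable {R : Type*} [CommRing R]

theorem X_mul_derivative_coeff {S : Type*} [CommRing S] (f : Polynomial S) (d : ℕ) :
    (Polynomial.X * Polynomial.derivative f).coeff d = d * f.coeff d := by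
  cases d with
  | zero => simp
  | succ d => rw [Polynomial.coeff_X_mul, Polynomial.coeff_derivative]; push_cast; ring

/-- The equation says that `f / g ^ M` has zero derivative. Multiplying by `X` turns the derivative
into the Euler operator, whose leading coefficient is the degree times that of `f`. Comparing
leading coefficients avoids fractions. -/
theorem natDegree_eq_mul_of_derivative {S : Type*} [CommRing S] [IsDomain S] [CharZero S]
    {f g : Polynomial S} {M : ℕ} (hf : f ≠ 0) (hg : g ≠ 0)
    (h : g * Polynomial.derivative f = M * Polynomial.derivative g * f) :
    f.natDegree = M * g.natDegree := by
  have hX : ∀ u : Polynomial S, (Polynomial.X * Polynomial.derivative u).natDegree ≤ u.natDegree := by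
    intro u
    refine Polynomial.natDegree_le_iff_coeff_eq_zero.2 fun N hN => ?_
    rw [X_mul_derivative_coeff, Polynomial.coeff_eq_zero_of_natDegree_lt hN, mul_zero]
  have h1 : g * (Polynomial.X * Polynomial.derivative f) =
      (M : Polynomial S) * ((Polynomial.X * Polynomial.derivative g) * f) := by
    linear_combination Polynomial.X * h
  have h2 := congrArg (fun u => Polynomial.coeff u (g.natDegree + f.natDegree)) h1
  rw [Polynomial.coeff_mul_add_eq_of_natDegree_le le_rfl (hX f), ← Polynomial.C_eq_natCast,
    Polynomial.coeff_C_mul,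
    Polynomial.coeff_mul_add_eq_of_natDegree_le (hX g) le_rfl, X_mul_derivative_coeff,
    X_mul_derivative_coeff] at h2
  have hf' : f.coeff f.natDegree ≠ 0 := Polynomial.leadingCoeff_ne_zero.2 hf
  have hg' : g.coeff g.natDegree ≠ 0 := Polynomial.leadingCoeff_ne_zero.2 hg
  have h3 : (f.natDegree : S) = ((M * g.natDegree : ℕ) : S) := by
    push_cast
    apply mul_right_cancel₀ (mul_ne_zero hf' hg')
    linear_combination h2
  exact_mod_cast h3

/-- The top part `q` satisfies `A ∂_ν q = M (∂_ν A) q`, so on lines in direction `ν` its degree is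
`M` times that of `A`. Distinct `ν i` make the latter exactly `n.choose 2`, too large for the
assumed bound. -/
theorem eq_zero_of_step_eq_zero [IsDomain R] [CharZero R] {n : ℕ} {ν : Fin n → R}
    (hν : Function.Injective ν) {m M : ℕ} {p : MvPolynomial (Fin n) R}
    (hp : p ∈ degLE R 1 (M * n.choose 2 - 1)) (h : step (vdm X) ν m M p = 0) : p = 0 := by
  by_contra hp0
  obtain ⟨d, q, hq, hq0, hr, hpd, s, hs, hsd⟩ := exists_top_component hp0
  have hd : (d : ℤ) ≤ M * n.choose 2 - 1 := hsd ▸ hp s hs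
  set A : MvPolynomial (Fin n) R := vdm X with hAdef
  have hA : A.IsHomogeneous (n.choose 2) := isHomogeneous_vdm fun i => isHomogeneous_X R i
  have hA' := mem_degLE_of_isHomogeneous hA
  have hA0 : A ≠ 0 := vdm_ne_zero X_injective
  have h1 := step_expand_mem hA ν m M hpd
  rw [h, zero_add] at h1
  have h2 : A * dirDeriv ν (p - q) ∈ degLE R 1 (n.choose 2 + (d - 2)) :=
    mul_mem_degLE_of_eq hA' (dirDeriv_mem_degLE ν hr) (by ring)
  have h3 : dirDeriv ν A * (p - q) ∈ degLE R 1 (n.choose 2 + (d - 2)) :=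
    mul_mem_degLE_of_eq (dirDeriv_mem_degLE ν hA') hr (by ring)
  have h5 : A * dirDeriv ν p - M * dirDeriv ν A * p ∈ degLE R 1 (n.choose 2 + (d - 2)) := by
    have hA2 : (C (2 : R) * A).IsHomogeneous (n.choose 2) := hA.C_mul 2
    refine mem_degLE_of_mul_mem hA2 (mul_ne_zero (by simp) hA0) ?_
    have e : C (2 : R) * A * (A * dirDeriv ν p - (M : MvPolynomial (Fin n) R) * dirDeriv ν A * p) =
        2 * A ^ 2 * dirDeriv ν p - 2 * (M : MvPolynomial (Fin n) R) * A * dirDeriv ν A * p := by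
      rw [map_ofNat]; ring
    rw [e]
    exact degLE_mono (by linarith) h1
  have h6 : A * dirDeriv ν q - M * dirDeriv ν A * q ∈ degLE R 1 (n.choose 2 + (d - 2)) := by
    have e : A * dirDeriv ν q - M * dirDeriv ν A * q = (A * dirDeriv ν p - M * dirDeriv ν A * p)
        - A * dirDeriv ν (p - q) + M * (dirDeriv ν A * (p - q)) := by
      rw [map_sub]; ring
    rw [e]
    exact add_mem (sub_mem h5 h2) (natCast_mul_mem_degLE _ h3)
  have h7 : A * dirDeriv ν q - M * dirDeriv ν A * q = 0 := by
    -- Degree zero is separated because `d - 1` is a truncated subtraction; there the derivative is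
    -- zero anyway.
    have hD : ∀ {e : ℕ} {f : MvPolynomial (Fin n) R}, f.IsHomogeneous e → e = 0 →
        dirDeriv ν f = 0 := fun {e f} hf he =>
      eq_zero_of_mem_degLE_neg (by norm_num)
        (dirDeriv_mem_degLE ν (d := 0) (by simpa [he] using mem_degLE_of_isHomogeneous hf))
    have e1 : (A * dirDeriv ν q).IsHomogeneous (n.choose 2 + d - 1) := by
      rcases Nat.eq_zero_or_pos d with h0 | h0
      · rw [hD hq h0, mul_zero]
        exact isHomogeneous_zero _ _ _
      · rw [Nat.add_sub_assoc h0]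
        exact hA.mul (isHomogeneous_dirDeriv ν hq)
    have e2 : (dirDeriv ν A * q).IsHomogeneous (n.choose 2 + d - 1) := by
      rcases Nat.eq_zero_or_pos (n.choose 2) with h0 | h0
      · rw [hD hA h0, zero_mul]
        exact isHomogeneous_zero _ _ _
      · rw [Nat.sub_add_comm h0]
        exact (isHomogeneous_dirDeriv ν hA).mul hq
    refine eq_zero_of_isHomogeneous_of_mem_degLE (d := n.choose 2 + d - 1)
      (e := n.choose 2 + (d - 2)) (by omega) (e1.sub ?_) h6
    rw [mul_assoc, ← map_natCast C]
    exact e2.C_mul _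
  have h8 := natDegree_eq_mul_of_derivative (f := translate ν q) (g := translate ν A) (M := M)
    (fun h0 => hq0 (by rw [← coeff_zero_translate ν q, h0, Polynomial.coeff_zero]))
    (fun h0 => hA0 (by rw [← coeff_zero_translate ν A, h0, Polynomial.coeff_zero]))
    (by
      rw [derivative_translate, derivative_translate, ← map_natCast (translate ν), ← map_mul,
        ← map_mul, ← map_mul, sub_eq_zero.1 h7])
  have h9 : (translate ν A).natDegree = n.choose 2 := by
    have h1 : translate ν A = vdm fun i => translate ν (X i) :=
      map_vdm (translate ν).toRingHom _
    have h2 : ∀ i, (translate ν (X i)).natDegree ≤ 1 := fun i => natDegree_translate_X_le _ _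
    refine le_antisymm (h1 ▸ natDegree_vdm_le h2) (Polynomial.le_natDegree_of_ne_zero ?_)
    rw [h1, coeff_vdm h2]
    simp only [coeff_one_translate_X]
    exact vdm_ne_zero ((C_injective _ _).comp hν)
  have h10 := natDegree_translate_le ν (mem_degLE_of_isHomogeneous hq)
  rw [h8, h9] at h10
  zify at h10
  linarith

end Uniqueness

/-! ### Logarithmic derivatives of Vandermonde products -/

section LogDeriv

theorem sum_sum_eq_sum_Ioi {A : Type*} [AddCommMonoid A] {n : ℕ} (f : Fin n → Fin n → A) :
    ∑ i, ∑ j, f i j = ∑ i, ∑ j ∈ Finset.Ioi i, (f i j + f j i) + ∑ i, f i i := by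
  have h1 : ∀ i, ∑ j, f i j = ∑ j ∈ Finset.Ioi i, f i j + ∑ j ∈ Finset.Iio i, f i j + f i i := by
    intro i
    rw [← Finset.sum_filter_add_sum_filter_not Finset.univ (fun j => i < j)]
    rw [← Finset.sum_filter_add_sum_filter_not (Finset.univ.filter fun j => ¬ i < j) (fun j => j < i)]
    rw [add_assoc]
    congr 1
    · exact Finset.sum_congr (by ext; simp) fun _ _ => rfl
    congr 1
    · refine Finset.sum_congr (by ext j; simp; exact le_of_lt) fun _ _ => rfl
    · rw [← Finset.sum_singleton (f i) i]
      refine Finset.sum_congr (by ext j; simp; exact ⟨fun h => le_antisymm h.1 h.2, by rintro rfl; simp⟩)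
        fun _ _ => rfl
  simp only [h1, Finset.sum_add_distrib]
  congr 2
  exact Finset.sum_comm' (by simp)

/-- The convention `0⁻¹ = 0` silently removes the diagonal terms, here and in all later sums of `(y
a - y b)⁻¹`. -/
theorem sum_Ioi_sub_mul {K : Type*} [Field K] {n : ℕ} (v u : Fin n → K) :
    ∑ i, ∑ j ∈ Finset.Ioi i, (v i - v j) / (u i - u j) = ∑ i, v i * ∑ j, (u i - u j)⁻¹ := by
  simp only [Finset.mul_sum]
  rw [sum_sum_eq_sum_Ioi]
  simp only [sub_self, inv_zero, mul_zero, Finset.sum_const_zero, add_zero]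
  refine Finset.sum_congr rfl fun i _ => Finset.sum_congr rfl fun j _ => ?_
  rw [← neg_sub (u i) (u j), inv_neg]
  ring

variable {S K : Type*} [CommRing S] [Field K]

/-- Logarithmic differentiation for a derivation along `ev`. The twisted form covers both a
polynomial derivative followed by evaluation and a genuine derivation of a field. -/
theorem twisted_prod {ι : Type*} (ev : S →+* K) (δ : S →+ K)
    (hδ : ∀ a b, δ (a * b) = ev a * δ b + ev b * δ a) (s : Finset ι) (f : ι → S)
    (hf : ∀ i ∈ s, ev (f i) ≠ 0) :
    δ (∏ i ∈ s, f i) = ev (∏ i ∈ s, f i) * ∑ i ∈ s, δ (f i) / ev (f i) := by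
  classical
  induction s using Finset.induction_on with
  | empty =>
    have := hδ 1 1
    simp at this ⊢
    exact this
  | insert a s ha ih =>
    have h1 := hf a (Finset.mem_insert_self a s)
    rw [Finset.prod_insert ha, Finset.sum_insert ha, hδ, map_mul,
      ih fun i hi => hf i (Finset.mem_insert_of_mem hi)]
    field_simp
    ring

theorem twisted_vdm (ev : S →+* K) (δ : S →+ K)
    (hδ : ∀ a b, δ (a * b) = ev a * δ b + ev b * δ a) {n : ℕ} {u : Fin n → S}
    (hu : Function.Injective fun i => ev (u i)) :
    δ (vdm u) = ev (vdm u) * ∑ i, δ (u i) * ∑ j, (ev (u i) - ev (u j))⁻¹ := by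
  have h1 : ∀ i, ∀ j ∈ Finset.Ioi i, ev (u i - u j) ≠ 0 := by
    intro i j hj
    rw [map_sub]
    exact sub_ne_zero.2 (hu.ne (Finset.mem_Ioi.1 hj).ne)
  unfold vdm
  rw [twisted_prod ev δ hδ]
  · rw [← sum_Ioi_sub_mul]
    congr 1
    refine Finset.sum_congr rfl fun i _ => ?_
    rw [twisted_prod ev δ hδ _ _ (h1 i), mul_div_cancel_left₀]
    · simp
    · rw [map_prod]
      exact Finset.prod_ne_zero_iff.2 (h1 i)
  · intro i _
    rw [map_prod]
    exact Finset.prod_ne_zero_iff.2 (h1 i)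

/-- The gradient of the Vandermonde polynomial. -/
theorem map_pderiv_vdm {R : Type*} [CommRing R] {n : ℕ} (ev : MvPolynomial (Fin n) R →+* K)
    (hev : Function.Injective fun i => ev (X i)) (i : Fin n) :
    ev (pderiv i (vdm X)) = ev (vdm X) * ∑ j, (ev (X i) - ev (X j))⁻¹ := by
  have := twisted_vdm ev (ev.toAddMonoidHom.comp (pderiv i : Derivation R _ _).toLinearMap.toAddMonoidHom)
    (by intro a b; simp) hev
  simp only [AddMonoidHom.comp_apply] at this
  erw [this]
  congr 1
  rw [Finset.sum_eq_single i]
  · simp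
  · intro j _ hj
    simp [pderiv_X_of_ne hj]
  · simp

/-- The identity `∑ s_a s_b s_c / ((y_a - y_b) (y_a - y_c)) = 0` over triples with `b ≠ c`. -/
theorem sum_mul_sum_inv_sq [CharZero K] {ι : Type*} [Fintype ι] (s : ι → K) {y : ι → K}
    (hy : Function.Injective y) :
    ∑ a, s a * (∑ b, s b * (y a - y b)⁻¹) ^ 2 = ∑ a, s a * ∑ b, s b ^ 2 * (y a - y b)⁻¹ ^ 2 := by
  classical
  set r : ι → ι → K := fun a b => (y a - y b)⁻¹ with hr
  let g : ι → ι → ι → K := fun a b c => if b = c then 0 else s a * s b * s c * (r a b * r a c)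
  have hraa : ∀ a, r a a = 0 := fun a => by simp [hr]
  -- The partial-fraction identity `1/((a-b)(a-c)) + cyclic = 0`. Summed over all triples it gives
  -- three times the desired sum.
  have hcyc : ∀ a b c, g a b c + g b c a + g c a b = 0 := by
    intro a b c
    by_cases hab : a = b
    · subst hab
      simp [g, hraa]
    by_cases hbc : b = c
    · subst hbc
      simp [g, hraa]
    by_cases hca : c = a
    · subst hca
      simp [g, hraa]
    have h1 : y a - y b ≠ 0 := sub_ne_zero.2 (hy.ne hab)
    have h2 : y b - y c ≠ 0 := sub_ne_zero.2 (hy.ne hbc)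
    have h3 : y c - y a ≠ 0 := sub_ne_zero.2 (hy.ne hca)
    simp only [g, hab, hbc, hca, if_false, hr]
    rw [← neg_sub (y c) (y a), ← neg_sub (y a) (y b), ← neg_sub (y b) (y c)]
    field_simp
    ring
  have hsum : ∑ a, ∑ b, ∑ c, g a b c = 0 := by
    have e1 : ∑ a, ∑ b, ∑ c, g b c a = ∑ a, ∑ b, ∑ c, g a b c := by
      rw [Finset.sum_comm]
      exact Finset.sum_congr rfl fun a _ => Finset.sum_comm
    have e2 : ∑ a, ∑ b, ∑ c, g c a b = ∑ a, ∑ b, ∑ c, g a b c := by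
      have : ∀ a, ∑ b, ∑ c, g c a b = ∑ c, ∑ b, g c a b := fun a => Finset.sum_comm
      simp only [this]
      exact Finset.sum_comm
    have e3 : ∑ a, ∑ b, ∑ c, (g a b c + g b c a + g c a b) = 0 := by simp [hcyc]
    simp only [Finset.sum_add_distrib, e1, e2] at e3
    have : (3 : K) * ∑ a, ∑ b, ∑ c, g a b c = 0 := by linear_combination e3
    exact (mul_eq_zero.1 this).resolve_left (by norm_num)
  rw [← sub_eq_zero, ← hsum, ← Finset.sum_sub_distrib]
  refine Finset.sum_congr rfl fun a _ => ?_
  rw [sq, Finset.sum_mul_sum, ← mul_sub, ← Finset.sum_sub_distrib, Finset.mul_sum]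
  refine Finset.sum_congr rfl fun b _ => ?_
  have : s b ^ 2 * (y a - y b)⁻¹ ^ 2 = ∑ c, if b = c then s b ^ 2 * r a b ^ 2 else 0 := by simp [hr]
  rw [this, ← Finset.sum_sub_distrib, Finset.mul_sum]
  refine Finset.sum_congr rfl fun c _ => ?_
  by_cases hbc : b = c
  · subst hbc
    simp only [g, hr, if_true]
    ring
  · simp only [g, hbc, if_false, hr]
    ring

theorem sum_sum_inv_sq [CharZero K] {n : ℕ} {y : Fin n → K} (hy : Function.Injective y) :
    ∑ a, (∑ b, (y a - y b)⁻¹) ^ 2 = ∑ a, ∑ b, (y a - y b)⁻¹ ^ 2 := by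
  simpa using sum_mul_sum_inv_sq (fun _ => 1) hy

end LogDeriv

/-! ### Derivations on a field of fractions -/

section FracDeriv

variable {R S : Type*} [CommRing R] [CommRing S] [IsDomain S] [Algebra R S]
variable (K : Type*) [Field K] [Algebra S K] [IsFractionRing S K]

/-- A derivation amounts to a ring map `s ↦ s + ε D s` into dual numbers. Nonzero elements go to
units there, so the map extends to the fraction field, and its `ε`-part is the extension. -/
theorem exists_derivation_extend (D : Derivation R S S) :
    ∃ D' : Derivation ℤ K K, ∀ s, D' (algebraMap S K s) = algebraMap S K (D s) := by
  let f : S →+* TrivSqZeroExt K K :=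
    { toFun := fun s => TrivSqZeroExt.inl (algebraMap S K s) + TrivSqZeroExt.inr (algebraMap S K (D s))
      map_one' := by ext <;> simp
      map_zero' := by ext <;> simp
      map_mul' := fun a b => by
        ext
        · simp
        · simp only [TrivSqZeroExt.snd_add, TrivSqZeroExt.snd_inl, TrivSqZeroExt.snd_inr, TrivSqZeroExt.snd_mul,
            TrivSqZeroExt.fst_add, TrivSqZeroExt.fst_inl, TrivSqZeroExt.fst_inr, map_mul, map_add,
            Derivation.leibniz, smul_eq_mul, zero_add, add_zero, MulOpposite.smul_eq_mul_unop,
            MulOpposite.unop_op]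
          ring
      map_add' := fun a b => by
        ext <;> simp only [TrivSqZeroExt.snd_add, TrivSqZeroExt.snd_inl, TrivSqZeroExt.snd_inr,
          TrivSqZeroExt.fst_add, TrivSqZeroExt.fst_inl, TrivSqZeroExt.fst_inr, map_add, add_zero,
          zero_add] }
  have hf : ∀ y : nonZeroDivisors S, IsUnit (f y) := by
    intro y
    rw [TrivSqZeroExt.isUnit_iff_isUnit_fst]
    simp only [f, RingHom.coe_mk, MonoidHom.coe_mk, OneHom.coe_mk, TrivSqZeroExt.fst_add,
      TrivSqZeroExt.fst_inl, TrivSqZeroExt.fst_inr, add_zero]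
    exact (IsFractionRing.to_map_ne_zero_of_mem_nonZeroDivisors (K := K) y.2).isUnit
  let F : K →+* TrivSqZeroExt K K := IsLocalization.lift (M := nonZeroDivisors S) hf
  have hF : ∀ s, F (algebraMap S K s) = f s := fun s => IsLocalization.lift_eq hf s
  have hfst : (TrivSqZeroExt.fstHom ℤ K K).toRingHom.comp F = RingHom.id K := by
    refine IsLocalization.ringHom_ext (nonZeroDivisors S) (RingHom.ext fun s => ?_)
    simp [hF, f]
  have hfst' : ∀ a, (F a).fst = a := fun a => congrArg (fun g : K →+* K => g a) hfst
  let D0 : K →ₗ[ℤ] K :=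
    { toFun := fun a => (F a).snd
      map_add' := fun a b => by simp
      map_smul' := fun a b => by simp }
  refine ⟨Derivation.mk' D0 fun a b => ?_, fun s => ?_⟩
  · change (F (a * b)).snd = a * (F b).snd + b * (F a).snd
    rw [map_mul, TrivSqZeroExt.snd_mul, hfst', hfst', smul_eq_mul, MulOpposite.smul_eq_mul_unop,
      MulOpposite.unop_op, mul_comm b]
  · change (F (algebraMap S K s)).snd = _
    rw [hF]
    change (TrivSqZeroExt.inl (algebraMap S K s) + TrivSqZeroExt.inr (algebraMap S K (D s))).snd = _
    rw [TrivSqZeroExt.snd_add, TrivSqZeroExt.snd_inl, TrivSqZeroExt.snd_inr, zero_add]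

/-- With `r_ij = 1/(x_i - x_j)`, each `∂_i² A / A` equals `(∑_j r_ij)² - ∑_j r_ij²`, and these sum
to zero over `i` by `sum_sum_inv_sq`. -/
theorem laplacian_vdm_aux {R : Type*} [CommRing R] [IsDomain R] [CharZero R] (n : ℕ) (K : Type*)
    [Field K] [Algebra (MvPolynomial (Fin n) R) K] [IsFractionRing (MvPolynomial (Fin n) R) K] :
    ∑ i, pderiv i (pderiv i (vdm X : MvPolynomial (Fin n) R)) = 0 := by
  set S := MvPolynomial (Fin n) R
  have hinj := IsFractionRing.injective S K
  have : CharZero K := charZero_of_injective_algebraMap hinj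
  let y : Fin n → K := fun i => algebraMap S K (X i)
  have hy : Function.Injective y := hinj.comp X_injective
  have hgrad := map_pderiv_vdm (R := R) (algebraMap S K) hy
  apply hinj
  rw [map_sum, map_zero]
  have h1 : ∀ i, algebraMap S K (pderiv i (pderiv i (vdm X : MvPolynomial (Fin n) R))) =
      algebraMap S K (vdm X) * ((∑ j, (y i - y j)⁻¹) ^ 2 - ∑ j, (y i - y j)⁻¹ ^ 2) := by
    intro i
    obtain ⟨D, hD⟩ := exists_derivation_extend K (pderiv i : Derivation R S S)
    rw [← hD, hgrad, Derivation.leibniz, hD, hgrad]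
    have h2 : D (∑ j, (y i - y j)⁻¹) = -∑ j, (y i - y j)⁻¹ ^ 2 := by
      rw [map_sum, ← Finset.sum_neg_distrib]
      refine Finset.sum_congr rfl fun j _ => ?_
      rcases eq_or_ne j i with rfl | hij
      · simp
      · rw [Derivation.leibniz_inv, map_sub, hD, hD, pderiv_X_self, pderiv_X_of_ne hij]
        simp
    erw [h2]
    simp only [smul_eq_mul]
    ring
  simp only [h1]
  rw [← Finset.mul_sum, Finset.sum_sub_distrib, sum_sum_inv_sq hy, sub_self, mul_zero]

/-- The Vandermonde polynomial is harmonic. -/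
theorem laplacian_vdm (R : Type*) [CommRing R] [IsDomain R] [CharZero R] (n : ℕ) :
    ∑ i, pderiv i (pderiv i (vdm X : MvPolynomial (Fin n) R)) = 0 :=
  laplacian_vdm_aux n (FractionRing (MvPolynomial (Fin n) R))

end FracDeriv

/-! ### Quasi-invariant numerators -/

section QuasiInvariance

variable {R : Type*} [CommRing R] {n : ℕ}

/-- The derivative `∂_i + ν_i`, that is, `∂_i` conjugated by `exp (ν, x)`. -/
def covD (ν : Fin n → R) (i : Fin n) : Module.End R (MvPolynomial (Fin n) R) :=
  (pderiv i : Derivation R _ _).toLinearMap + LinearMap.mulLeft R (C (ν i))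

theorem covD_apply (ν : Fin n → R) (i : Fin n) (p : MvPolynomial (Fin n) R) :
    covD ν i p = pderiv i p + C (ν i) * p := rfl

theorem covD_mul (ν : Fin n → R) (i : Fin n) (p q : MvPolynomial (Fin n) R) :
    covD ν i (p * q) = pderiv i p * q + p * covD ν i q := by
  simp only [covD_apply, pderiv_mul]
  ring

theorem pderiv_pderiv_comm {σ : Type*} (i j : σ) (p : MvPolynomial σ R) :
    pderiv i (pderiv j p) = pderiv j (pderiv i p) := by
  ext s
  simp only [coeff_pderiv]
  rw [add_right_comm]
  rcases eq_or_ne i j with rfl | h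
  · rfl
  · simp [h, h.symm]
    ring

theorem covD_commute (ν : Fin n → R) (i j : Fin n) : Commute (covD ν i) (covD ν j) := by
  refine LinearMap.ext fun p => ?_
  change covD ν i (covD ν j p) = covD ν j (covD ν i p)
  simp only [covD_apply, map_add, pderiv_C_mul, pderiv_pderiv_comm i j]
  ring

/-- The difference `(∂_a + ν_a) - (∂_b + ν_b)`. -/
def covE (ν : Fin n → R) (a b : Fin n) : Module.End R (MvPolynomial (Fin n) R) :=
  covD ν a - covD ν b

theorem covE_apply (ν : Fin n → R) (a b : Fin n) (p : MvPolynomial (Fin n) R) :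
    covE ν a b p = covD ν a p - covD ν b p := rfl

theorem covE_mul (ν : Fin n → R) (a b : Fin n) (p q : MvPolynomial (Fin n) R) :
    covE ν a b (p * q) = (pderiv a p - pderiv b p) * q + p * covE ν a b q := by
  simp only [covE_apply, covD_mul]
  ring

theorem covD_covE_pow (ν : Fin n → R) (a b i : Fin n) (r : ℕ) (p : MvPolynomial (Fin n) R) :
    (covE ν a b ^ r) (covD ν i p) = covD ν i ((covE ν a b ^ r) p) := by
  have h : Commute (covE ν a b ^ r) (covD ν i) :=
    (Commute.sub_left (covD_commute ν a i) (covD_commute ν b i)).pow_left r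
  exact LinearMap.congr_fun h p

theorem covE_covE_pow (ν : Fin n → R) (a b i j : Fin n) (r : ℕ) (p : MvPolynomial (Fin n) R) :
    (covE ν a b ^ r) (covE ν i j p) = covE ν i j ((covE ν a b ^ r) p) := by
  simp only [covE_apply ν i j, map_sub, covD_covE_pow]

theorem covE_pow_succ (ν : Fin n → R) (a b : Fin n) (r : ℕ) (p : MvPolynomial (Fin n) R) :
    (covE ν a b ^ (r + 1)) p = covE ν a b ((covE ν a b ^ r) p) := by
  rw [pow_succ']
  rfl

theorem covE_pow_mul_of_pderiv_eq (ν : Fin n → R) {a b : Fin n} {c : MvPolynomial (Fin n) R}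
    (hc : pderiv a c = pderiv b c) (r : ℕ) (p : MvPolynomial (Fin n) R) :
    (covE ν a b ^ r) (c * p) = c * (covE ν a b ^ r) p := by
  induction r with
  | zero => rfl
  | succ r ih => rw [covE_pow_succ, ih, covE_mul, hc, sub_self, zero_mul, zero_add, covE_pow_succ]

theorem pderiv_sub_pderiv_root {a b : Fin n} (hab : a ≠ b) :
    pderiv a (X a - X b : MvPolynomial (Fin n) R) - pderiv b (X a - X b) = 2 := by
  simp only [map_sub, pderiv_X_self, pderiv_X_of_ne hab, pderiv_X_of_ne hab.symm]
  ring

/-- The commutator of the normal derivative with `X a - X b` is the constant `2`, hence the factor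
`2 (r + 1)`. On the hyperplane, multiplication by the root shifts normal derivatives by one order.
-/
theorem covE_pow_root_mul (ν : Fin n → R) {a b : Fin n} (hab : a ≠ b) (r : ℕ)
    (p : MvPolynomial (Fin n) R) :
    (covE ν a b ^ (r + 1)) ((X a - X b) * p) =
      (X a - X b) * (covE ν a b ^ (r + 1)) p +
        ((2 * (r + 1) : ℕ) : MvPolynomial (Fin n) R) * (covE ν a b ^ r) p := by
  induction r with
  | zero =>
    rw [zero_add, pow_one, covE_mul, pderiv_sub_pderiv_root hab, pow_zero, Module.End.one_apply]
    push_cast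
    ring
  | succ r ih =>
    have h1 : covE ν a b (((2 * (r + 1) : ℕ) : MvPolynomial (Fin n) R) * (covE ν a b ^ r) p) =
        ((2 * (r + 1) : ℕ) : MvPolynomial (Fin n) R) * (covE ν a b ^ (r + 1)) p := by
      rw [covE_pow_succ, ← nsmul_eq_mul, map_nsmul, nsmul_eq_mul]
    rw [covE_pow_succ ν a b (r + 1), ih, map_add, covE_mul, pderiv_sub_pderiv_root hab, h1,
      ← covE_pow_succ]
    push_cast
    ring

/-- Restriction to the hyperplane `x_a = x_b`. -/
def restr (R : Type*) [CommRing R] (a b : Fin n) :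
    MvPolynomial (Fin n) R →ₐ[R] MvPolynomial (Fin n) R :=
  aeval fun i => if i = a then X b else X i

theorem restr_X_self (a b : Fin n) : restr R a b (X a) = X b := by simp [restr]

theorem restr_X_of_ne {a b i : Fin n} (h : i ≠ a) : restr R a b (X i) = X i := by simp [restr, h]

theorem restr_root {a b : Fin n} (hab : a ≠ b) : restr R a b (X a - X b) = 0 := by
  rw [map_sub, restr_X_self, restr_X_of_ne hab.symm, sub_self]

theorem restr_eq_zero_iff {a b : Fin n} (hab : a ≠ b) {p : MvPolynomial (Fin n) R} :
    restr R a b p = 0 ↔ X a - X b ∣ p := by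
  constructor
  · intro h
    have key : ∀ q : MvPolynomial (Fin n) R, X a - X b ∣ q - restr R a b q := by
      intro q
      induction q using MvPolynomial.induction_on with
      | C c => simp [restr]
      | add p q hp hq =>
        rw [map_add, add_sub_add_comm]
        exact dvd_add hp hq
      | mul_X p i hp =>
        rw [map_mul]
        have h2 : X a - X b ∣ X i - restr R a b (X i) := by
          by_cases hi : i = a
          · rw [hi, restr_X_self]
          · rw [restr_X_of_ne hi, sub_self]
            exact dvd_zero _
        have e : p * X i - restr R a b p * restr R a b (X i) =
            (p - restr R a b p) * X i + restr R a b p * (X i - restr R a b (X i)) := by ring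
        rw [e]
        exact dvd_add (hp.mul_right _) (h2.mul_left _)
    simpa [h] using key p
  · rintro ⟨q, rfl⟩
    rw [map_mul, restr_root hab, zero_mul]

/-- The numerator `p` is quasi-invariant of order `m` on `x_a = x_b`. -/
def QuasiInv (ν : Fin n → R) (m : ℕ) (a b : Fin n) (p : MvPolynomial (Fin n) R) : Prop :=
  ∀ k < m, restr R a b ((covE ν a b ^ (2 * k + 1)) p) = 0

/-- Each derivative lowers the order of vanishing by at most one, and the highest one required is `2
m - 1`. This starts the sequence at `A ^ (2 * m)`. -/
theorem quasiInv_of_dvd (ν : Fin n → R) (m : ℕ) {a b : Fin n} (hab : a ≠ b)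
    {p : MvPolynomial (Fin n) R} (hp : (X a - X b) ^ (2 * m) ∣ p) : QuasiInv ν m a b p := by
  have key : ∀ r N : ℕ, r ≤ N → ∀ q, (X a - X b) ^ N ∣ q →
      (X a - X b) ^ (N - r) ∣ (covE ν a b ^ r) q := by
    intro r
    induction r with
    | zero => intro N _ q hq; simpa using hq
    | succ r ih =>
      intro N hN q hq
      obtain ⟨t, ht⟩ := ih N (by omega) q hq
      rw [covE_pow_succ, ht, show N - r = (N - (r + 1)) + 1 by omega, covE_mul, pderiv_pow, pderiv_pow]
      have e : N - (r + 1) + 1 - 1 = N - (r + 1) := by omega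
      rw [e]
      refine dvd_add (Dvd.dvd.mul_right ?_ _) (Dvd.dvd.mul_right (pow_dvd_pow _ (by omega)) _)
      rw [mul_assoc, mul_assoc, ← mul_sub, ← mul_sub]
      exact (dvd_mul_right _ _).mul_left _
  intro k hk
  rw [restr_eq_zero_iff hab]
  exact (dvd_pow_self _ (by omega)).trans (key (2 * k + 1) (2 * m) (by omega) p hp)

theorem root_ne_zero [Nontrivial R] {i j : Fin n} (h : i ≠ j) :
    (X i - X j : MvPolynomial (Fin n) R) ≠ 0 :=
  sub_ne_zero.2 (X_injective.ne h)

variable [IsDomain R] [CharZero R]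

/-- With `u = x_a + x_b - 2 x_l` and `s = x_a - x_b`, the factor is `u² - s²`: even in `s`, and
nonzero on the hyperplane. Even factors can be cancelled by induction on the order, since the `s²`
part only brings in the previous odd derivative of `g`. -/
theorem quasiInv_of_mul {ν : Fin n → R} {m : ℕ} {a b l : Fin n} (hab : a ≠ b) (hla : l ≠ a)
    (hlb : l ≠ b) {g : MvPolynomial (Fin n) R}
    (hg : QuasiInv ν m a b (4 * ((X a - X l) * (X b - X l) * g))) : QuasiInv ν m a b g := by
  set s : MvPolynomial (Fin n) R := X a - X b with hs
  set u : MvPolynomial (Fin n) R := X a + X b - 2 * X l with hu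
  have hus : 4 * ((X a - X l) * (X b - X l) * g) = u ^ 2 * g - s * (s * g) := by
    rw [hs, hu]; ring
  have hud : pderiv a (u ^ 2) = pderiv b (u ^ 2) := by
    have h2 : ∀ i, pderiv i (2 * X l : MvPolynomial (Fin n) R) = 2 * pderiv i (X l) := fun i => by
      rw [← map_ofNat C 2, pderiv_C_mul]
    simp only [pderiv_pow, hu, map_sub, map_add, h2, pderiv_X_self, pderiv_X_of_ne hab,
      pderiv_X_of_ne hab.symm, pderiv_X_of_ne hla, pderiv_X_of_ne hlb]
    ring
  have hru : restr R a b u ≠ 0 := by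
    have : restr R a b u = 2 * (X b - X l) := by
      rw [hu, map_sub, map_add, map_mul, restr_X_self, restr_X_of_ne hab.symm, restr_X_of_ne hla,
        map_ofNat]
      ring
    rw [this]
    exact mul_ne_zero two_ne_zero (root_ne_zero hlb.symm)
  have hres : restr R a b (X a - X b) = 0 := restr_root hab
  intro k hk
  induction k with
  | zero =>
    have h1 := hg 0 hk
    rw [hus, map_sub, covE_pow_mul_of_pderiv_eq ν hud, covE_pow_root_mul ν hab, pow_zero,
      Module.End.one_apply] at h1
    simpa only [map_sub, map_add, map_mul, map_pow, hres, hs, zero_mul, mul_zero, add_zero, sub_zero,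
      mul_eq_zero, pow_eq_zero_iff two_ne_zero, hru, false_or] using h1
  | succ k ih =>
    have h0 := ih (by omega)
    have h1 := hg (k + 1) hk
    have e1 : 2 * (k + 1) + 1 = (2 * k + 1 + 1) + 1 := by ring
    rw [e1] at h1 ⊢
    rw [hus, map_sub, covE_pow_mul_of_pderiv_eq ν hud, covE_pow_root_mul ν hab,
      covE_pow_root_mul ν hab (2 * k + 1) g] at h1
    simpa only [map_sub, map_add, map_mul, map_pow, hres, h0, zero_mul, mul_zero, add_zero, sub_zero,
      mul_eq_zero, pow_eq_zero_iff two_ne_zero, hru, false_or] using h1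

/-- The combination is symmetric in `a` and `b`. After clearing denominators it becomes `2 u` times
a tangential derivative of `p`, minus `2 s` times its normal derivative, and both are controlled by
odd normal derivatives of `p`. -/
theorem quasiInv_quotient_add {ν : Fin n → R} {m : ℕ} {a b l : Fin n} (hab : a ≠ b) (hla : l ≠ a)
    (hlb : l ≠ b) {p ga gb : MvPolynomial (Fin n) R} (hp : QuasiInv ν m a b p)
    (ha : (X a - X l) * ga = covE ν a l p) (hb : (X b - X l) * gb = covE ν b l p) :
    QuasiInv ν m a b (ga + gb) := by
  refine quasiInv_of_mul hab hla hlb fun k hk => ?_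
  set s : MvPolynomial (Fin n) R := X a - X b with hs
  set u : MvPolynomial (Fin n) R := X a + X b - 2 * X l with hu
  have e : 4 * ((X a - X l) * (X b - X l) * (ga + gb)) =
      2 * (u * (covE ν a l p + covE ν b l p)) - 2 * (s * covE ν a b p) := by
    have h3 : covE ν a b p = covE ν a l p - covE ν b l p := by
      simp only [covE_apply]; ring
    rw [h3, hs, hu]
    linear_combination 4 * (X b - X l) * ha + 4 * (X a - X l) * hb
  have hud : pderiv a u = pderiv b u := by
    have h2 : ∀ i, pderiv i (2 * X l : MvPolynomial (Fin n) R) = 2 * pderiv i (X l) := fun i => by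
      rw [← map_ofNat C 2, pderiv_C_mul]
    simp only [hu, map_sub, map_add, h2, pderiv_X_self, pderiv_X_of_ne hab,
      pderiv_X_of_ne hab.symm, pderiv_X_of_ne hla, pderiv_X_of_ne hlb]
    ring
  have h2 : pderiv a (2 : MvPolynomial (Fin n) R) = pderiv b 2 := by
    rw [← map_ofNat C 2, pderiv_C, pderiv_C]
  obtain ⟨h, hh⟩ := (restr_eq_zero_iff hab).1 (hp k hk)
  rw [e, map_sub, covE_pow_mul_of_pderiv_eq ν h2, covE_pow_mul_of_pderiv_eq ν h2,
    covE_pow_mul_of_pderiv_eq ν hud, covE_pow_root_mul ν hab, map_add, covE_covE_pow, covE_covE_pow,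
    covE_covE_pow, hh]
  have e2 : covE ν a l (s * h) + covE ν b l (s * h) = s * (covE ν a l h + covE ν b l h) := by
    have h4 : pderiv a s = 1 := by simp [hs, pderiv_X_of_ne hab.symm]
    have h5 : pderiv b s = -1 := by simp [hs, pderiv_X_of_ne hab]
    have h6 : pderiv l s = 0 := by simp [hs, pderiv_X_of_ne hla.symm, pderiv_X_of_ne hlb.symm]
    rw [covE_mul, covE_mul, h4, h5, h6]
    ring
  have e3 : (covE ν a b ^ (2 * k)) (covE ν a b p) = s * h := by
    rw [covE_covE_pow, ← covE_pow_succ, hh]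
  have hres : restr R a b s = 0 := restr_root hab
  rw [e2, ← hs, e3]
  simp only [map_sub, map_add, map_mul, hres, zero_mul, mul_zero, sub_zero, add_zero]

end QuasiInvariance

/-! ### Invariance of quasi-invariance under the conjugated operator -/

section Existence

variable {R : Type*} [CommRing R] {n : ℕ}

/-- Splits the Laplacian into its part normal to `x_a = x_b` and parts tangential to it. -/
theorem two_mul_sum_covD_sq (ν : Fin n → R) {a b : Fin n} (hab : a ≠ b)
    (p : MvPolynomial (Fin n) R) :
    2 * ∑ i, covD ν i (covD ν i p) = covE ν a b (covE ν a b p)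
      + (covD ν a (covD ν a p + covD ν b p) + covD ν b (covD ν a p + covD ν b p))
      + 2 * ∑ i ∈ (Finset.univ.erase a).erase b, covD ν i (covD ν i p) := by
  have h1 := Finset.add_sum_erase Finset.univ (fun i => covD ν i (covD ν i p)) (Finset.mem_univ a)
  have h2 := Finset.add_sum_erase (Finset.univ.erase a) (fun i => covD ν i (covD ν i p))
    (Finset.mem_erase.2 ⟨hab.symm, Finset.mem_univ b⟩)
  have h3 : covD ν a (covD ν b p) = covD ν b (covD ν a p) :=
    LinearMap.congr_fun (covD_commute ν a b) p
  rw [← h1, ← h2]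
  simp only [covE_apply, map_sub, map_add, h3]
  ring

theorem sum_sum_split {A : Type*} [AddCommGroup A] {a b : Fin n} (hab : a ≠ b)
    (g : Fin n → Fin n → A) (hg : ∀ i j, g i j = g j i) (h0 : ∀ i, g i i = 0) :
    ∑ i, ∑ j, g i j = 2 • g a b + 2 • (∑ l ∈ (Finset.univ.erase a).erase b, (g a l + g b l))
      + ∑ i ∈ (Finset.univ.erase a).erase b, ∑ j ∈ (Finset.univ.erase a).erase b, g i j := by
  have h : ∀ f : Fin n → A, ∑ i, f i = f a + (f b + ∑ i ∈ (Finset.univ.erase a).erase b, f i) :=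
    fun f => by
      rw [Finset.add_sum_erase _ f (Finset.mem_erase.2 ⟨hab.symm, Finset.mem_univ b⟩),
        Finset.add_sum_erase _ f (Finset.mem_univ a)]
  have h1 : ∑ i ∈ (Finset.univ.erase a).erase b, ∑ j, g i j =
      ∑ i ∈ (Finset.univ.erase a).erase b,
        (g a i + (g b i + ∑ j ∈ (Finset.univ.erase a).erase b, g i j)) :=
    Finset.sum_congr rfl fun i _ => by rw [h (g i), hg i a, hg i b]
  rw [h, h (g a), h (g b), h1, h0, h0, hg b a]
  simp only [Finset.sum_add_distrib]
  abel

variable [IsDomain R] [CharZero R]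

/-- The shifted Schroedinger operator preserves quasi-invariance. -/
theorem quasiInv_next {ν : Fin n → R} {m : ℕ} {a b : Fin n} (hab : a ≠ b)
    {p p' : MvPolynomial (Fin n) R} {g : Fin n → Fin n → MvPolynomial (Fin n) R} (c : R)
    (hp : QuasiInv ν m a b p) (hg : ∀ i j, (X i - X j) * g i j = covE ν i j p)
    (h0 : ∀ i, g i i = 0)
    (hp' : p' = -∑ i, covD ν i (covD ν i p) + C c * p + C (m : R) * ∑ i, ∑ j, g i j) :
    QuasiInv ν m a b p' := by
  have hsymm : ∀ i j, g i j = g j i := by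
    intro i j
    rcases eq_or_ne i j with rfl | hij
    · rfl
    · apply mul_left_cancel₀ (root_ne_zero (R := R) hij)
      have h1 : covE ν j i p = - covE ν i j p := by simp only [covE_apply]; ring
      linear_combination hg i j + hg j i + h1
  intro k hk
  have hpk := hp k hk
  obtain ⟨h, hh⟩ := (restr_eq_zero_iff hab).1 hpk
  have hres : restr R a b (X a - X b) = 0 := restr_root hab
  set T := (Finset.univ.erase a).erase b with hT
  have hTa : ∀ l ∈ T, l ≠ a := fun l hl => (Finset.mem_erase.1 (Finset.mem_erase.1 hl).2).1
  have hTb : ∀ l ∈ T, l ≠ b := fun l hl => (Finset.mem_erase.1 hl).1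
  have hcov : ∀ l ∈ T, ∀ q, covD ν l ((X a - X b) * q) = (X a - X b) * covD ν l q := by
    intro l hl q
    rw [covD_mul, map_sub, pderiv_X_of_ne (hTa l hl).symm, pderiv_X_of_ne (hTb l hl).symm]
    ring
  have hab' : ∀ q, covD ν a ((X a - X b) * q) + covD ν b ((X a - X b) * q) =
      (X a - X b) * (covD ν a q + covD ν b q) := by
    intro q
    rw [covD_mul, covD_mul, map_sub, map_sub, pderiv_X_of_ne hab, pderiv_X_of_ne hab.symm,
      pderiv_X_self, pderiv_X_self]
    ring
  -- Tangential derivatives preserve divisibility by `X a - X b`, so only the normal second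
  -- derivative survives restriction.
  have hlap : restr R a b (2 * ∑ i, covD ν i (covD ν i ((covE ν a b ^ (2 * k + 1)) p))) =
      restr R a b ((covE ν a b ^ (2 * k + 1 + 2)) p) := by
    rw [two_mul_sum_covD_sq ν hab, ← covE_pow_succ, ← covE_pow_succ, map_add, map_add, hh, hab', hab']
    have : ∑ i ∈ T, covD ν i (covD ν i ((X a - X b) * h)) =
        (X a - X b) * ∑ i ∈ T, covD ν i (covD ν i h) := by
      rw [Finset.mul_sum]
      exact Finset.sum_congr rfl fun l hl => by rw [hcov l hl, hcov l hl]
    rw [this]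
    simp only [map_mul, hres, zero_mul, mul_zero, add_zero]
  have hgab : restr R a b ((covE ν a b ^ (2 * k + 1 + 2)) p) =
      (2 * (2 * k + 1 + 1) : ℕ) * restr R a b ((covE ν a b ^ (2 * k + 1)) (g a b)) := by
    have e : (covE ν a b ^ (2 * k + 1 + 2)) p = (covE ν a b ^ (2 * k + 1 + 1)) (covE ν a b p) := by
      rw [covE_covE_pow, ← covE_pow_succ]
    rw [e, ← hg, covE_pow_root_mul ν hab, map_add, map_mul, hres, zero_mul, zero_add, map_mul,
      map_natCast]
  -- The quotients involving just one of `a` and `b` are good only in pairs. Those involving neither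
  -- are good separately.
  have hT1 : ∀ l ∈ T, restr R a b ((covE ν a b ^ (2 * k + 1)) (g a l + g b l)) = 0 := fun l hl =>
    quasiInv_quotient_add hab (hTa l hl) (hTb l hl) hp (hg a l) (hg b l) k hk
  have hT2 : ∀ i ∈ T, ∀ j ∈ T, restr R a b ((covE ν a b ^ (2 * k + 1)) (g i j)) = 0 := by
    intro i hi j hj
    rcases eq_or_ne i j with rfl | hij
    · rw [h0, map_zero, map_zero]
    · have hc : pderiv a (X i - X j : MvPolynomial (Fin n) R) = pderiv b (X i - X j) := by
        simp only [map_sub, pderiv_X_of_ne (hTa i hi), pderiv_X_of_ne (hTa j hj),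
          pderiv_X_of_ne (hTb i hi), pderiv_X_of_ne (hTb j hj)]
      have h1 := congrArg (fun q => restr R a b ((covE ν a b ^ (2 * k + 1)) q)) (hg i j)
      simp only [covE_pow_mul_of_pderiv_eq ν hc, covE_covE_pow, hh] at h1
      have h2 : covE ν i j ((X a - X b) * h) = (X a - X b) * covE ν i j h := by
        simp only [covE_apply, hcov i hi, hcov j hj]
        ring
      rw [h2, map_mul, map_mul, hres, zero_mul, map_sub, restr_X_of_ne (hTa i hi),
        restr_X_of_ne (hTa j hj)] at h1
      exact (mul_eq_zero.1 h1).resolve_left (root_ne_zero hij)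
  have hgg : restr R a b ((covE ν a b ^ (2 * k + 1)) (∑ i, ∑ j, g i j)) =
      2 * restr R a b ((covE ν a b ^ (2 * k + 1)) (g a b)) := by
    rw [sum_sum_split hab g hsymm h0]
    simp only [map_add, map_sum, map_nsmul] at hT1 ⊢
    rw [Finset.sum_eq_zero (s := T) (f := fun l => _ + _) hT1, Finset.sum_eq_zero fun i hi => Finset.sum_eq_zero fun j hj => hT2 i hi j hj]
    simp [two_mul, two_smul]
  have hmain : 2 * restr R a b ((covE ν a b ^ (2 * k + 1)) p') =
      -restr R a b (2 * ∑ i, covD ν i (covD ν i ((covE ν a b ^ (2 * k + 1)) p)))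
       + 2 * C (m : R) * (2 * restr R a b ((covE ν a b ^ (2 * k + 1)) (g a b))) := by
    have e1 : (covE ν a b ^ (2 * k + 1)) p' =
        -∑ i, covD ν i (covD ν i ((covE ν a b ^ (2 * k + 1)) p))
          + C c * (covE ν a b ^ (2 * k + 1)) p
          + C (m : R) * (covE ν a b ^ (2 * k + 1)) (∑ i, ∑ j, g i j) := by
      have hC : ∀ (c : R) q, (covE ν a b ^ (2 * k + 1)) (C c * q) =
          C c * (covE ν a b ^ (2 * k + 1)) q := fun c q => by rw [C_mul', map_smul, C_mul']
      have hs : (covE ν a b ^ (2 * k + 1)) (∑ i, covD ν i (covD ν i p)) =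
          ∑ i, covD ν i (covD ν i ((covE ν a b ^ (2 * k + 1)) p)) := by
        rw [map_sum]
        exact Finset.sum_congr rfl fun i _ => by rw [covD_covE_pow, covD_covE_pow]
      rw [hp', LinearMap.map_add, LinearMap.map_add, LinearMap.map_neg, hC, hC, hs]
    have e2 : restr R a b (C (m : R)) = C (m : R) := by simp [restr]
    rw [e1, map_add, map_add, map_neg, map_mul, map_mul, hpk, hgg, e2, map_mul, map_ofNat]
    ring
  rw [hlap, hgab] at hmain
  -- Up to sign, twice the restricted derivative is `4 (m - (k + 1))` times that of `g a b`. For `k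
  -- + 1 < m` the latter vanishes by the next quasi-invariance condition; for `k + 1 = m` the
  -- coefficient is zero.
  have hfin : restr R a b ((covE ν a b ^ (2 * k + 1)) (g a b)) = 0 ∨ k + 1 = m := by
    rcases Nat.lt_or_ge (k + 1) m with hkm | hkm
    · left
      have h1 := hp (k + 1) hkm
      rw [show 2 * (k + 1) + 1 = 2 * k + 1 + 2 by ring, hgab] at h1
      refine (mul_eq_zero.1 h1).resolve_left ?_
      exact Nat.cast_ne_zero.2 (by omega)
    · right
      omega
  have h2 : (2 : MvPolynomial (Fin n) R) ≠ 0 := two_ne_zero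
  apply mul_left_cancel₀ h2
  rw [hmain, mul_zero]
  rcases hfin with h1 | h1
  · rw [h1]; ring
  · rw [← h1, map_natCast]
    push_cast
    ring

end Existence

/-! ### Berest's iteration -/

section BerestSequence

variable {R : Type*} [CommRing R] {n : ℕ}

theorem root_dvd_vdm {a b : Fin n} (hab : a ≠ b) :
    (X a - X b : MvPolynomial (Fin n) R) ∣ vdm X := by
  have key : ∀ a b : Fin n, a < b → (X a - X b : MvPolynomial (Fin n) R) ∣ vdm X := fun a b h =>
    (Finset.dvd_prod_of_mem (fun j => (X a - X j : MvPolynomial (Fin n) R)) (Finset.mem_Ioi.2 h)).trans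
      (Finset.dvd_prod_of_mem (fun i => ∏ j ∈ Finset.Ioi i, (X i - X j : MvPolynomial (Fin n) R))
        (Finset.mem_univ a))
  rcases lt_or_gt_of_ne hab with h | h
  · exact key a b h
  · rw [← neg_sub, neg_dvd]
    exact key b a h

variable [CharZero R]

/-- `∂_i A / A = ∑_j 1/(x_i - x_j)`, and symmetrizing the double sum pairs each difference quotient
with both of its orderings, hence the factor `2`. -/
theorem vdm_mul_sum_quotients_aux (K : Type*) [Field K] [Algebra (MvPolynomial (Fin n) R) K]
    [IsFractionRing (MvPolynomial (Fin n) R) K] (f : Fin n → MvPolynomial (Fin n) R)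
    {g : Fin n → Fin n → MvPolynomial (Fin n) R}
    (hg : ∀ i j, (X i - X j) * g i j = f i - f j) (h0 : ∀ i, g i i = 0) :
    vdm X * ∑ i, ∑ j, g i j = 2 * ∑ i, pderiv i (vdm X) * f i := by
  have hinj := IsFractionRing.injective (MvPolynomial (Fin n) R) K
  let y : Fin n → K := fun i => algebraMap (MvPolynomial (Fin n) R) K (X i)
  have hy : Function.Injective y := hinj.comp X_injective
  apply hinj
  have h1 : ∀ i j, algebraMap _ K (g i j) =
      (y i - y j)⁻¹ * (algebraMap _ K (f i)) + (y j - y i)⁻¹ * algebraMap _ K (f j) := by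
    intro i j
    rcases eq_or_ne i j with rfl | hij
    · simp [h0]
    · have h2 : y i - y j ≠ 0 := sub_ne_zero.2 (hy.ne hij)
      have h3 := congrArg (algebraMap _ K) (hg i j)
      simp only [map_mul, map_sub] at h3
      rw [← neg_sub (y i) (y j), inv_neg]
      field_simp
      linear_combination h3
  simp only [map_mul, map_sum, h1, Finset.sum_add_distrib, map_ofNat]
  rw [Finset.sum_comm (f := fun i j => (y j - y i)⁻¹ * algebraMap _ K (f j))]
  have h4 : ∀ i, algebraMap _ K (pderiv i (vdm X)) = _ :=
    map_pderiv_vdm (R := R) (algebraMap _ K) hy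
  simp only [h4, ← Finset.sum_mul, mul_assoc, ← Finset.mul_sum]
  change _ = 2 * (_ * ∑ i, (∑ j, (y i - y j)⁻¹) * _)
  ring

variable [IsDomain R]

theorem vdm_mul_sum_quotients (f : Fin n → MvPolynomial (Fin n) R)
    {g : Fin n → Fin n → MvPolynomial (Fin n) R}
    (hg : ∀ i j, (X i - X j) * g i j = f i - f j) (h0 : ∀ i, g i i = 0) :
    vdm X * ∑ i, ∑ j, g i j = 2 * ∑ i, pderiv i (vdm X) * f i :=
  vdm_mul_sum_quotients_aux (FractionRing (MvPolynomial (Fin n) R)) f hg h0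

/-- As `A` is harmonic, conjugating the operator by `A ^ m` cancels its double poles. What remains
are the quotients `(∂_i - ∂_j) / (x_i - x_j)` with covariant derivatives. The first quasi-invariance
condition, available since `m ≥ 1`, makes them polynomial, so `step` is divisible by `A ^ 2`. -/
theorem exists_next (ν : Fin n → R) {m : ℕ} (hm : 1 ≤ m) {p : MvPolynomial (Fin n) R}
    (hp : ∀ a b, a ≠ b → QuasiInv ν m a b p) :
    ∃ p', (∀ a b, a ≠ b → QuasiInv ν m a b p') ∧ vdm X ^ 2 * p' = step (vdm X) ν m m p := by
  have h1 : ∀ i j, ∃ g, (X i - X j) * g = covE ν i j p ∧ (i = j → g = 0) := by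
    intro i j
    rcases eq_or_ne i j with rfl | hij
    · exact ⟨0, by simp [covE_apply], fun _ => rfl⟩
    · have h2 := hp i j hij 0 hm
      rw [restr_eq_zero_iff hij] at h2
      obtain ⟨g, hg⟩ := h2
      exact ⟨g, hg.symm, fun h => absurd h hij⟩
  choose g hg h0' using h1
  have h0 : ∀ i, g i i = 0 := fun i => h0' i i rfl
  refine ⟨-∑ i, covD ν i (covD ν i p) + C (∑ i, ν i ^ 2) * p + C (m : R) * ∑ i, ∑ j, g i j,
    fun a b hab => quasiInv_next hab _ (hp a b hab) hg h0 rfl, ?_⟩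
  have h3 := vdm_mul_sum_quotients (fun i => covD ν i p) hg h0
  have h4 := step_expand (vdm X) ν m m p
  have h5 := laplacian_vdm R n
  have h6 : ∑ i, (vdm X ^ 2 * pderiv i (pderiv i p) - 2 * (m : MvPolynomial (Fin n) R) * vdm X * pderiv i (vdm X) * pderiv i p
        - (m : MvPolynomial (Fin n) R) * vdm X * pderiv i (pderiv i (vdm X)) * p
        + ((m : MvPolynomial (Fin n) R) * ((m : MvPolynomial (Fin n) R) + 1) - (m : MvPolynomial (Fin n) R) * ((m : MvPolynomial (Fin n) R) + 1)) * (pderiv i (vdm X) ^ 2 * p)) =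
      vdm X ^ 2 * ∑ i, pderiv i (pderiv i p) - 2 * (m : MvPolynomial (Fin n) R) * vdm X * ∑ i, pderiv i (vdm X) * pderiv i p
       - (m : MvPolynomial (Fin n) R) * vdm X * p * ∑ i, pderiv i (pderiv i (vdm X)) := by
    simp only [Finset.mul_sum, ← Finset.sum_sub_distrib]
    exact Finset.sum_congr rfl fun i _ => by ring
  have h7 : ∑ i, covD ν i (covD ν i p) = ∑ i, pderiv i (pderiv i p) + 2 * dirDeriv ν p + C (∑ i, ν i ^ 2) * p := by
    simp only [dirDeriv_apply, covD_apply, map_sum, map_pow, Finset.mul_sum, Finset.sum_mul, ← Finset.sum_add_distrib, map_add, pderiv_C_mul]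
    exact Finset.sum_congr rfl fun i _ => by ring
  have h8 : ∑ i, pderiv i (vdm X) * covD ν i p = ∑ i, pderiv i (vdm X) * pderiv i p + dirDeriv ν (vdm X) * p := by
    simp only [dirDeriv_apply, covD_apply, Finset.sum_mul, ← Finset.sum_add_distrib]
    exact Finset.sum_congr rfl fun i _ => by ring
  rw [h6, h5] at h4
  rw [h8] at h3
  rw [h7, map_natCast]
  linear_combination (m : MvPolynomial (Fin n) R) * vdm X * h3 - h4

/-- Iterating the shifted Schroedinger operator on `A ^ m * exp (ν, x)` produces the numerator of a
solution after `m n (n - 1) / 2` steps. -/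
theorem exists_berest_sequence {ν : Fin n → R} (hν : Function.Injective ν) {m : ℕ} (hm : 1 ≤ m) :
    ∃ Q : ℕ → MvPolynomial (Fin n) R, Q 0 = vdm X ^ (2 * m) ∧
      (∀ j, vdm X ^ 2 * Q (j + 1) = step (vdm X) ν m m (Q j)) ∧ Q (m * n.choose 2 + 1) = 0 ∧
      Q (m * n.choose 2) - vdm X ^ m * C ((-2) ^ (m * n.choose 2) *
        ((m * n.choose 2).factorial * vdm ν ^ m)) ∈ degLE R 1 (m * n.choose 2 - 1) := by
  set A : MvPolynomial (Fin n) R := vdm X with hAdef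
  set N := m * n.choose 2 with hN
  have hA : A.IsHomogeneous (n.choose 2) := isHomogeneous_vdm fun i => isHomogeneous_X R i
  have hA' := mem_degLE_of_isHomogeneous hA
  have hA0 : A ≠ 0 := vdm_ne_zero X_injective
  have h0 : ∀ a b, a ≠ b → QuasiInv ν m a b (A ^ (2 * m)) := fun a b hab =>
    quasiInv_of_dvd ν m hab (pow_dvd_pow_of_dvd (root_dvd_vdm hab) _)
  choose! nx hnx1 hnx2 using fun p (hp : ∀ a b, a ≠ b → QuasiInv ν m a b p) => exists_next ν hm hp
  let Q : ℕ → MvPolynomial (Fin n) R := fun j => nx^[j] (A ^ (2 * m))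
  have hQs : ∀ j, Q (j + 1) = nx (Q j) := fun j => Function.iterate_succ_apply' _ _ _
  have hQq : ∀ j, ∀ a b, a ≠ b → QuasiInv ν m a b (Q j) := by
    intro j
    induction j with
    | zero => exact h0
    | succ j ih => rw [hQs]; exact hnx1 _ ih
  have hQ : ∀ j, A ^ 2 * Q (j + 1) = step A ν m m (Q j) := fun j => by
    rw [hQs]; exact hnx2 _ (hQq j)
  -- The predicted top parts of `Q j / A ^ m`: iterates of `-2 ∂_ν` on `A ^ m`.
  let q : ℕ → MvPolynomial (Fin n) R := fun j => C ((-2) ^ j) * (dirDeriv ν)^[j] (A ^ m)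
  have hqs : ∀ j, q (j + 1) = -2 * dirDeriv ν (q j) := by
    intro j
    have : dirDeriv ν (q j) = C ((-2) ^ j) * (dirDeriv ν)^[j + 1] (A ^ m) := by
      rw [Function.iterate_succ_apply']
      simp only [q]
      rw [C_mul', map_smul, C_mul']
    rw [this]
    simp only [q, pow_succ, map_mul, map_neg, map_ofNat]
    ring
  have hqd : ∀ j : ℕ, q j ∈ degLE R 1 (N - j) := by
    intro j
    induction j with
    | zero =>
      have : q 0 = A ^ m := by simp [q]
      rw [this]
      refine degLE_mono (le_of_eq ?_) (pow_mem_degLE hA' m)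
      simp [hN]
    | succ j ih =>
      rw [hqs]
      have e : (-2 * dirDeriv ν (q j)) = C (-2) * dirDeriv ν (q j) := by
        rw [map_neg, map_ofNat]
      rw [e]
      refine C_mul_mem_degLE _ (degLE_mono (le_of_eq ?_) (dirDeriv_mem_degLE ν ih))
      push_cast
      ring
  have htop : ∀ j : ℕ, Q j - A ^ m * q j ∈ degLE R 1 (m * n.choose 2 + (N - j) - 1) := by
    intro j
    induction j with
    | zero =>
      have : Q 0 - A ^ m * q 0 = 0 := by
        simp only [Q, q, Function.iterate_zero, id]
        simp
        ring
      rw [this]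
      exact zero_mem _
    | succ j ih =>
      have h1 := step_top hA ν m m (hqd j) ih
      have e : step A ν m m (Q j) - A ^ (m + 2) * (-2 * dirDeriv ν (q j)) =
          A ^ 2 * (Q (j + 1) - A ^ m * q (j + 1)) := by
        rw [← hQ, hqs]; ring
      rw [e] at h1
      refine mem_degLE_of_mul_mem (hA.pow 2) (pow_ne_zero 2 hA0) (degLE_mono (le_of_eq ?_) h1)
      push_cast
      ring
  have hQd : ∀ j : ℕ, Q j ∈ degLE R 1 (2 * N - j) := by
    intro j
    have h1 := mul_mem_degLE (pow_mem_degLE hA' m) (hqd j)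
    have h2 := add_mem (degLE_mono (e := 2 * N - j) ?_ (htop j)) (degLE_mono ?_ h1)
    · simpa using h2
    · rw [hN]; push_cast; linarith
    · rw [hN]; push_cast; linarith
  -- Descending induction from index `2 N + 1`, where the degree bound is negative. For indices
  -- above `N` the degree is below `m * n.choose 2`, so `step (Q j) = 0` implies `Q j = 0` by
  -- uniqueness.
  have hzero : ∀ d, d ≤ N → Q (2 * N + 1 - d) = 0 := by
    intro d
    induction d with
    | zero =>
      intro _
      refine eq_zero_of_mem_degLE_neg ?_ (hQd _)
      push_cast
      linarith
    | succ d ih =>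
      intro hd
      have h1 := hQ (2 * N + 1 - (d + 1))
      rw [show 2 * N + 1 - (d + 1) + 1 = 2 * N + 1 - d by omega, ih (by omega), mul_zero] at h1
      refine eq_zero_of_step_eq_zero hν (degLE_mono ?_ (hQd _)) h1.symm
      rw [hN] at hd ⊢
      push_cast at hd ⊢
      zify at hd
      omega
  refine ⟨Q, rfl, hQ, ?_, ?_⟩
  · have := hzero N le_rfl
    rwa [show 2 * N + 1 - N = N + 1 by omega] at this
  · have h1 := htop N
    have h2 : q N = C ((-2) ^ N * (N.factorial * vdm ν ^ m)) := by
      simp only [q]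
      rw [map_mul C, hN, hAdef]
      exact congrArg (C ((-2) ^ (m * n.choose 2)) * ·) (dirDeriv_iterate_vdm_pow ν id m)
    rw [h2] at h1
    refine degLE_mono (le_of_eq ?_) h1
    ring

end BerestSequence

/-! ### Quotients of polynomials times exponentials -/

section ExpQuot

variable {σ : Type*} [Fintype σ]

/-- The function `p(y) / B(y) ^ M * exp (∑ ℓ_a y_a)`. -/
def expQuot (B : MvPolynomial σ ℂ) (ℓ : σ → ℂ) (M : ℕ) (p : MvPolynomial σ ℂ) (y : σ → ℂ) : ℂ :=
  eval y p / eval y B ^ M * Complex.exp (∑ a, ℓ a * y a)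

theorem expQuot_C_mul (B : MvPolynomial σ ℂ) (ℓ : σ → ℂ) (M : ℕ) (c : ℂ) (p : MvPolynomial σ ℂ)
    (y : σ → ℂ) : expQuot B ℓ M (C c * p) y = c * expQuot B ℓ M p y := by
  simp only [expQuot, map_mul, eval_C]
  ring

theorem expQuot_pow_mul (B : MvPolynomial σ ℂ) (ℓ : σ → ℂ) (M k : ℕ) (p : MvPolynomial σ ℂ)
    {y : σ → ℂ} (hy : eval y B ≠ 0) : expQuot B ℓ (M + k) (B ^ k * p) y = expQuot B ℓ M p y := by
  simp only [expQuot, map_mul, map_pow, pow_add]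
  field_simp

variable [DecidableEq σ]

omit [Fintype σ] in
theorem hasDerivAt_eval_update (p : MvPolynomial σ ℂ) (y : σ → ℂ) (a : σ) :
    HasDerivAt (fun t => eval (Function.update y a t) p) (eval y (pderiv a p)) (y a) := by
  induction p using MvPolynomial.induction_on with
  | C c => simpa using hasDerivAt_const (y a) c
  | add p q hp hq => simpa only [map_add] using hp.fun_add hq
  | mul_X p i hp =>
    have h1 : HasDerivAt (fun t => Function.update y a t i) (if i = a then (1 : ℂ) else 0) (y a) := by
      rcases eq_or_ne i a with rfl | h
      · simpa using hasDerivAt_id' (y i)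
      · simpa [h] using hasDerivAt_const (y a) (y i)
    have h2 := hp.fun_mul h1
    simp only [Function.update_eq_self] at h2
    simp only [map_mul, eval_X, pderiv_mul, map_add]
    refine h2.congr_deriv ?_
    rw [pderiv_X]
    congr 2
    rcases eq_or_ne i a with rfl | h
    · simp
    · simp [h]

theorem hasDerivAt_expQuot (B : MvPolynomial σ ℂ) (ℓ : σ → ℂ) (M : ℕ) (p : MvPolynomial σ ℂ)
    {y : σ → ℂ} (a : σ) (hy : eval y B ≠ 0) :
    HasDerivAt (fun t => expQuot B ℓ M p (Function.update y a t))
      (expQuot B ℓ (M + 1) (dOp B ℓ M a p) y) (y a) := by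
  have hp := hasDerivAt_eval_update p y a
  have hB := (hasDerivAt_eval_update B y a).pow M
  have hl : HasDerivAt (fun t => ∑ b, ℓ b * Function.update y a t b) (ℓ a) (y a) := by
    have h1 := hasDerivAt_eval_update (∑ b, C (ℓ b) * X b : MvPolynomial σ ℂ) y a
    simp only [map_sum, map_mul, eval_C, eval_X] at h1
    refine h1.congr_deriv ?_
    rw [Finset.sum_eq_single a]
    · simp
    · intro b _ hb
      rw [pderiv_C_mul, pderiv_X_of_ne hb, mul_zero, map_zero]
    · simp
  have h := (hp.div hB (by simpa using pow_ne_zero M hy)).mul hl.cexp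
  simp only [Function.update_eq_self, Pi.pow_apply, Pi.div_apply] at h
  refine h.congr_deriv ?_
  simp only [expQuot, dOp_apply, map_add, map_sub, map_mul, eval_C, map_natCast]
  rcases M with _ | M
  · simp
    field_simp
  · simp only [Nat.add_sub_cancel]
    field_simp
    push_cast
    ring

theorem hasDerivAt_expQuot_update (B : MvPolynomial σ ℂ) (ℓ : σ → ℂ) (M : ℕ) (p : MvPolynomial σ ℂ)
    {y : σ → ℂ} (a : σ) (t : ℂ) (hy : eval (Function.update y a t) B ≠ 0) :
    HasDerivAt (fun t => expQuot B ℓ M p (Function.update y a t))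
      (expQuot B ℓ (M + 1) (dOp B ℓ M a p) (Function.update y a t)) t := by
  simpa using hasDerivAt_expQuot B ℓ M p a hy

theorem iteratedDeriv_two_of_eventually {f g : ℂ → ℂ} {c t : ℂ}
    (h1 : ∀ᶠ s in nhds t, HasDerivAt f (g s) s) (h2 : HasDerivAt g c t) :
    iteratedDeriv 2 f t = c := by
  rw [iteratedDeriv_succ, iteratedDeriv_one]
  have : deriv f =ᶠ[nhds t] g := h1.mono fun s hs => hs.deriv
  rw [this.deriv_eq, h2.deriv]

theorem iteratedDeriv_two_expQuot (B : MvPolynomial σ ℂ) (ℓ : σ → ℂ) (M : ℕ) (p : MvPolynomial σ ℂ)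
    {y : σ → ℂ} (a : σ) (hy : eval y B ≠ 0) :
    iteratedDeriv 2 (fun t => expQuot B ℓ M p (Function.update y a t)) (y a) =
      expQuot B ℓ (M + 2) (dOp B ℓ (M + 1) a (dOp B ℓ M a p)) y := by
  refine iteratedDeriv_two_of_eventually ?_ (hasDerivAt_expQuot B ℓ (M + 1) _ a hy)
  have hc : ContinuousAt (fun t => eval (Function.update y a t) B) (y a) :=
    (hasDerivAt_eval_update B y a).continuousAt
  have hne : ∀ᶠ t in nhds (y a), eval (Function.update y a t) B ≠ 0 :=
    hc.eventually_ne (by simpa using hy)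
  exact hne.mono fun t ht => hasDerivAt_expQuot_update B ℓ M p a t ht

end ExpQuot

/-! ### The Schroedinger equation as an identity of numerators -/

section Schroedinger

variable {n : ℕ}

theorem eval_vdm_X (x : Fin n → ℂ) : eval x (vdm X : MvPolynomial (Fin n) ℂ) = vdm x := by
  rw [map_vdm]
  simp

/-- The sum of squares of the gradient of `log A` is the Calogero-Moser potential. -/
theorem sum_pderiv_vdm_sq {x : Fin n → ℂ} (hx : Function.Injective x) :
    ∑ i, eval x (pderiv i (vdm X : MvPolynomial (Fin n) ℂ)) ^ 2 =
      vdm x ^ 2 * ∑ i, ∑ j ∈ Finset.Ioi i, 2 / (x i - x j) ^ 2 := by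
  have h1 : ∀ i, eval x (pderiv i (vdm X : MvPolynomial (Fin n) ℂ)) = vdm x * ∑ j, (x i - x j)⁻¹ := by
    intro i
    have := map_pderiv_vdm (R := ℂ) (eval x) (by simpa using hx) i
    simpa only [eval_X, eval_vdm_X] using this
  simp only [h1, mul_pow, ← Finset.mul_sum]
  rw [sum_sum_inv_sq hx, sum_sum_eq_sum_Ioi]
  simp only [sub_self, inv_zero, ne_eq, OfNat.ofNat_ne_zero, not_false_eq_true, zero_pow,
    Finset.sum_const_zero, add_zero]
  congr 1
  refine Finset.sum_congr rfl fun i _ => Finset.sum_congr rfl fun j _ => ?_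
  rw [← neg_sub (x i) (x j), inv_neg, neg_sq, inv_pow]
  ring

theorem calogeroMoser_expQuot (m M : ℕ) (ν : Fin n → ℂ) (p : MvPolynomial (Fin n) ℂ)
    {x : Fin n → ℂ} (hx : Function.Injective x) :
    calogeroMoser n m (expQuot (vdm X) ν M p) x + (∑ i, ν i ^ 2) * expQuot (vdm X) ν M p x =
      expQuot (vdm X) ν (M + 2) (step (vdm X) ν m M p) x := by
  have hA : eval x (vdm X : MvPolynomial (Fin n) ℂ) ≠ 0 := by
    rw [eval_vdm_X]
    exact vdm_ne_zero hx
  unfold calogeroMoser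
  simp only [iteratedDeriv_two_expQuot _ _ _ _ _ hA]
  have hpot : (∑ i : Fin n, ∑ j ∈ Finset.Ioi i, 2 * (m : ℂ) * ((m : ℂ) + 1) / (x i - x j) ^ 2) =
      (m : ℂ) * ((m : ℂ) + 1) * ∑ i, ∑ j ∈ Finset.Ioi i, 2 / (x i - x j) ^ 2 := by
    simp only [Finset.mul_sum]
    exact Finset.sum_congr rfl fun i _ => Finset.sum_congr rfl fun j _ => by ring
  rw [hpot, step_apply]
  have hW := sum_pderiv_vdm_sq hx
  have hA' : vdm x ≠ 0 := vdm_ne_zero hx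
  set U := ∑ i, ∑ j ∈ Finset.Ioi i, 2 / (x i - x j) ^ 2
  simp only [expQuot, map_add, map_neg, map_sum, map_mul, map_pow, eval_C, map_natCast, map_one, hW,
    eval_vdm_X, ← Finset.sum_mul, ← Finset.sum_div]
  field_simp
  ring

/-- Specialization of the second group of variables. -/
def specialize (μ : Fin n → ℂ) : MvPolynomial (Fin n ⊕ Fin n) ℂ →ₐ[ℂ] MvPolynomial (Fin n) ℂ :=
  aeval (Sum.elim X fun i => C (μ i))

theorem eval_specialize (μ x : Fin n → ℂ) (P : MvPolynomial (Fin n ⊕ Fin n) ℂ) :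
    eval x (specialize μ P) = eval (Sum.elim x μ) P := by
  have : (eval x).comp (specialize μ).toRingHom = eval (Sum.elim x μ) := by
    refine MvPolynomial.ringHom_ext (fun c => ?_) fun i => ?_
    · simp [specialize]
    · rcases i with i | i <;> simp [specialize]
  exact congrArg (fun f => f P) this

theorem ansatz_eq_expQuot (m : ℕ) (P : MvPolynomial (Fin n ⊕ Fin n) ℂ) (x μ : Fin n → ℂ) :
    ansatz n m P x μ = expQuot (vdm X) μ m (C ((vdm μ ^ m)⁻¹) * specialize μ P) x := by
  rw [expQuot_C_mul]
  simp only [ansatz, expQuot, eval_specialize, eval_vdm_X]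
  rw [div_mul_eq_div_div_swap, div_eq_mul_inv _ (vdm μ ^ m)]
  ring

/-- A polynomial vanishing wherever a nonzero polynomial does not vanish is zero. -/
theorem eq_zero_of_eval_eq_zero_of_ne {σ : Type*} [Finite σ] {A p : MvPolynomial σ ℂ} (hA : A ≠ 0)
    (h : ∀ y, eval y A ≠ 0 → eval y p = 0) : p = 0 := by
  have : A * p = 0 := by
    refine MvPolynomial.funext fun y => ?_
    rw [map_mul, map_zero]
    by_cases hy : eval y A = 0
    · rw [hy, zero_mul]
    · rw [h y hy, mul_zero]
  exact (mul_eq_zero.1 this).resolve_left hA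

theorem injective_of_vdm_ne_zero {x : Fin n → ℂ} (h : vdm x ≠ 0) : Function.Injective x := by
  have key : ∀ i j, i < j → x i ≠ x j := fun i j hij hx => by
    refine h (Finset.prod_eq_zero (Finset.mem_univ i) (Finset.prod_eq_zero (Finset.mem_Ioi.2 hij) ?_))
    rw [hx, sub_self]
  intro i j hij
  by_contra hne
  rcases lt_or_gt_of_ne hne with h1 | h1
  exacts [key _ _ h1 hij, key _ _ h1 hij.symm]

theorem expQuot_eq_zero_iff {σ : Type*} [Fintype σ] {B : MvPolynomial σ ℂ} {ℓ : σ → ℂ} {M : ℕ}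
    {p : MvPolynomial σ ℂ} {y : σ → ℂ} (hy : eval y B ≠ 0) :
    expQuot B ℓ M p y = 0 ↔ eval y p = 0 := by
  simp [expQuot, hy, Complex.exp_ne_zero]

/-- A polynomial vanishing off the zero set of `A` is zero, so the equation at all regular `x`
becomes one polynomial identity for each regular `μ`. -/
theorem schrodinger_iff (m : ℕ) (P : MvPolynomial (Fin n ⊕ Fin n) ℂ) {μ : Fin n → ℂ}
    (hμ : Function.Injective μ) :
    (∀ x, Function.Injective x → calogeroMoser n m (fun y => ansatz n m P y μ) x =
      -(∑ i, μ i ^ 2) * ansatz n m P x μ) ↔ step (vdm X) μ m m (specialize μ P) = 0 := by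
  have hc : (vdm μ ^ m)⁻¹ ≠ 0 := inv_ne_zero (pow_ne_zero _ (vdm_ne_zero hμ))
  have h1 : ∀ x, Function.Injective x → ((calogeroMoser n m (fun y => ansatz n m P y μ) x =
      -(∑ i, μ i ^ 2) * ansatz n m P x μ) ↔ eval x (step (vdm X) μ m m (specialize μ P)) = 0) := by
    intro x hx
    have hA : eval x (vdm X : MvPolynomial (Fin n) ℂ) ≠ 0 := by
      rw [eval_vdm_X]
      exact vdm_ne_zero hx
    have h2 := calogeroMoser_expQuot m m μ (C ((vdm μ ^ m)⁻¹) * specialize μ P) hx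
    simp only [ansatz_eq_expQuot]
    rw [← sub_eq_zero, neg_mul, sub_neg_eq_add]
    erw [h2]
    rw [expQuot_eq_zero_iff hA, C_mul', map_smul, smul_eval, mul_eq_zero]
    simp [hc]
  constructor
  · intro h
    refine eq_zero_of_eval_eq_zero_of_ne (vdm_ne_zero (X_injective (R := ℂ) (σ := Fin n)))
      fun x hx => ?_
    rw [eval_vdm_X] at hx
    exact (h1 x (injective_of_vdm_ne_zero hx)).1 (h x (injective_of_vdm_ne_zero hx))
  · intro h x hx
    rw [h1 x hx, h, map_zero]

end Schroedinger

/-! ### Existence and uniqueness of the Baker-Akhiezer polynomial -/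

section BakerAkhiezer

variable {n : ℕ}

/-- The weight which counts the degree in the first group of variables. -/
abbrev inlWeight (n : ℕ) (τ : Type*) : Fin n ⊕ τ → ℕ := Sum.elim 1 0

theorem weight_inlWeight {τ : Type*} [Fintype τ] (d : (Fin n ⊕ τ) →₀ ℕ) :
    Finsupp.weight (inlWeight n τ) d = ∑ i, d (Sum.inl i) := by
  rw [Finsupp.weight_apply, Finsupp.sum_fintype _ _ (by simp), Fintype.sum_sum_type]
  simp

theorem specialize_mem_degLE (μ : Fin n → ℂ) {d : ℤ} {P : MvPolynomial (Fin n ⊕ Fin n) ℂ}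
    (hP : P ∈ degLE ℂ (inlWeight n (Fin n)) d) : specialize μ P ∈ degLE ℂ 1 d := by
  rw [P.as_sum, map_sum]
  refine sum_mem fun s hs => degLE_mono (hP s hs) ?_
  rw [specialize, aeval_monomial, Finsupp.prod_fintype _ _ (by simp), Fintype.prod_sum_type]
  have h1 : ∏ i, (Sum.elim X (fun i => C (μ i)) (Sum.inl i : Fin n ⊕ Fin n) :
      MvPolynomial (Fin n) ℂ) ^ s (Sum.inl i) ∈ degLE ℂ 1 (∑ i, (s (Sum.inl i) : ℤ)) :=
    prod_mem_degLE _ fun i _ => by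
      simpa using pow_mem_degLE (X_mem_degLE (R := ℂ) 1 i) (s (Sum.inl i))
  have h2 : ∏ i, (Sum.elim X (fun i => C (μ i)) (Sum.inr i : Fin n ⊕ Fin n) :
      MvPolynomial (Fin n) ℂ) ^ s (Sum.inr i) = C (∏ i, μ i ^ s (Sum.inr i)) := by
    simp
  rw [h2, weight_inlWeight, MvPolynomial.algebraMap_eq, mul_comm (∏ i, _)]
  push_cast
  exact C_mul_mem_degLE _ (C_mul_mem_degLE _ h1)

theorem specialize_leadingTerm (m : ℕ) (μ : Fin n → ℂ) :
    specialize μ (leadingTerm n m) = vdm X ^ m * C (vdm μ ^ m) := by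
  refine MvPolynomial.funext fun x => ?_
  rw [eval_specialize, leadingTerm, map_mul, map_pow, map_pow, map_vdm, map_vdm, map_mul, map_pow,
    map_vdm, eval_C]
  simp

theorem eq_zero_of_specialize {P : MvPolynomial (Fin n ⊕ Fin n) ℂ}
    (h : ∀ μ, Function.Injective μ → specialize μ P = 0) : P = 0 := by
  have hA : (vdm fun i : Fin n => (X (Sum.inr i) : MvPolynomial (Fin n ⊕ Fin n) ℂ)) ≠ 0 :=
    vdm_ne_zero (X_injective.comp Sum.inr_injective)
  refine eq_zero_of_eval_eq_zero_of_ne hA fun y hy => ?_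
  rw [map_vdm] at hy
  simp only [eval_X] at hy
  have h1 := congrArg (eval fun i => y (Sum.inl i)) (h _ (injective_of_vdm_ne_zero hy))
  rw [eval_specialize, map_zero] at h1
  rw [← h1]
  congr
  funext i
  rcases i with i | i <;> rfl

/-- Uniqueness uses only the bound on the degree in `x`. This is what lets the scaling argument
deduce the bound in `μ` afterwards. -/
theorem eq_of_specialize_step {m : ℕ} {P P' : MvPolynomial (Fin n ⊕ Fin n) ℂ}
    (hd : P - leadingTerm n m ∈ degLE ℂ (inlWeight n (Fin n)) (m * n.choose 2 - 1))
    (hd' : P' - leadingTerm n m ∈ degLE ℂ (inlWeight n (Fin n)) (m * n.choose 2 - 1))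
    (h : ∀ μ, Function.Injective μ → step (vdm X) μ m m (specialize μ P) = 0)
    (h' : ∀ μ, Function.Injective μ → step (vdm X) μ m m (specialize μ P') = 0) : P = P' := by
  rw [← sub_eq_zero]
  refine eq_zero_of_specialize fun μ hμ => eq_zero_of_step_eq_zero hμ (m := m) (M := m) ?_ ?_
  · refine specialize_mem_degLE μ ?_
    have := sub_mem hd hd'
    rwa [sub_sub_sub_cancel_right] at this
  · rw [map_sub, map_sub, h μ hμ, h' μ hμ, sub_self]

theorem isBAPolynomial_iff {m : ℕ} {P : MvPolynomial (Fin n ⊕ Fin n) ℂ} :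
    IsBAPolynomial n m P ↔
      (∀ d ∈ (P - leadingTerm n m).support, ∑ i : Fin n, d (Sum.inl i) < m * n.choose 2 ∧
        ∑ i : Fin n, d (Sum.inr i) < m * n.choose 2) ∧
      ∀ μ, Function.Injective μ → step (vdm X) μ m m (specialize μ P) = 0 := by
  constructor
  · rintro ⟨h1, h2⟩
    exact ⟨h1, fun μ hμ => (schrodinger_iff m P hμ).1 fun x hx => h2 x μ hx hμ⟩
  · rintro ⟨h1, h2⟩
    exact ⟨h1, fun x μ hx hμ => (schrodinger_iff m P hμ).2 (h2 μ hμ) x hx⟩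

theorem mem_degLE_of_leading {m : ℕ} {P : MvPolynomial (Fin n ⊕ Fin n) ℂ}
    (h : ∀ d ∈ (P - leadingTerm n m).support, ∑ i : Fin n, d (Sum.inl i) < m * n.choose 2 ∧
        ∑ i : Fin n, d (Sum.inr i) < m * n.choose 2) :
    P - leadingTerm n m ∈ degLE ℂ (inlWeight n (Fin n)) (m * n.choose 2 - 1) := by
  intro d hd
  rw [weight_inlWeight]
  have := (h d hd).1
  zify at this
  push_cast
  linarith

theorem coeff_scale {σ R : Type*} [CommRing R] (c : σ → R) (p : MvPolynomial σ R) (d : σ →₀ ℕ) :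
    coeff d (aeval (fun i => C (c i) * X i : σ → MvPolynomial σ R) p) =
      (d.prod fun i k => c i ^ k) * coeff d p := by
  classical
  induction p using MvPolynomial.induction_on' with
  | monomial s a =>
    have : aeval (fun i => C (c i) * X i : σ → MvPolynomial σ R) (monomial s a) =
        monomial s ((s.prod fun i k => c i ^ k) * a) := by
      rw [aeval_monomial, monomial_eq (s := s)]
      simp only [mul_pow, Finsupp.prod_mul, MvPolynomial.algebraMap_eq, map_mul]
      have : (s.prod fun i k => (C (c i) : MvPolynomial σ R) ^ k) = C (s.prod fun i k => c i ^ k) := by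
        simp [Finsupp.prod, map_prod]
      rw [this]
      ring
    rw [this, coeff_monomial, coeff_monomial]
    split_ifs with h
    · rw [h]
    · rw [mul_zero]
  | add p q hp hq => rw [map_add, coeff_add, coeff_add, hp, hq, mul_add]

theorem pderiv_scale {σ R : Type*} [CommRing R] (c : R) (p : MvPolynomial σ R) (i : σ) :
    pderiv i (aeval (fun i => C c * X i : σ → MvPolynomial σ R) p) =
      C c * aeval (fun i => C c * X i : σ → MvPolynomial σ R) (pderiv i p) := by
  classical
  induction p using MvPolynomial.induction_on with
  | C a => simp
  | add p q hp hq => simp only [map_add, hp, hq, mul_add]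
  | mul_X p j hp =>
    simp only [map_mul, aeval_X, pderiv_mul, hp, pderiv_C, map_add, pderiv_X]
    rcases eq_or_ne j i with rfl | h
    · simp; ring
    · simp [h]; ring

theorem step_scale {σ R : Type*} [Fintype σ] [CommRing R] (c : R) (A p : MvPolynomial σ R)
    (ν : σ → R) (m M : ℕ) :
    step (aeval (fun i => C c * X i : σ → MvPolynomial σ R) A) (fun i => c * ν i) m M
        (aeval (fun i => C c * X i : σ → MvPolynomial σ R) p) =
      C c ^ 2 * aeval (fun i => C c * X i : σ → MvPolynomial σ R) (step A ν m M p) := by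
  set s : MvPolynomial σ R →ₐ[R] MvPolynomial σ R := aeval (fun i => C c * X i)
  have h1 : ∀ M i q, dOp (s A) (fun i => c * ν i) M i (s q) = C c * s (dOp A ν M i q) := by
    intro M i q
    have hC : s (C (ν i)) = C (ν i) := by simp [s]
    simp only [dOp_apply, map_add, map_sub, map_mul, map_natCast, s, pderiv_scale]
    simp
    ring
  have hC : ∀ r, s (C r) = C r := fun r => by simp [s]
  have h2 : ∀ i, dOp (s A) (fun i => c * ν i) (M + 1) i (dOp (s A) (fun i => c * ν i) M i (s p)) =
      C c ^ 2 * s (dOp A ν (M + 1) i (dOp A ν M i p)) := by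
    intro i
    rw [h1, C_mul', map_smul, h1, ← C_mul']
    ring
  simp only [step_apply, h2, map_add, map_neg, map_sum, map_mul, map_pow, map_natCast, map_one, hC,
    ← Finset.mul_sum, mul_pow]
  simp only [s, pderiv_scale, mul_pow, ← Finset.mul_sum]
  ring

theorem step_C_mul {σ R : Type*} [Fintype σ] [CommRing R] (c : R) (A p : MvPolynomial σ R)
    (ν : σ → R) (m M : ℕ) : step (C c * A) ν m M p = C c ^ 2 * step A ν m M p := by
  have h1 : ∀ M i q, dOp (C c * A) ν M i q = C c * dOp A ν M i q := by
    intro M i q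
    simp only [dOp_apply, pderiv_C_mul]
    ring
  have h2 : ∀ i, dOp (C c * A) ν (M + 1) i (dOp (C c * A) ν M i p) =
      C c ^ 2 * dOp A ν (M + 1) i (dOp A ν M i p) := by
    intro i
    rw [h1, h1, C_mul', C_mul', map_smul, ← C_mul', ← C_mul']
    ring
  simp only [step_apply, h2, pderiv_C_mul, mul_pow, ← Finset.mul_sum]
  ring

theorem map_step {σ R S : Type*} [Fintype σ] [CommRing R] [CommRing S] (f : R →+* S)
    (A p : MvPolynomial σ R) (ν : σ → R) (m M : ℕ) :
    map f (step A ν m M p) = step (map f A) (fun i => f (ν i)) m M (map f p) := by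
  simp [step_apply, dOp_apply, pderiv_map]

theorem vdm_const_mul {R : Type*} [CommRing R] (c : R) (u : Fin n → R) :
    vdm (fun i => c * u i) = c ^ n.choose 2 * vdm u := by
  simp only [vdm, ← mul_sub, Finset.prod_mul_distrib, Finset.prod_const, Finset.prod_pow_eq_pow_sum,
    sum_card_Ioi]

end BakerAkhiezer

/-! ### Existence with polynomial dependence on the spectral variables -/

section BakerAkhiezerExistence

variable {n : ℕ}

theorem specialize_sumAlgEquiv_symm (μ : Fin n → ℂ)
    (Q : MvPolynomial (Fin n) (MvPolynomial (Fin n) ℂ)) :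
    specialize μ ((sumAlgEquiv ℂ (Fin n) (Fin n)).symm Q) = map (eval μ) Q := by
  obtain ⟨P, rfl⟩ := (sumAlgEquiv ℂ (Fin n) (Fin n)).surjective Q
  rw [AlgEquiv.symm_apply_apply]
  have : (specialize μ).toRingHom = (map (eval μ)).comp (sumAlgEquiv ℂ (Fin n) (Fin n)).toRingHom := by
    refine MvPolynomial.ringHom_ext (fun c => ?_) fun i => ?_
    · simp [specialize]
    · rcases i with i | i <;> simp [specialize]
  exact congrArg (fun f => f P) this

theorem sumAlgEquiv_symm_mem_degLE {d : ℤ} {Q : MvPolynomial (Fin n) (MvPolynomial (Fin n) ℂ)}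
    (hQ : Q ∈ degLE (MvPolynomial (Fin n) ℂ) 1 d) :
    (sumAlgEquiv ℂ (Fin n) (Fin n)).symm Q ∈ degLE ℂ (inlWeight n (Fin n)) d := by
  have hC : ∀ r : MvPolynomial (Fin n) ℂ,
      (sumAlgEquiv ℂ (Fin n) (Fin n)).symm (C r) ∈ degLE ℂ (inlWeight n (Fin n)) 0 := by
    intro r
    induction r using MvPolynomial.induction_on with
    | C a => rw [sumAlgEquiv_symm_C_C]; exact C_mem_degLE _
    | add p q hp hq => rw [map_add, map_add]; exact add_mem hp hq
    | mul_X p i hp =>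
      rw [map_mul, map_mul, sumAlgEquiv_symm_C_X]
      exact mul_mem_degLE_of_eq hp (X_mem_degLE _ _) (by simp)
  rw [Q.as_sum, map_sum]
  refine sum_mem fun s hs => degLE_mono (hQ s hs) ?_
  rw [monomial_eq, map_mul, Finsupp.weight_apply, Finsupp.prod, Finsupp.sum, map_prod]
  refine mul_mem_degLE_of_eq (hC _) (prod_mem_degLE (d := fun i => (s i : ℤ)) _ fun i _ => ?_) (by simp)
  rw [map_pow, sumAlgEquiv_symm_X]
  simpa using pow_mem_degLE (X_mem_degLE (R := ℂ) (inlWeight n (Fin n)) (Sum.inl i)) (s i)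

/-- Berest's iteration is run over the coefficient ring `ℂ[μ]` with `ν = X` generic, so the result
is automatically polynomial in `μ`. Dividing by the complex constant `(-2)^N N!` normalizes the
leading term. -/
theorem exists_specialize_step (n : ℕ) {m : ℕ} (hm : 1 ≤ m) :
    ∃ P : MvPolynomial (Fin n ⊕ Fin n) ℂ,
      P - leadingTerm n m ∈ degLE ℂ (inlWeight n (Fin n)) (m * n.choose 2 - 1) ∧
      ∀ μ, step (vdm X) μ m m (specialize μ P) = 0 := by
  obtain ⟨Q, -, hQ, hQ0, hQN⟩ := exists_berest_sequence (R := MvPolynomial (Fin n) ℂ)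
    (ν := X) (X_injective (R := ℂ)) hm
  set N := m * n.choose 2 with hN
  let c : ℂ := (-2) ^ N * N.factorial
  have hc : c ≠ 0 := mul_ne_zero (pow_ne_zero _ (by norm_num)) (Nat.cast_ne_zero.2 N.factorial_ne_zero)
  refine ⟨C c⁻¹ * (sumAlgEquiv ℂ (Fin n) (Fin n)).symm (Q N), ?_, fun μ => ?_⟩
  · have h1 := C_mul_mem_degLE c⁻¹ (sumAlgEquiv_symm_mem_degLE hQN)
    convert h1 using 1
    rw [map_sub, mul_sub]
    congr 1
    have hcc : (C ((-2) ^ N * ((N.factorial : MvPolynomial (Fin n) ℂ) * vdm X ^ m)) :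
        MvPolynomial (Fin n) (MvPolynomial (Fin n) ℂ)) = C (C c) * C (vdm X) ^ m := by
      simp only [c, map_mul, map_pow, map_neg, map_ofNat, map_natCast]
      ring
    have e1 : (sumAlgEquiv ℂ (Fin n) (Fin n)).symm (vdm X) = vdm fun i => X (Sum.inl i) := by
      have := map_vdm (sumAlgEquiv ℂ (Fin n) (Fin n)).symm.toRingEquiv.toRingHom
        (X : Fin n → MvPolynomial (Fin n) (MvPolynomial (Fin n) ℂ))
      simpa using this
    have e2 : (sumAlgEquiv ℂ (Fin n) (Fin n)).symm (C (vdm X)) = vdm fun i => X (Sum.inr i) := by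
      have := map_vdm ((sumAlgEquiv ℂ (Fin n) (Fin n)).symm.toRingEquiv.toRingHom.comp C)
        (X : Fin n → MvPolynomial (Fin n) ℂ)
      simpa using this
    rw [hcc, map_mul, map_mul, sumAlgEquiv_symm_C_C, map_pow, map_pow, e1, e2, leadingTerm]
    have : (C c⁻¹ * C c : MvPolynomial (Fin n ⊕ Fin n) ℂ) = 1 := by
      rw [← map_mul, inv_mul_cancel₀ hc, map_one]
    linear_combination (-(vdm fun i => X (Sum.inl i)) ^ m * (vdm fun i => X (Sum.inr i)) ^ m) * this
  · have h1 := hQ N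
    rw [hQ0, mul_zero] at h1
    have h2 := map_step (eval μ) (vdm X) (Q N) X m m
    rw [← h1, map_zero] at h2
    have e1 : map (eval μ) (vdm X : MvPolynomial (Fin n) (MvPolynomial (Fin n) ℂ)) = vdm X := by
      rw [map_vdm]
      simp
    rw [e1] at h2
    simp only [eval_X] at h2
    have e2 : specialize μ (C c⁻¹ * (sumAlgEquiv ℂ (Fin n) (Fin n)).symm (Q N)) =
        c⁻¹ • map (eval μ) (Q N) := by
      rw [map_mul, specialize_sumAlgEquiv_symm, ← C_mul']
      congr 1
      simp [specialize]
    rw [e2, map_smul, ← h2, smul_zero]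

/-- A solution is invariant under `(x, μ) ↦ (2 x, μ / 2)`, hence bihomogeneous. -/
theorem sum_inl_eq_sum_inr {m : ℕ} {P : MvPolynomial (Fin n ⊕ Fin n) ℂ}
    (hd : P - leadingTerm n m ∈ degLE ℂ (inlWeight n (Fin n)) (m * n.choose 2 - 1))
    (h : ∀ μ, Function.Injective μ → step (vdm X) μ m m (specialize μ P) = 0)
    {d : (Fin n ⊕ Fin n) →₀ ℕ} (hdP : coeff d (P - leadingTerm n m) ≠ 0) :
    ∑ i, d (Sum.inl i) = ∑ i, d (Sum.inr i) := by
  -- The scale `2` works because its powers are distinct: invariance of a monomial forces equal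
  -- degrees in the two groups.
  let κ : Fin n ⊕ Fin n → ℂ := Sum.elim (fun _ => 2) (fun _ => 2⁻¹)
  let S : MvPolynomial (Fin n ⊕ Fin n) ℂ →ₐ[ℂ] MvPolynomial (Fin n ⊕ Fin n) ℂ :=
    aeval fun i => C (κ i) * X i
  have hlead : S (leadingTerm n m) = leadingTerm n m := by
    have e1 : S (vdm fun i => X (Sum.inl i)) =
        C 2 ^ n.choose 2 * vdm fun i => X (Sum.inl i) := by
      rw [← vdm_const_mul]
      have := map_vdm S.toRingHom (fun i => (X (Sum.inl i) : MvPolynomial (Fin n ⊕ Fin n) ℂ))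
      simpa [S, κ] using this
    have e2 : S (vdm fun i => X (Sum.inr i)) =
        C 2⁻¹ ^ n.choose 2 * vdm fun i => X (Sum.inr i) := by
      rw [← vdm_const_mul]
      have := map_vdm S.toRingHom (fun i => (X (Sum.inr i) : MvPolynomial (Fin n ⊕ Fin n) ℂ))
      simpa [S, κ] using this
    have e3 : (C (2 : ℂ) ^ n.choose 2 * C (2⁻¹ : ℂ) ^ n.choose 2 : MvPolynomial (Fin n ⊕ Fin n) ℂ) = 1 := by
      rw [← mul_pow, ← map_mul]
      simp
    rw [leadingTerm, map_mul, map_pow, map_pow, e1, e2, ← mul_pow, ← mul_pow]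
    congr 1
    linear_combination ((vdm fun i => X (Sum.inl i)) * (vdm fun i => X (Sum.inr i))) * e3
  -- The rescaled polynomial solves the same equation with the same leading term, so uniqueness
  -- applies.
  have hSP : S P = P := by
    refine eq_of_specialize_step (m := m) ?_ hd (fun μ hμ => ?_) h
    · rw [← hlead, ← map_sub]
      intro s hs
      refine hd s ?_
      rw [mem_support_iff, coeff_scale] at hs
      exact mem_support_iff.2 (right_ne_zero_of_mul hs)
    · let s : MvPolynomial (Fin n) ℂ →ₐ[ℂ] MvPolynomial (Fin n) ℂ := aeval fun i => C 2 * X i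
      have e1 : specialize μ (S P) = s (specialize (fun i => 2⁻¹ * μ i) P) := by
        have : (specialize μ).comp S = s.comp (specialize fun i => 2⁻¹ * μ i) := by
          refine MvPolynomial.algHom_ext fun i => ?_
          rcases i with i | i <;> simp [S, s, κ, specialize]
        exact congrArg (fun f => f P) this
      have e2 : s (vdm X) = C (2 ^ n.choose 2) * vdm X := by
        have := map_vdm s.toRingHom (X : Fin n → MvPolynomial (Fin n) ℂ)
        rw [map_pow, ← vdm_const_mul]
        simpa [s] using this
      have h1 := step_scale (2 : ℂ) (vdm X) (specialize (fun i => 2⁻¹ * μ i) P)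
        (fun i => 2⁻¹ * μ i) m m
      have hinj : Function.Injective fun i => (2⁻¹ : ℂ) * μ i := fun i j hij =>
        hμ (mul_left_cancel₀ (by norm_num) hij)
      rw [h _ hinj, map_zero, mul_zero] at h1
      have e3 : (fun i => (2 : ℂ) * (2⁻¹ * μ i)) = μ := by
        funext i
        ring
      change step (s (vdm X)) _ m m (s _) = 0 at h1
      rw [e2, e3, step_C_mul, ← e1] at h1
      refine (mul_eq_zero.1 h1).resolve_left (pow_ne_zero _ ?_)
      simp
  have h1 := coeff_scale κ (P - leadingTerm n m) d
  change coeff d (S (P - leadingTerm n m)) = _ at h1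
  rw [map_sub, hSP, hlead, Finsupp.prod_fintype _ _ (by simp), Fintype.prod_sum_type] at h1
  simp only [κ, Sum.elim_inl, Sum.elim_inr, Finset.prod_pow_eq_pow_sum] at h1
  have h2 : (2 : ℂ) ^ (∑ i, d (Sum.inl i)) * (2⁻¹ : ℂ) ^ (∑ i, d (Sum.inr i)) = 1 := by
    apply mul_right_cancel₀ hdP
    rw [← h1, one_mul]
  rw [inv_pow, mul_inv_eq_one₀ (pow_ne_zero _ two_ne_zero)] at h2
  have h3 : (2 : ℕ) ^ ∑ i, d (Sum.inl i) = 2 ^ ∑ i, d (Sum.inr i) := by exact_mod_cast h2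
  exact Nat.pow_right_injective le_rfl h3

theorem existsUnique_isBAPolynomial (n : ℕ) {m : ℕ} (hm : 1 ≤ m) : ∃! P, IsBAPolynomial n m P := by
  obtain ⟨P, hd, hP⟩ := exists_specialize_step n hm
  refine ⟨P, isBAPolynomial_iff.2 ⟨fun d hdP => ?_, fun μ _ => hP μ⟩, fun P' hP' => ?_⟩
  · have h1 : ∑ i, d (Sum.inl i) < m * n.choose 2 := by
      have := hd d hdP
      rw [weight_inlWeight] at this
      zify
      push_cast at this ⊢
      linarith
    refine ⟨h1, ?_⟩
    rwa [← sum_inl_eq_sum_inr hd (fun μ _ => hP μ) (mem_support_iff.1 hdP)]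
  · obtain ⟨h1, h2⟩ := isBAPolynomial_iff.1 hP'
    exact eq_of_specialize_step (mem_degLE_of_leading h1) hd h2 fun μ _ => hP μ

end BakerAkhiezerExistence

/-! ### The kernel function -/

section Kernel

variable {K : Type*} [Field K] [CharZero K] {ι : Type*} [Fintype ι] [DecidableEq ι]

omit [CharZero K] [Fintype ι] in
theorem derivation_inv_sub {y : ι → K} {D : ι → Derivation ℤ K K}
    (hD : ∀ a b, D a (y b) = if a = b then 1 else 0) (a b : ι) :
    D a ((y a - y b)⁻¹) = -(y a - y b)⁻¹ ^ 2 := by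
  rcases eq_or_ne a b with rfl | hab
  · simp
  · rw [Derivation.leibniz_inv, map_sub, hD, hD]
    simp [hab]

/-- The signed Laplacian of the deformed kernel `∏ (y_a - y_b) ^ (- m s_a s_b)`. -/
theorem sum_derivation_kernel (m : ℕ) {s y : ι → K} (hy : Function.Injective y)
    (hs : ∀ a, s a ^ 2 = 1) {D : ι → Derivation ℤ K K} (hDs : ∀ a b, D a (s b) = 0)
    (hD : ∀ a b, D a (y b) = if a = b then 1 else 0) {κ : K}
    (hκ : ∀ a, D a κ = -((m : K) * (s a * ∑ b, s b * (y a - y b)⁻¹) * κ)) :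
    ∑ a, s a * D a (D a κ) =
      (m : K) * ((m : K) + 1) * (∑ a, s a * ∑ b, (y a - y b)⁻¹ ^ 2) * κ := by
  have h1 : ∀ a, s a * D a (D a κ) = (m : K) ^ 2 * κ * (s a * (∑ b, s b * (y a - y b)⁻¹) ^ 2)
      + (m : K) * κ * ∑ b, s b * (y a - y b)⁻¹ ^ 2 := by
    intro a
    have h2 : D a (∑ b, s b * (y a - y b)⁻¹) = -∑ b, s b * (y a - y b)⁻¹ ^ 2 := by
      rw [map_sum, ← Finset.sum_neg_distrib]
      refine Finset.sum_congr rfl fun b _ => ?_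
      rw [Derivation.leibniz, hDs, derivation_inv_sub hD]
      simp
    have h3 : D a (m : K) = 0 := (D a).map_natCast m
    rw [hκ a]
    simp only [map_neg, Derivation.leibniz, smul_eq_mul, h2, h3, hDs, hκ a]
    linear_combination (m : K) * κ * ((m : K) * s a * (∑ b, s b * (y a - y b)⁻¹) ^ 2
      + ∑ b, s b * (y a - y b)⁻¹ ^ 2) * hs a
  simp only [h1, Finset.sum_add_distrib, ← Finset.mul_sum]
  rw [sum_mul_sum_inv_sq s hy]
  -- After symmetrization a pair `a, b` carries the weight `s a + s b`, so mixed pairs of opposite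
  -- sign cancel. The two potentials therefore decouple.
  have h4 : ∑ a, ∑ b, s b * (y a - y b)⁻¹ ^ 2 = ∑ a, s a * ∑ b, (y a - y b)⁻¹ ^ 2 := by
    rw [Finset.sum_comm]
    refine Finset.sum_congr rfl fun a _ => ?_
    rw [Finset.mul_sum]
    refine Finset.sum_congr rfl fun b _ => ?_
    rw [← neg_sub (y a) (y b), inv_neg, neg_sq]
  simp only [hs, one_mul, h4]
  ring

-- Translation invariance of the kernel; it disposes of the first-order terms proportional to `L`.
omit [DecidableEq ι] in
theorem sum_derivation_kernel_eq_zero (m : ℕ) {s y : ι → K} {D : ι → Derivation ℤ K K} {κ : K}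
    (hκ : ∀ a, D a κ = -((m : K) * (s a * ∑ b, s b * (y a - y b)⁻¹) * κ)) : ∑ a, D a κ = 0 := by
  have h : ∑ a, ∑ b, s a * (s b * (y a - y b)⁻¹) = 0 := by
    refine self_eq_neg.1 ?_
    conv_lhs => rw [Finset.sum_comm]
    simp only [← Finset.sum_neg_distrib]
    refine Finset.sum_congr rfl fun a _ => Finset.sum_congr rfl fun b _ => ?_
    rw [← neg_sub (y a) (y b), inv_neg]
    ring
  simp only [← Finset.mul_sum] at h
  simp only [hκ, Finset.sum_neg_distrib, ← Finset.sum_mul, ← Finset.mul_sum, h, mul_zero, zero_mul,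
    neg_zero]

/-- The intertwining identity behind the integral formula. -/
theorem kernel_intertwining {k : ℕ} (m : ℕ) {x : Fin (k + 1) → K} {z : Fin k → K}
    (hy : Function.Injective (Sum.elim x z)) {Y : Fin (k + 1) → Derivation ℤ K K}
    {Z : Fin k → Derivation ℤ K K} (hYx : ∀ a b, Y a (x b) = if a = b then 1 else 0)
    (hYz : ∀ a i, Y a (z i) = 0) (hZx : ∀ i a, Z i (x a) = 0)
    (hZz : ∀ i j, Z i (z j) = if i = j then 1 else 0) {κ f L : K} {ν : Fin k → K}
    (hYκ : ∀ a, Y a κ = -((m : K) * (∑ b, (x a - x b)⁻¹ - ∑ i, (x a - z i)⁻¹) * κ))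
    (hZκ : ∀ i, Z i κ = -((m : K) * (∑ j, (z i - z j)⁻¹ - ∑ a, (z i - x a)⁻¹) * κ))
    (hYf : ∀ a, Y a f = 0) (hYL : ∀ a, Y a L = 0)
    (hYZ : ∀ i u, Y i.castSucc (Z i u) = Z i (Y i.castSucc u)) (hYν : ∀ a i, Y a (ν i) = 0) (hZν : ∀ i j, Z i (ν j) = 0)
    {X T : K → Fin k → K} {U : K → K} (hX : ∀ u i, X u i = Y i.castSucc u + Z i u + ν i * u)
    (hU : ∀ u, U u = Y (Fin.last k) u + L * u) (hT : ∀ u i, T u i = Z i u + (ν i - L) * u)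
    {E : K → Fin k → K} (hE : ∀ u i, E u i = Z i u + ν i * u) :
    -(∑ i, X (X (κ * f) i) i + U (U (κ * f)))
        + (m : K) * ((m : K) + 1) * (∑ a, ∑ b, (x a - x b)⁻¹ ^ 2) * (κ * f)
        + (∑ i, ν i ^ 2 + L ^ 2) * (κ * f) =
      κ * (-∑ i, E (E f i) i + (m : K) * ((m : K) + 1) * (∑ i, ∑ j, (z i - z j)⁻¹ ^ 2) * f
        + (∑ i, ν i ^ 2) * f) - 2 * ∑ i, T (X (κ * f) i - κ * E f i) i := by
  let s : Fin (k + 1) ⊕ Fin k → K := Sum.elim (fun _ => 1) (fun _ => -1)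
  let D : Fin (k + 1) ⊕ Fin k → Derivation ℤ K K := Sum.elim Y Z
  have hκ : ∀ a, D a κ = -((m : K) *
      (s a * ∑ b, s b * (Sum.elim x z a - Sum.elim x z b)⁻¹) * κ) := by
    rintro (a | i)
    · simp [D, s, hYκ, sub_eq_add_neg]
    · simp only [D, s, hZκ, Fintype.sum_sum_type, Sum.elim_inl, Sum.elim_inr, one_mul, neg_one_mul,
        Finset.sum_neg_distrib, ← sub_eq_add_neg]
      ring
  have h1 := sum_derivation_kernel m hy (s := s) (D := D) (κ := κ)
    (by rintro (a | i) <;> simp [s]) (by rintro (a | i) (b | j) <;> simp [s, D])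
    (by rintro (a | i) (b | j) <;> simp [D, hYx, hYz, hZx, hZz]) hκ
  have h2 := sum_derivation_kernel_eq_zero m hκ
  simp only [Fintype.sum_sum_type, D, s, Sum.elim_inl, Sum.elim_inr, one_mul, neg_one_mul,
    Finset.sum_neg_distrib, Finset.sum_add_distrib] at h1 h2
  have h3 : ∑ i, ∑ a, (z i - x a)⁻¹ ^ 2 = ∑ a, ∑ i, (x a - z i)⁻¹ ^ 2 := by
    rw [Finset.sum_comm]
    refine Finset.sum_congr rfl fun a _ => Finset.sum_congr rfl fun i _ => ?_
    rw [← neg_sub (x a) (z i), inv_neg, neg_sq]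
  rw [h3] at h1
  rw [Fin.sum_univ_castSucc (fun a => Y a (Y a κ))] at h1
  rw [Fin.sum_univ_castSucc (fun a => Y a κ)] at h2
  -- `X (κ f) i - κ E f i` is `(Y_i κ + Z_i κ) f`. Subtracting twice its `T`-derivative removes the
  -- mixed second derivatives of `κ` and all products of derivatives of `κ` and `f`.
  have hX2 : ∀ i, X (X (κ * f) i) i - 2 * T (X (κ * f) i - κ * E f i) i =
      (Y i.castSucc (Y i.castSucc κ) + 2 * L * Y i.castSucc κ - (Z i (Z i κ) - 2 * L * Z i κ)) * f
        + κ * E (E f i) i := by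
    intro i
    simp only [hX, hT, hE, Derivation.leibniz, map_add, map_sub, smul_eq_mul, hYf, hYν, hZν]
    simp only [hYZ, hYf, map_zero]
    ring
  have hU2 : U (U (κ * f)) = (Y (Fin.last k) (Y (Fin.last k) κ) + 2 * L * Y (Fin.last k) κ
      + L ^ 2 * κ) * f := by
    simp only [hU, Derivation.leibniz, map_add, smul_eq_mul, hYf, hYL]
    simp only [map_zero]
    ring
  have hX3 := Finset.sum_congr (rfl : Finset.univ = Finset.univ) fun i _ => hX2 i
  rw [Finset.sum_sub_distrib, ← Finset.mul_sum, Finset.sum_add_distrib, ← Finset.sum_mul,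
    Finset.sum_sub_distrib, Finset.sum_sub_distrib, Finset.sum_add_distrib, ← Finset.mul_sum,
    ← Finset.mul_sum, ← Finset.mul_sum] at hX3
  linear_combination -hX3 - hU2 - f * h1 - 2 * L * f * h2

end Kernel

/-! ### The integrand as a polynomial quotient in the point and the contour parameters -/

section Lift

variable {σ R K : Type*} [CommRing R] [Field K]

/-- Translates numerators into honest quotients in a field, where the kernel identity can be proved
by logarithmic derivatives. -/
theorem map_dOp (ev : MvPolynomial σ R →+* K) {a : σ} {D : Derivation ℤ K K}
    (hD : ∀ p, D (ev p) = ev (pderiv a p)) {B : MvPolynomial σ R} (hB : ev B ≠ 0) (ℓ : σ → R) (M : ℕ)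
    (p : MvPolynomial σ R) :
    ev (dOp B ℓ M a p) / ev B ^ (M + 1) = D (ev p / ev B ^ M) + ev (C (ℓ a)) * (ev p / ev B ^ M) := by
  rw [Derivation.leibniz_div, Derivation.leibniz_pow, hD, hD, dOp_apply]
  simp only [map_add, map_sub, map_mul, map_natCast, smul_eq_mul, nsmul_eq_mul]
  rcases M with _ | M
  · simp
    field_simp
  · simp only [Nat.add_sub_cancel]
    field_simp
    ring

/-- The logarithmic derivative of the kernel. -/
theorem derivation_crossKernel {k l : ℕ} (m : ℕ) {x : Fin l → K} {z : Fin k → K}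
    (hy : Function.Injective (Sum.elim x z)) (D : Derivation ℤ K K) :
    D ((∏ i, ∏ a, (z i - x a)) ^ m / (vdm x ^ m * vdm z ^ m)) =
      (m : K) * ((∏ i, ∏ a, (z i - x a)) ^ m / (vdm x ^ m * vdm z ^ m)) *
        ((∑ i, ∑ a, (D (z i) - D (x a)) * (z i - x a)⁻¹) - (∑ a, D (x a) * ∑ b, (x a - x b)⁻¹)
          - ∑ i, D (z i) * ∑ j, (z i - z j)⁻¹) := by
  have hx : Function.Injective x := hy.comp Sum.inl_injective
  have hz : Function.Injective z := hy.comp Sum.inr_injective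
  have hne : ∀ i a, z i - x a ≠ 0 := fun i a => sub_ne_zero.2 fun h => by
    have := @hy (Sum.inr i) (Sum.inl a) h
    simp at this
  have hδ : ∀ a b, D.toLinearMap.toAddMonoidHom (a * b) = RingHom.id K a * D.toLinearMap.toAddMonoidHom b
      + RingHom.id K b * D.toLinearMap.toAddMonoidHom a := fun a b => D.leibniz a b
  have h1 := twisted_vdm (RingHom.id K) D.toLinearMap.toAddMonoidHom hδ hx
  have h2 := twisted_vdm (RingHom.id K) D.toLinearMap.toAddMonoidHom hδ hz
  have h3 := twisted_prod (RingHom.id K) D.toLinearMap.toAddMonoidHom hδ Finset.univ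
    (fun p : Fin k × Fin l => z p.1 - x p.2) fun p _ => hne p.1 p.2
  rw [Fintype.sum_prod_type, Fintype.prod_prod_type] at h3
  have hco : ∀ a, D.toLinearMap.toAddMonoidHom a = D a := fun _ => rfl
  simp only [hco, RingHom.id_apply, map_sub, div_eq_mul_inv] at h1 h2 h3
  have hx' := vdm_ne_zero hx
  have hz' := vdm_ne_zero hz
  have hc : (∏ i, ∏ a, (z i - x a)) ≠ 0 :=
    Finset.prod_ne_zero_iff.2 fun i _ => Finset.prod_ne_zero_iff.2 fun a _ => hne i a
  rw [Derivation.leibniz_div, Derivation.leibniz, Derivation.leibniz_pow, Derivation.leibniz_pow,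
    Derivation.leibniz_pow, h1, h2, h3]
  simp only [smul_eq_mul, nsmul_eq_mul]
  generalize (∏ i, ∏ a, (z i - x a)) = c at *
  rcases m with _ | m
  · simp
  · simp only [Nat.add_sub_cancel]
    field_simp
    ring

variable [CharZero K] {n : ℕ}

theorem map_sum_pderiv_vdm_sq (ev : MvPolynomial (Fin n) R →+* K)
    (hev : Function.Injective fun i => ev (X i)) :
    ev (∑ i, pderiv i (vdm X) ^ 2) =
      vdm (fun i => ev (X i)) ^ 2 * ∑ i, ∑ j, (ev (X i) - ev (X j))⁻¹ ^ 2 := by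
  rw [← sum_sum_inv_sq hev, map_sum, Finset.mul_sum]
  refine Finset.sum_congr rfl fun i _ => ?_
  rw [map_pow, map_pderiv_vdm ev hev, mul_pow, map_vdm]

theorem map_step_vdm (ev : MvPolynomial (Fin n) R →+* K)
    (hev : Function.Injective fun i => ev (X i)) {D : Fin n → Derivation ℤ K K}
    (hD : ∀ i p, D i (ev p) = ev (pderiv i p)) (ν : Fin n → R) (m M : ℕ) (p : MvPolynomial (Fin n) R)
    {f : K} (hf : ev p / vdm (fun i => ev (X i)) ^ M = f) :
    ev (step (vdm X) ν m M p) / vdm (fun i => ev (X i)) ^ (M + 2) =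
      -∑ i, (D i (D i f + ev (C (ν i)) * f) + ev (C (ν i)) * (D i f + ev (C (ν i)) * f))
        + (m : K) * ((m : K) + 1) * (∑ i, ∑ j, (ev (X i) - ev (X j))⁻¹ ^ 2) * f
        + (∑ i, ev (C (ν i)) ^ 2) * f := by
  have hv : ev (vdm X) = vdm fun i => ev (X i) := map_vdm ev X
  have hB : ev (vdm X) ≠ 0 := hv ▸ vdm_ne_zero hev
  have h1 : ∀ i, ev (dOp (vdm X) ν (M + 1) i (dOp (vdm X) ν M i p)) / ev (vdm X) ^ (M + 2) =
      D i (D i f + ev (C (ν i)) * f) + ev (C (ν i)) * (D i f + ev (C (ν i)) * f) := fun i => by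
    rw [map_dOp ev (hD i) hB, map_dOp ev (hD i) hB, hv, hf]
  rw [← hv] at hf ⊢
  simp only [← h1]
  rw [← hf, step_apply, map_add, map_add, map_neg, map_sum, map_mul, map_mul ev (_ * _),
    map_sum_pderiv_vdm_sq ev hev, ← hv, ← Finset.sum_div]
  simp only [map_mul, map_add, map_one, map_natCast, map_sum, map_pow]
  field_simp
  ring

end Lift

/-! ### The intertwining identity for numerators -/

section Integrand

variable {k : ℕ}

/-- The coordinates `z_i = x_i + τ_i` of the contour. -/
def contourVar (i : Fin k) : MvPolynomial (Fin (k + 1) ⊕ Fin k) ℂ :=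
  X (Sum.inl i.castSucc) + X (Sum.inr i)

/-- The denominator `A(x) A(z)`. -/
def kerDenom (k : ℕ) : MvPolynomial (Fin (k + 1) ⊕ Fin k) ℂ :=
  vdm (fun a => X (Sum.inl a)) * vdm contourVar

/-- The product `A(z, x)`. -/
def kerCross (k : ℕ) : MvPolynomial (Fin (k + 1) ⊕ Fin k) ℂ :=
  ∏ i : Fin k, ∏ a, (contourVar i - X (Sum.inl a))

/-- The coefficients of the linear form in the exponential. -/
def kerExp (μ : Fin (k + 1) → ℂ) : Fin (k + 1) ⊕ Fin k → ℂ :=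
  Sum.elim μ fun i => μ i.castSucc - μ (Fin.last k)

/-- Substitution of the contour coordinates. -/
def toContour (k : ℕ) : MvPolynomial (Fin k) ℂ →ₐ[ℂ] MvPolynomial (Fin (k + 1) ⊕ Fin k) ℂ :=
  aeval contourVar

/-- The numerator `A(z, x) ^ m A(x) ^ m q(z)`. -/
def kerNum (m : ℕ) (q : MvPolynomial (Fin k) ℂ) : MvPolynomial (Fin (k + 1) ⊕ Fin k) ℂ :=
  kerCross k ^ m * vdm (fun a => X (Sum.inl a)) ^ m * toContour k q

/-- The numerator of the boundary term. -/
def kerBdry (m : ℕ) (μ : Fin (k + 1) → ℂ) (q : MvPolynomial (Fin k) ℂ) (i : Fin k) :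
    MvPolynomial (Fin (k + 1) ⊕ Fin k) ℂ :=
  dOp (kerDenom k) (kerExp μ) (2 * m) (Sum.inl i.castSucc) (kerNum m q)
    - kerCross k ^ m * vdm (fun a => X (Sum.inl a)) ^ (m + 1)
      * toContour k (dOp (vdm X) (fun i => μ i.castSucc) m i q)

theorem toContour_pderiv_inr (q : MvPolynomial (Fin k) ℂ) (i : Fin k) :
    pderiv (Sum.inr i) (toContour k q) = toContour k (pderiv i q) := by
  induction q using MvPolynomial.induction_on with
  | C c => simp [toContour, algebraMap_eq]
  | add p q hp hq => simp only [map_add, hp, hq]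
  | mul_X p j hp =>
    simp only [map_mul, pderiv_mul, hp, map_add]
    congr 2
    rcases eq_or_ne i j with rfl | hij
    · simp [toContour, contourVar]
    · have : j ≠ i := hij.symm
      simp [toContour, contourVar, this]

theorem toContour_pderiv_inl (q : MvPolynomial (Fin k) ℂ) (i : Fin k) :
    pderiv (Sum.inl i.castSucc) (toContour k q) = toContour k (pderiv i q) := by
  induction q using MvPolynomial.induction_on with
  | C c => simp [toContour, algebraMap_eq]
  | add p q hp hq => simp only [map_add, hp, hq]
  | mul_X p j hp =>
    simp only [map_mul, pderiv_mul, hp, map_add]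
    congr 2
    rcases eq_or_ne i j with rfl | hij
    · simp [toContour, contourVar]
    · have : j ≠ i := hij.symm
      have h2 : j.castSucc ≠ i.castSucc := fun h => this (Fin.castSucc_injective k h)
      simp [toContour, contourVar, this, h2]

theorem toContour_pderiv_last (q : MvPolynomial (Fin k) ℂ) :
    pderiv (Sum.inl (Fin.last k)) (toContour k q) = 0 := by
  induction q using MvPolynomial.induction_on with
  | C c => simp [toContour, algebraMap_eq]
  | add p q hp hq => simp only [map_add, hp, hq, add_zero]
  | mul_X p j hp =>
    simp only [map_mul, pderiv_mul, hp, zero_mul, zero_add]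
    have h2 : j.castSucc ≠ Fin.last k := Fin.castSucc_ne_last j
    simp [toContour, contourVar, h2]

theorem injective_coordinates :
    Function.Injective (Sum.elim (fun a => X (Sum.inl a)) (contourVar (k := k)) :
      Fin (k + 1) ⊕ Fin k → MvPolynomial (Fin (k + 1) ⊕ Fin k) ℂ) := by
  intro p q h
  have h1 := fun c : Fin (k + 1) ⊕ Fin k → ℂ => congrArg (eval c) h
  have h2 := h1 fun _ => 1
  rcases p with a | i <;> rcases q with b | j <;>
    simp only [Sum.elim_inl, Sum.elim_inr, contourVar, map_add, eval_X] at h1 h2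
  · have := h1 (Pi.single (Sum.inl a) 1)
    by_contra hne
    have hba : b ≠ a := fun h => hne (by rw [h])
    simp [hba] at this
  · norm_num at h2
  · norm_num at h2
  · have := h1 (Pi.single (Sum.inr i) 1)
    by_contra hne
    have hji : j ≠ i := fun h => hne (by rw [h])
    simp [hji] at this

theorem derivation_ext_of_fraction {S K : Type*} [CommRing S] [IsDomain S] [Field K] [Algebra S K]
    [IsFractionRing S K] {D D' : Derivation ℤ K K}
    (h : ∀ s, D (algebraMap S K s) = D' (algebraMap S K s)) : D = D' := by
  ext u
  obtain ⟨a, b, -, rfl⟩ := IsFractionRing.div_surjective (A := S) u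
  rw [Derivation.leibniz_div, Derivation.leibniz_div, h, h]

theorem kerNum_intertwining_aux (K : Type*) [Field K]
    [Algebra (MvPolynomial (Fin (k + 1) ⊕ Fin k) ℂ) K]
    [IsFractionRing (MvPolynomial (Fin (k + 1) ⊕ Fin k) ℂ) K] (m : ℕ) (μ : Fin (k + 1) → ℂ)
    (q : MvPolynomial (Fin k) ℂ) :
    -(∑ a, dOp (kerDenom k) (kerExp μ) (2 * m + 1) (Sum.inl a)
          (dOp (kerDenom k) (kerExp μ) (2 * m) (Sum.inl a) (kerNum m q)))
        + (m : MvPolynomial (Fin (k + 1) ⊕ Fin k) ℂ) * ((m : MvPolynomial (Fin (k + 1) ⊕ Fin k) ℂ) + 1)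
          * rename Sum.inl (∑ a, pderiv a (vdm X) ^ 2) * vdm contourVar ^ 2 * kerNum m q
        + (∑ a, C (μ a) ^ 2) * kerDenom k ^ 2 * kerNum m q =
      kerCross k ^ m * vdm (fun a => X (Sum.inl a)) ^ (m + 2)
          * toContour k (step (vdm X) (fun i => μ i.castSucc) m m q)
        - 2 * ∑ i, dOp (kerDenom k) (kerExp μ) (2 * m + 1) (Sum.inr i) (kerBdry m μ q i) := by
  set S := MvPolynomial (Fin (k + 1) ⊕ Fin k) ℂ
  have hinj := IsFractionRing.injective S K
  have : CharZero K := charZero_of_injective_algebraMap hinj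
  have hD := fun a : Fin (k + 1) ⊕ Fin k => exists_derivation_extend K (pderiv a : Derivation ℂ S S)
  choose D hD using hD
  let ev : S →+* K := algebraMap S K
  let x : Fin (k + 1) → K := fun a => ev (X (Sum.inl a))
  let z : Fin k → K := fun i => ev (contourVar i)
  have hy : Function.Injective (Sum.elim x z) := by
    have : Sum.elim x z = ev ∘ Sum.elim (fun a => X (Sum.inl a)) contourVar := by
      ext (a | i) <;> rfl
    rw [this]
    exact hinj.comp injective_coordinates
  have hx : Function.Injective x := hy.comp Sum.inl_injective
  have hz : Function.Injective z := hy.comp Sum.inr_injective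
  have hcomm : ∀ a b u, D a (D b u) = D b (D a u) := by
    intro a b u
    have : ⁅D a, D b⁆ = (0 : Derivation ℤ K K) := derivation_ext_of_fraction (S := S) fun s => by
      rw [Derivation.commutator_apply, hD, hD, hD, hD, sub_eq_zero.2]
      · rfl
      · rw [pderiv_pderiv_comm]
    have h := congrArg (fun E : Derivation ℤ K K => E u) this
    rw [Derivation.commutator_apply] at h
    exact sub_eq_zero.1 h
  -- The `D` are partial derivatives in `(x, τ)`, whereas the kernel identity uses `(x, z)`. Since
  -- `z_i = x_i + τ_i`, differentiating in `x_i` at fixed `τ` gives `Y_i + Z_i`.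
  let Y : Fin (k + 1) → Derivation ℤ K K := fun a =>
    Fin.lastCases (D (Sum.inl (Fin.last k))) (fun i => D (Sum.inl i.castSucc) - D (Sum.inr i)) a
  let Z : Fin k → Derivation ℤ K K := fun i => D (Sum.inr i)
  have hYc : ∀ i : Fin k, Y i.castSucc = D (Sum.inl i.castSucc) - D (Sum.inr i) := fun i => by
    simp [Y]
  have hYl : Y (Fin.last k) = D (Sum.inl (Fin.last k)) := by simp [Y]
  have hC : ∀ a c, D a (ev (C c)) = 0 := fun a c => by
    rw [hD, pderiv_C, map_zero]
  have hYC : ∀ a c, Y a (ev (C c)) = 0 := fun a c => by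
    refine Fin.lastCases ?_ (fun i => ?_) a
    · rw [hYl, hC]
    · rw [hYc, Derivation.sub_apply, hC, hC, sub_zero]
  have hevx : ev (vdm fun a => X (Sum.inl a)) = vdm x := map_vdm ev _
  have hevz : ev (vdm contourVar) = vdm z := map_vdm ev _
  have hevB : ev (kerDenom k) = vdm x * vdm z := by rw [kerDenom, map_mul, hevx, hevz]
  have hevc : ev (kerCross k) = ∏ i, ∏ a, (z i - x a) := by
    simp only [kerCross, map_prod, map_sub, z, x]
  have hx' := vdm_ne_zero hx
  have hz' := vdm_ne_zero hz
  have hB : ev (kerDenom k) ≠ 0 := hevB ▸ mul_ne_zero hx' hz'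
  let κ : K := (∏ i, ∏ a, (z i - x a)) ^ m / (vdm x ^ m * vdm z ^ m)
  let f : K := ev (toContour k q) / vdm z ^ m
  let L : K := ev (C (μ (Fin.last k)))
  let ν : Fin k → K := fun i => ev (C (μ i.castSucc))
  have hXx : ∀ a b, D (Sum.inl a) (x b) = if a = b then 1 else 0 := fun a b => by
    rw [hD, pderiv_X, Pi.single_apply]
    by_cases h : a = b <;> simp [h]
    intro h'
    exact absurd h'.symm h
  have hZx : ∀ i a, Z i (x a) = 0 := fun i a => by
    change D _ (ev _) = 0
    rw [hD]
    simp
  have hZz : ∀ i j, Z i (z j) = if i = j then 1 else 0 := fun i j => by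
    change D _ (ev _) = _
    rw [hD, contourVar]
    by_cases h : i = j
    · simp [h]
    · have : j ≠ i := fun h' => h h'.symm
      simp [h, this]
  have hXz : ∀ a i, D (Sum.inl a) (z i) = if a = i.castSucc then 1 else 0 := fun a i => by
    rw [hD, contourVar]
    by_cases h : a = i.castSucc
    · simp [h]
    · have : i.castSucc ≠ a := fun h' => h h'.symm
      simp [h, this]
  have hYx : ∀ a b, Y a (x b) = if a = b then 1 else 0 := fun a b => by
    refine Fin.lastCases ?_ (fun i => ?_) a
    · rw [hYl, hXx]
    · rw [hYc, Derivation.sub_apply, hXx]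
      simpa [Z] using hZx i b
  have hYz : ∀ a i, Y a (z i) = 0 := fun a i => by
    refine Fin.lastCases ?_ (fun j => ?_) a
    · rw [hYl, hXz, if_neg (Fin.castSucc_ne_last i).symm]
    · rw [hYc, Derivation.sub_apply, hXz]
      change _ - Z j (z i) = 0
      rw [hZz]
      simp [Fin.castSucc_inj]
  have hYφ : ∀ a p, Y a (ev (toContour k p)) = 0 := fun a p => by
    refine Fin.lastCases ?_ (fun j => ?_) a
    · rw [hYl, hD, toContour_pderiv_last, map_zero]
    · rw [hYc, Derivation.sub_apply, hD, hD, toContour_pderiv_inl, toContour_pderiv_inr, sub_self]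
  have hYf : ∀ a, Y a f = 0 := fun a => by
    have h1 : Y a (vdm z) = 0 := by
      have : vdm z = ev (toContour k (vdm X)) := by
        rw [← hevz]
        congr 1
        have := map_vdm (toContour k).toRingHom (X : Fin k → _)
        simpa [toContour] using this.symm
      rw [this, hYφ]
    rw [Derivation.leibniz_div, Derivation.leibniz_pow, hYφ, h1]
    simp
  have hκ := fun E => derivation_crossKernel m hy E
  have key := kernel_intertwining (L := L) (ν := ν) (f := f) (κ := κ) m hy hYx hYz hZx hZz
    (fun a => by
      rw [hκ]
      simp only [hYx, hYz, zero_sub, zero_mul, Finset.sum_const_zero, sub_zero, ite_mul, neg_mul,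
        one_mul, Finset.sum_neg_distrib, Finset.sum_ite_eq, Finset.mem_univ, if_true]
      have : ∀ i, (z i - x a)⁻¹ = -(x a - z i)⁻¹ := fun i => by
        rw [← inv_neg, neg_sub]
      simp only [this, Finset.sum_neg_distrib]
      ring)
    (fun i => by
      rw [hκ]
      simp only [hZx, hZz, sub_zero, zero_mul, Finset.sum_const_zero, ite_mul, one_mul,
        Finset.sum_ite_irrel, Finset.sum_ite_eq, Finset.mem_univ, if_true]
      ring)
    hYf (fun a => hYC a _) (fun i u => by
      simp only [hYc, Derivation.sub_apply, Z, map_sub]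
      rw [hcomm])
    (fun a i => hYC a _) (fun i j => hC _ _)
    (fun u i => rfl) (fun u => rfl) (fun u i => rfl) (fun u i => rfl)
  simp only [hYl] at key
  have hX : ∀ (i : Fin k) u, Y i.castSucc u + Z i u + ν i * u = D (Sum.inl i.castSucc) u + ν i * u :=
    fun i u => by
      rw [hYc, Derivation.sub_apply]
      change D _ u - Z i u + Z i u + _ = _
      ring
  simp only [hX] at key
  set B := ev (kerDenom k) with hBdef
  -- The factor `A(x) ^ m` in `kerNum` compensates for the common denominator `(A(x) A(z)) ^ (2 m)`;
  -- the true function has only `A(x) ^ m` below.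
  have hnum : ev (kerNum m q) / B ^ (2 * m) = κ * f := by
    rw [kerNum, map_mul, map_mul, map_pow, map_pow, hevc, hevx, hevB]
    simp only [κ, f]
    field_simp
    ring
  have hdOp := fun a M p => map_dOp ev (hD a) hB (kerExp μ) M p
  have h1 : ∀ a, ev (dOp (kerDenom k) (kerExp μ) (2 * m + 1) (Sum.inl a)
      (dOp (kerDenom k) (kerExp μ) (2 * m) (Sum.inl a) (kerNum m q))) / B ^ (2 * m + 2) =
      D (Sum.inl a) (D (Sum.inl a) (κ * f) + ev (C (μ a)) * (κ * f))
        + ev (C (μ a)) * (D (Sum.inl a) (κ * f) + ev (C (μ a)) * (κ * f)) := fun a => by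
    rw [hdOp, hdOp, hnum]
    rfl
  have hev : ∀ i, (ev.comp (toContour k).toRingHom) (X i) = z i := fun i => by
    simp [toContour, z]
  have hevD : ∀ i p, Z i ((ev.comp (toContour k).toRingHom) p) =
      (ev.comp (toContour k).toRingHom) (pderiv i p) := fun i p => by
    change D _ (ev (toContour k p)) = _
    rw [hD, toContour_pderiv_inr]
    rfl
  have hevC : ∀ c, (ev.comp (toContour k).toRingHom) (C c) = ev (C c) := fun c => by
    simp [toContour, algebraMap_eq]
  have hevv : (ev.comp (toContour k).toRingHom) (vdm X) = vdm z := by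
    rw [map_vdm]
    simp only [hev]
  have h2 : ∀ (i : Fin k), ev (toContour k (dOp (vdm X) (fun i => μ i.castSucc) m i q)) / vdm z ^ (m + 1)
      = Z i f + ν i * f := fun i => by
    have := map_dOp _ (hevD i) (hevv ▸ hz') (fun i => μ i.castSucc) m q
    rw [hevv, hevC] at this
    exact this
  have h3 : ∀ i, ev (kerBdry m μ q i) / B ^ (2 * m + 1) =
      D (Sum.inl i.castSucc) (κ * f) + ν i * (κ * f) - κ * (Z i f + ν i * f) := fun i => by
    rw [kerBdry, map_sub, sub_div, hdOp, hnum, ← h2, map_mul ev, map_mul ev, map_pow ev, map_pow ev,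
      hevc, hevx, hevB]
    congr 1
    simp only [κ]
    field_simp
    ring
  have h4 : ∀ i, ev (dOp (kerDenom k) (kerExp μ) (2 * m + 1) (Sum.inr i) (kerBdry m μ q i)) /
      B ^ (2 * m + 2) = Z i (D (Sum.inl i.castSucc) (κ * f) + ν i * (κ * f) - κ * (Z i f + ν i * f))
        + (ν i - L) * (D (Sum.inl i.castSucc) (κ * f) + ν i * (κ * f) - κ * (Z i f + ν i * f)) :=
    fun i => by
    rw [hdOp, h3]
    simp only [kerExp, Sum.elim_inr, map_sub, ν, L, Z]
  have h5 : ev (rename Sum.inl (∑ a, pderiv a (vdm X) ^ 2)) = vdm x ^ 2 * ∑ a, ∑ b, (x a - x b)⁻¹ ^ 2 :=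
    map_sum_pderiv_vdm_sq (ev.comp (rename (R := ℂ) Sum.inl).toRingHom) (by simpa using hx) |>.trans
      (by simp [x])
  have h6 : ev (toContour k (step (vdm X) (fun i => μ i.castSucc) m m q)) / vdm z ^ (m + 2) =
      -∑ i, (Z i (Z i f + ν i * f) + ν i * (Z i f + ν i * f)) +
            (m : K) * ((m : K) + 1) * (∑ i, ∑ j, (z i - z j)⁻¹ ^ 2) * f +
          (∑ i, ν i ^ 2) * f := by
    have := map_step_vdm (f := f) (ev.comp (toContour k).toRingHom) (by simpa only [hev] using hz) hevD
      (fun i => μ i.castSucc) m m q (by simp only [hev]; rfl)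
    simp only [hev, hevC] at this
    exact this
  rw [← h6] at key
  apply hinj
  have hBB : B ^ (2 * m + 2) ≠ 0 := pow_ne_zero _ hB
  rw [← div_left_inj' hBB]
  change ev _ / _ = ev _ / _
  have e1 : ev (kerNum m q) = B ^ (2 * m) * (κ * f) := by
    rw [← hnum]
    field_simp
  have e2 : ev (kerCross k ^ m * vdm (fun a => X (Sum.inl a)) ^ (m + 2)) =
      κ * B ^ (2 * m + 2) / vdm z ^ (m + 2) := by
    rw [map_mul ev, map_pow ev, map_pow ev, hevc, hevx, hevB]
    simp only [κ]
    field_simp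
    ring
  rw [map_add ev, map_add ev, map_neg ev, map_sum ev, map_sub ev, map_mul ev (_ * _) (kerNum m q),
    map_mul ev (_ * _) (vdm _ ^ 2), map_mul ev _ (rename _ _), h5, map_mul ev (_ * _) (kerNum m q),
    e1, map_mul ev (_ * _) (toContour k _), e2, map_mul ev 2, map_sum ev, Fin.sum_univ_castSucc,
    add_div, add_div, sub_div, neg_div, add_div, Finset.sum_div, h1, mul_div_assoc (ev 2),
    Finset.sum_div]
  simp only [h1, h4]
  simp only [map_mul ev, map_pow ev, map_add ev, map_natCast, map_one, map_sum ev, map_ofNat, hevz]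
  rw [Fin.sum_univ_castSucc (fun a => ev (C (μ a)) ^ 2)]
  have hB2 : B ^ (2 * m + 2) = B ^ (2 * m) * (vdm x * vdm z) ^ 2 := by rw [pow_add, hevB]
  refine Eq.trans ?_ (key.trans ?_)
  · congr 1
    · congr 1
      rw [hB2]
      field_simp
    · rw [← hBdef, pow_add]
      simp only [ν, L]
      field_simp
  · congr 1
    field_simp

/-- The intertwining identity for the numerators. -/
theorem kerNum_intertwining (m : ℕ) (μ : Fin (k + 1) → ℂ) (q : MvPolynomial (Fin k) ℂ) :
    -(∑ a, dOp (kerDenom k) (kerExp μ) (2 * m + 1) (Sum.inl a)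
          (dOp (kerDenom k) (kerExp μ) (2 * m) (Sum.inl a) (kerNum m q)))
        + (m : MvPolynomial (Fin (k + 1) ⊕ Fin k) ℂ) * ((m : MvPolynomial (Fin (k + 1) ⊕ Fin k) ℂ) + 1)
          * rename Sum.inl (∑ a, pderiv a (vdm X) ^ 2) * vdm contourVar ^ 2 * kerNum m q
        + (∑ a, C (μ a) ^ 2) * kerDenom k ^ 2 * kerNum m q =
      kerCross k ^ m * vdm (fun a => X (Sum.inl a)) ^ (m + 2)
          * toContour k (step (vdm X) (fun i => μ i.castSucc) m m q)
        - 2 * ∑ i, dOp (kerDenom k) (kerExp μ) (2 * m + 1) (Sum.inr i) (kerBdry m μ q i) :=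
  kerNum_intertwining_aux (FractionRing (MvPolynomial (Fin (k + 1) ⊕ Fin k) ℂ)) m μ q

end Integrand

open MeasureTheory Filter

/-! ### Integrals over the contour -/

section Bounds

theorem exists_norm_eval_le {σ : Type*} [Fintype σ] (p : MvPolynomial σ ℂ) :
    ∃ (D : ℕ) (c : ℝ), 0 ≤ c ∧ ∀ y : σ → ℂ, ‖eval y p‖ ≤ c * (∏ a, (1 + ‖y a‖)) ^ D := by
  have hN : ∀ y : σ → ℂ, 1 ≤ ∏ a, (1 + ‖y a‖) := fun y =>
    Finset.one_le_prod fun a _ => by simp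
  induction p using MvPolynomial.induction_on with
  | C c => exact ⟨0, ‖c‖, norm_nonneg c, fun y => by simp⟩
  | add p q hp hq =>
    obtain ⟨D, c, hc, hD⟩ := hp
    obtain ⟨E, d, hd, hE⟩ := hq
    refine ⟨max D E, c + d, add_nonneg hc hd, fun y => ?_⟩
    rw [map_add, add_mul]
    refine (norm_add_le _ _).trans (add_le_add ((hD y).trans ?_) ((hE y).trans ?_))
    · exact mul_le_mul_of_nonneg_left (pow_le_pow_right₀ (hN y) (le_max_left _ _)) hc
    · exact mul_le_mul_of_nonneg_left (pow_le_pow_right₀ (hN y) (le_max_right _ _)) hd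
  | mul_X p i hp =>
    obtain ⟨D, c, hc, hD⟩ := hp
    refine ⟨D + 1, c, hc, fun y => ?_⟩
    have h1 : ‖y i‖ ≤ ∏ a, (1 + ‖y a‖) := by
      classical
      rw [← Finset.mul_prod_erase _ _ (Finset.mem_univ i)]
      have h2 : 1 ≤ ∏ a ∈ Finset.univ.erase i, (1 + ‖y a‖) :=
        Finset.one_le_prod fun a _ => by simp
      nlinarith [norm_nonneg (y i)]
    rw [map_mul, eval_X, norm_mul, pow_succ, ← mul_assoc]
    have h0 := (norm_nonneg _).trans (hD y)
    gcongr
    exact hD y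

/-- Half of the exponential rate absorbs the polynomial; the other half remains for integrability
and decay. -/
theorem isBigO_pow_mul_exp (D : ℕ) {b : ℝ} (hb : b < 0) :
    (fun t : ℝ => (1 + |t|) ^ D * Real.exp (b * t)) =O[atTop] fun t => Real.exp (-(-b / 2) * t) := by
  have h1 := (isLittleO_pow_exp_pos_mul_atTop D (show 0 < -b / 2 by linarith)).comp_tendsto
    (tendsto_atTop_add_const_left atTop (1 : ℝ) tendsto_id)
  have h2 := h1.isBigO.mul (Asymptotics.isBigO_refl (fun t : ℝ => Real.exp (b * t)) atTop)
  refine (h2.congr' ?_ ?_).trans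
    (Asymptotics.isBigO_const_mul_self (Real.exp (-b / 2)) (fun t => Real.exp (-(-b / 2) * t)) atTop)
  · filter_upwards [eventually_ge_atTop 0] with t ht
    simp [abs_of_nonneg ht]
  · refine Eventually.of_forall fun t => ?_
    simp only [Function.comp_apply, id_eq, ← Real.exp_add]
    congr 1
    ring

theorem integrableOn_pow_mul_exp (D : ℕ) {b : ℝ} (hb : b < 0) :
    IntegrableOn (fun t : ℝ => (1 + |t|) ^ D * Real.exp (b * t)) (Set.Ici 0) := by
  rw [integrableOn_Ici_iff_integrableOn_Ioi]
  exact integrable_of_isBigO_exp_neg (b := -b / 2) (by linarith)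
    (Continuous.continuousOn (by fun_prop)) (isBigO_pow_mul_exp D hb)

theorem tendsto_pow_mul_exp (D : ℕ) {b : ℝ} (hb : b < 0) :
    Tendsto (fun t : ℝ => (1 + |t|) ^ D * Real.exp (b * t)) atTop (nhds 0) := by
  refine (isBigO_pow_mul_exp D hb).trans_tendsto (Real.tendsto_exp_atBot.comp ?_)
  exact tendsto_id.const_mul_atTop_of_neg (by linarith)

end Bounds

/-! ### Domination, differentiation and Stokes' formula on the contour -/

section Contour

variable {k : ℕ}

/-- The point with coordinates `x` and contour parameters `τ`. -/
def contourPt (x : Fin (k + 1) → ℂ) (τ : Fin k → ℝ) : Fin (k + 1) ⊕ Fin k → ℂ :=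
  Sum.elim x fun i => (τ i : ℂ)

theorem eval_contourPt_contourVar (x : Fin (k + 1) → ℂ) (τ : Fin k → ℝ) :
    (fun i => eval (contourPt x τ) (contourVar i)) = contourPoint x τ := by
  ext i
  simp [contourVar, contourPt, contourPoint]

theorem eval_kerDenom (x : Fin (k + 1) → ℂ) (τ : Fin k → ℝ) :
    eval (contourPt x τ) (kerDenom k) = vdm x * vdm (contourPoint x τ) := by
  rw [kerDenom, map_mul, map_vdm, map_vdm, eval_contourPt_contourVar]
  congr 2
  ext a
  simp [contourPt]

/-- Real shifts `τ` leave imaginary parts unchanged, so this bounds the denominator below uniformly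
along the contour. -/
theorem abs_vdm_im_le {n : ℕ} (u : Fin n → ℂ) : |vdm fun i => (u i).im| ≤ ‖vdm u‖ := by
  simp only [vdm, Finset.abs_prod, norm_prod]
  refine Finset.prod_le_prod (fun i _ => by positivity) fun i _ => ?_
  refine Finset.prod_le_prod (fun i _ => by positivity) fun j _ => ?_
  rw [← Complex.sub_im]
  exact Complex.abs_im_le_norm _

/-- A lower bound for the denominator on the contour. -/
def imDenom (x : Fin (k + 1) → ℂ) : ℝ :=
  |vdm fun a => (x a).im| * |vdm fun i : Fin k => (x i.castSucc).im|

theorem imDenom_le (x : Fin (k + 1) → ℂ) (τ : Fin k → ℝ) :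
    imDenom x ≤ ‖eval (contourPt x τ) (kerDenom k)‖ := by
  rw [eval_kerDenom, norm_mul]
  have h := abs_vdm_im_le (contourPoint x τ)
  simp only [contourPoint, Complex.add_im, Complex.ofReal_im, add_zero] at h
  exact mul_le_mul (abs_vdm_im_le x) h (abs_nonneg _) (norm_nonneg _)

theorem imDenom_pos {x : Fin (k + 1) → ℂ} (hx : ∀ i j, i ≠ j → (x i).im ≠ (x j).im) :
    0 < imDenom x := by
  have h : Function.Injective fun a => (x a).im := fun i j hij => by
    by_contra hne
    exact hx i j hne hij
  exact mul_pos (abs_pos.2 (vdm_ne_zero h))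
    (abs_pos.2 (vdm_ne_zero (h.comp (Fin.castSucc_injective k))))

theorem continuous_imDenom : Continuous (imDenom (k := k)) := by
  unfold imDenom vdm
  fun_prop

theorem eval_kerDenom_ne_zero {x : Fin (k + 1) → ℂ} (hx : 0 < imDenom x) (τ : Fin k → ℝ) :
    eval (contourPt x τ) (kerDenom k) ≠ 0 :=
  norm_pos_iff.1 (hx.trans_le (imDenom_le x τ))

/-- The product measure on the contour parameters. -/
def contourMeasure (k : ℕ) : Measure (Fin k → ℝ) :=
  Measure.pi fun _ => (volume : Measure ℝ).restrict (Set.Ici 0)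

theorem restrict_eq_contourMeasure :
    (volume : Measure (Fin k → ℝ)).restrict {τ | ∀ i, 0 ≤ τ i} = contourMeasure k := by
  have : {τ : Fin k → ℝ | ∀ i, 0 ≤ τ i} = Set.univ.pi fun _ => Set.Ici 0 := by
    ext
    simp [-Set.pi_univ_Ici]
  rw [this, volume_pi, Measure.restrict_pi_pi]
  rfl

/-- The dependence on `x` is gathered in a function `h` continuous on the open set `0 < imDenom x`.
One bound thus serves for integrability, for decay at infinity, and for domination near a point. -/
theorem exists_norm_expQuot_le (μ : Fin (k + 1) → ℂ) (M : ℕ)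
    (p : MvPolynomial (Fin (k + 1) ⊕ Fin k) ℂ) :
    ∃ (D : ℕ) (h : (Fin (k + 1) → ℂ) → ℝ), (∀ x, 0 < imDenom x → ContinuousAt h x) ∧
      (∀ x, 0 < imDenom x → 0 ≤ h x) ∧ ∀ x, 0 < imDenom x → ∀ τ,
      ‖expQuot (kerDenom k) (kerExp μ) M p (contourPt x τ)‖ ≤
        h x * ∏ i, ((1 + |τ i|) ^ D * Real.exp ((μ i.castSucc - μ (Fin.last k)).re * τ i)) := by
  obtain ⟨D, c, hc, hp⟩ := exists_norm_eval_le p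
  refine ⟨D, fun x => c * (∏ a, (1 + ‖x a‖)) ^ D / imDenom x ^ M * Real.exp (∑ a, μ a * x a).re,
    fun x hx => ?_, fun x hx => by positivity, fun x hx τ => ?_⟩
  · have := continuous_imDenom (k := k)
    refine ContinuousAt.mul (ContinuousAt.div (Continuous.continuousAt ?_) (by fun_prop) (by positivity))
      (Continuous.continuousAt ?_)
    · exact (continuous_const.mul ((continuous_finsetProd _ fun a _ => by fun_prop).pow D))
    · exact Real.continuous_exp.comp (Complex.continuous_re.comp
        (continuous_finsetSum _ fun a _ => by fun_prop))
  · have h1 := hp (contourPt x τ)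
    have h2 := imDenom_le x τ
    rw [expQuot, norm_mul, norm_div, norm_pow, Complex.norm_exp, Finset.prod_mul_distrib,
      Finset.prod_pow, ← Real.exp_sum]
    have h3 : (∑ a, kerExp μ a * contourPt x τ a).re = (∑ a, μ a * x a).re
        + ∑ i, (μ i.castSucc - μ (Fin.last k)).re * τ i := by
      simp [Fintype.sum_sum_type, kerExp, contourPt]
    simp only [Fintype.prod_sum_type, contourPt, Sum.elim_inl, Sum.elim_inr, Complex.norm_real,
      Real.norm_eq_abs, mul_pow] at h1
    rw [h3, Real.exp_add]
    calc _ ≤ (c * ((∏ a, (1 + ‖x a‖)) ^ D * (∏ i, (1 + |τ i|)) ^ D)) / imDenom x ^ M *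
          (Real.exp (∑ a, μ a * x a).re * Real.exp (∑ i, (μ i.castSucc - μ (Fin.last k)).re * τ i)) := by
          gcongr
          exact h1
      _ = _ := by ring

theorem continuous_contourPt (x : Fin (k + 1) → ℂ) : Continuous (contourPt x) :=
  continuous_pi fun a => by
    rcases a with a | i
    · exact continuous_const
    · exact Complex.continuous_ofReal.comp (continuous_apply i)

theorem measurable_expQuot_contourPt (B : MvPolynomial (Fin (k + 1) ⊕ Fin k) ℂ)
    (ℓ : Fin (k + 1) ⊕ Fin k → ℂ) (M : ℕ) (p : MvPolynomial (Fin (k + 1) ⊕ Fin k) ℂ)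
    (x : Fin (k + 1) → ℂ) : Measurable fun τ => expQuot B ℓ M p (contourPt x τ) := by
  have h1 := fun q : MvPolynomial (Fin (k + 1) ⊕ Fin k) ℂ =>
    (q.continuous_eval.comp (continuous_contourPt x)).measurable
  have h2 : Continuous fun τ => ∑ a, ℓ a * contourPt x τ a :=
    continuous_finsetSum _ fun a _ => continuous_const.mul
      ((continuous_apply a).comp (continuous_contourPt x))
  exact ((h1 p).div ((h1 B).pow_const M)).mul (Complex.continuous_exp.comp h2).measurable

variable {μ : Fin (k + 1) → ℂ}

theorem integrable_bound (hμ : ∀ i : Fin k, (μ i.castSucc - μ (Fin.last k)).re < 0)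
    (D : ℕ) :
    Integrable (fun τ : Fin k → ℝ =>
      ∏ i, ((1 + |τ i|) ^ D * Real.exp ((μ i.castSucc - μ (Fin.last k)).re * τ i)))
      (contourMeasure k) :=
  Integrable.fintype_prod fun i => integrableOn_pow_mul_exp D (hμ i)

theorem integrable_expQuot (hμ : ∀ i : Fin k, (μ i.castSucc - μ (Fin.last k)).re < 0)
    (M : ℕ) (p : MvPolynomial (Fin (k + 1) ⊕ Fin k) ℂ)
    {x : Fin (k + 1) → ℂ} (hx : 0 < imDenom x) :
    Integrable (fun τ => expQuot (kerDenom k) (kerExp μ) M p (contourPt x τ)) (contourMeasure k) := by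
  obtain ⟨D, h, -, -, hb⟩ := exists_norm_expQuot_le μ M p
  exact ((integrable_bound hμ D).const_mul (h x)).mono'
    (measurable_expQuot_contourPt _ _ M p x).aestronglyMeasurable
    (Eventually.of_forall fun τ => hb x hx τ)

/-- The integral over the contour. -/
def contourIntegral (μ : Fin (k + 1) → ℂ) (M : ℕ) (p : MvPolynomial (Fin (k + 1) ⊕ Fin k) ℂ)
    (x : Fin (k + 1) → ℂ) : ℂ :=
  ∫ τ, expQuot (kerDenom k) (kerExp μ) M p (contourPt x τ) ∂contourMeasure k

/-- In the coordinates `(x, τ)` the domain does not move with `x`, so differentiation under the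
integral produces no boundary term. -/
theorem hasDerivAt_contourIntegral
    (hμ : ∀ i : Fin k, (μ i.castSucc - μ (Fin.last k)).re < 0) (M : ℕ)
    (p : MvPolynomial (Fin (k + 1) ⊕ Fin k) ℂ)
    {x : Fin (k + 1) → ℂ} (hx : 0 < imDenom x) (a : Fin (k + 1)) :
    HasDerivAt (fun t => contourIntegral μ M p (Function.update x a t))
      (contourIntegral μ (M + 1) (dOp (kerDenom k) (kerExp μ) M (Sum.inl a) p) x) (x a) := by
  obtain ⟨D, h, hc, h0, hb⟩ := exists_norm_expQuot_le μ (M + 1)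
    (dOp (kerDenom k) (kerExp μ) M (Sum.inl a) p)
  have hu : ContinuousAt (fun t => Function.update x a t) (x a) := by fun_prop
  have hux : Function.update x a (x a) = x := Function.update_eq_self a x
  have hpos : ∀ᶠ t in nhds (x a), 0 < imDenom (Function.update x a t) :=
    (continuous_imDenom.continuousAt.comp hu).eventually (lt_mem_nhds (by simpa using hx))
  have hlt : ∀ᶠ t in nhds (x a), h (Function.update x a t) < h x + 1 := by
    have : ContinuousAt (fun t => h (Function.update x a t)) (x a) :=
      ContinuousAt.comp (f := fun t => Function.update x a t) (by rw [hux]; exact hc x hx) hu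
    refine this.eventually (gt_mem_nhds ?_)
    change h (Function.update x a (x a)) < _
    rw [hux]
    exact lt_add_one _
  have key := hasDerivAt_integral_of_dominated_loc_of_deriv_le (μ := contourMeasure k) (x₀ := x a)
    (F := fun t τ => expQuot (kerDenom k) (kerExp μ) M p (contourPt (Function.update x a t) τ))
    (F' := fun t τ => expQuot (kerDenom k) (kerExp μ) (M + 1)
      (dOp (kerDenom k) (kerExp μ) M (Sum.inl a) p) (contourPt (Function.update x a t) τ))
    (bound := fun τ => (h x + 1) * ∏ i, ((1 + |τ i|) ^ D *
      Real.exp ((μ i.castSucc - μ (Fin.last k)).re * τ i)))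
    (hpos.and hlt)
    (Eventually.of_forall fun t => (measurable_expQuot_contourPt _ _ _ _ _).aestronglyMeasurable)
    (by simpa only [hux] using integrable_expQuot hμ M p hx)
    (measurable_expQuot_contourPt _ _ _ _ _).aestronglyMeasurable
    (Eventually.of_forall fun τ t ht => (hb _ ht.1 τ).trans
      (mul_le_mul_of_nonneg_right ht.2.le (by positivity)))
    ((integrable_bound hμ D).const_mul _)
    (Eventually.of_forall fun τ t ht => by
      have h1 : ∀ s, contourPt (Function.update x a s) τ =
          Function.update (contourPt x τ) (Sum.inl a) s := fun s => Sum.update_elim_inl.symm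
      have h2 := eval_kerDenom_ne_zero ht.1 τ
      simp only [h1] at h2 ⊢
      exact hasDerivAt_expQuot_update _ _ _ _ _ _ h2)
  have := key.2
  simp only [hux] at this
  exact this

/-- Stokes' formula for numerators vanishing on the boundary of the contour. -/
theorem contourIntegral_dOp_inr
    (hμ : ∀ i : Fin k, (μ i.castSucc - μ (Fin.last k)).re < 0) (M : ℕ)
    {p : MvPolynomial (Fin (k + 1) ⊕ Fin k) ℂ} (i : Fin k)
    (hp : X (Sum.inr i) ∣ p) {x : Fin (k + 1) → ℂ} (hx : 0 < imDenom x) :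
    contourIntegral μ (M + 1) (dOp (kerDenom k) (kerExp μ) M (Sum.inr i) p) x = 0 := by
  obtain _ | n := k
  · exact i.elim0
  set F := fun τ => expQuot (kerDenom (n + 1)) (kerExp μ) (M + 1)
    (dOp (kerDenom (n + 1)) (kerExp μ) M (Sum.inr i) p) (contourPt x τ)
  have hF : Integrable F (contourMeasure (n + 1)) := integrable_expQuot hμ _ _ hx
  have hmp := (measurePreserving_piFinSuccAbove
    (fun _ : Fin (n + 1) => (volume : Measure ℝ).restrict (Set.Ici 0)) i).symm
  change ∫ τ, F τ ∂Measure.pi _ = 0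
  rw [← hmp.integral_comp (MeasurableEquiv.measurableEmbedding _)]
  have hF' := (hmp.integrable_comp_emb (MeasurableEquiv.measurableEmbedding _)).2 hF
  change ∫ z, (F ∘ (MeasurableEquiv.piFinSuccAbove (fun _ => ℝ) i).symm) z ∂_ = 0
  -- Fubini with the variable `τ_i` innermost; for almost all other parameters the inner integral is
  -- that of a derivative.
  rw [integral_prod_symm _ hF']
  refine integral_eq_zero_of_ae ?_
  filter_upwards [hF'.prod_left_ae] with τ hτ
  obtain ⟨y, hupd⟩ : ∃ y, ∀ t : ℝ, contourPt x (i.insertNth t τ) =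
      Function.update y (Sum.inr i) (t : ℂ) := by
    refine ⟨contourPt x (i.insertNth 0 τ), fun t => ?_⟩
    ext (a | j)
    · simp [contourPt]
    · refine Fin.succAboveCases i ?_ (fun j => ?_) j
      · simp [contourPt]
      · simp [contourPt, Fin.succAbove_ne]
  have hder : ∀ t : ℝ, HasDerivAt (fun t : ℝ => expQuot (kerDenom (n + 1)) (kerExp μ) M p
      (contourPt x (i.insertNth t τ))) (F (i.insertNth t τ)) t := by
    intro t
    have h2 := eval_kerDenom_ne_zero hx (i.insertNth t τ)
    simp only [F, hupd] at h2 ⊢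
    exact (hasDerivAt_expQuot_update _ _ _ _ _ _ h2).comp_ofReal
  have hlim : Tendsto (fun t : ℝ => expQuot (kerDenom (n + 1)) (kerExp μ) M p
      (contourPt x (i.insertNth t τ))) atTop (nhds 0) := by
    obtain ⟨D, h, -, -, hb⟩ := exists_norm_expQuot_le μ M p
    refine squeeze_zero_norm (fun t => hb x hx _) ?_
    simp only [Fin.prod_univ_succAbove _ i, Fin.insertNth_apply_same, Fin.insertNth_apply_succAbove]
    have := ((tendsto_pow_mul_exp D (hμ i)).mul_const (∏ j, ((1 + |τ j|) ^ D * Real.exp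
      ((μ (i.succAbove j).castSucc - μ (Fin.last (n + 1))).re * τ j)))).const_mul (h x)
    simpa using this
  have h3 := integral_Ioi_of_hasDerivAt_of_tendsto' (a := 0) (fun t _ => hder t)
    (IntegrableOn.mono_set hτ Set.Ioi_subset_Ici_self) hlim
  -- The boundary value at `τ_i = 0` vanishes by divisibility.
  have h4 : expQuot (kerDenom (n + 1)) (kerExp μ) M p (contourPt x (i.insertNth 0 τ)) = 0 := by
    obtain ⟨q, rfl⟩ := hp
    simp [expQuot, contourPt]
  rw [h4, sub_zero] at h3
  change ∫ t in Set.Ici 0, F (i.insertNth t τ) = 0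
  rw [integral_Ici_eq_integral_Ioi, h3]

end Contour

/-! ### Transport of the Schroedinger operator through the integral -/

section Recursion

variable {k : ℕ}

theorem X_inr_dvd_kerCross (i : Fin k) : X (Sum.inr i) ∣ kerCross k := by
  refine Dvd.dvd.trans ?_ (Finset.dvd_prod_of_mem _ (Finset.mem_univ i))
  refine Dvd.dvd.trans ?_ (Finset.dvd_prod_of_mem _ (Finset.mem_univ i.castSucc))
  simp [contourVar]

/-- `A(z,x) ^ m` contains `τ_i ^ m`, and differentiating in `x_i` at fixed `τ` keeps this factor.
Hence `m ≥ 1` suffices, although a derivative of the kernel is involved. -/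
theorem X_inr_dvd_kerBdry {m : ℕ} (hm : 1 ≤ m) (μ : Fin (k + 1) → ℂ) (q : MvPolynomial (Fin k) ℂ)
    (i : Fin k) : X (Sum.inr i) ∣ kerBdry m μ q i := by
  have h1 : X (Sum.inr i) ∣ kerCross k ^ m := dvd_pow (X_inr_dvd_kerCross i) (by omega)
  have h2 : X (Sum.inr i) ∣ kerNum m q := (h1.mul_right _).mul_right _
  have h3 : X (Sum.inr i) ∣ pderiv (Sum.inl i.castSucc) (kerNum m q) := by
    obtain ⟨r, hr⟩ := h2
    rw [hr, pderiv_mul, pderiv_X_of_ne (by simp), zero_mul, zero_add]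
    exact dvd_mul_right _ _
  rw [kerBdry, dOp_apply]
  exact ((((h3.mul_left _).sub (h2.mul_left _)).add (h2.mul_left _)).sub ((h1.mul_right _).mul_right _))

theorem iteratedDeriv_two_contourIntegral {μ : Fin (k + 1) → ℂ}
    (hμ : ∀ i : Fin k, (μ i.castSucc - μ (Fin.last k)).re < 0) (M : ℕ)
    (p : MvPolynomial (Fin (k + 1) ⊕ Fin k) ℂ) {x : Fin (k + 1) → ℂ} (hx : 0 < imDenom x)
    (a : Fin (k + 1)) :
    iteratedDeriv 2 (fun t => contourIntegral μ M p (Function.update x a t)) (x a) =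
      contourIntegral μ (M + 2) (dOp (kerDenom k) (kerExp μ) (M + 1) (Sum.inl a)
        (dOp (kerDenom k) (kerExp μ) M (Sum.inl a) p)) x := by
  refine iteratedDeriv_two_of_eventually ?_ (hasDerivAt_contourIntegral hμ (M + 1) _ hx a)
  have hu : ContinuousAt (fun t => Function.update x a t) (x a) := by fun_prop
  have hpos : ∀ᶠ t in nhds (x a), 0 < imDenom (Function.update x a t) :=
    (continuous_imDenom.continuousAt.comp hu).eventually (lt_mem_nhds (by simpa using hx))
  filter_upwards [hpos] with t ht
  simpa using hasDerivAt_contourIntegral hμ M p ht a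

/-- The integrand intertwines the two Schroedinger operators up to a total derivative. -/
theorem expQuot_kerNum_intertwining (m : ℕ) (μ : Fin (k + 1) → ℂ) {q q' : MvPolynomial (Fin k) ℂ}
    (hq : vdm X ^ 2 * q' = step (vdm X) (fun i => μ i.castSucc) m m q) {x : Fin (k + 1) → ℂ}
    (hx : 0 < imDenom x) (τ : Fin k → ℝ) :
    -(∑ a, expQuot (kerDenom k) (kerExp μ) (2 * m + 2)
        (dOp (kerDenom k) (kerExp μ) (2 * m + 1) (Sum.inl a)
          (dOp (kerDenom k) (kerExp μ) (2 * m) (Sum.inl a) (kerNum m q))) (contourPt x τ))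
      + ((∑ i : Fin (k + 1), ∑ j ∈ Finset.Ioi i, 2 * (m : ℂ) * ((m : ℂ) + 1) / (x i - x j) ^ 2)
        + ∑ a, μ a ^ 2) * expQuot (kerDenom k) (kerExp μ) (2 * m) (kerNum m q) (contourPt x τ) =
    expQuot (kerDenom k) (kerExp μ) (2 * m) (kerNum m q') (contourPt x τ)
      - 2 * ∑ i, expQuot (kerDenom k) (kerExp μ) (2 * m + 2)
        (dOp (kerDenom k) (kerExp μ) (2 * m + 1) (Sum.inr i) (kerBdry m μ q i)) (contourPt x τ) := by
  have hB := eval_kerDenom_ne_zero hx τ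
  have hxz := hB
  rw [eval_kerDenom] at hxz
  have hvx : vdm x ≠ 0 := left_ne_zero_of_mul hxz
  have hvz : vdm (contourPoint x τ) ≠ 0 := right_ne_zero_of_mul hxz
  have h1 := congrArg (eval (contourPt x τ)) (kerNum_intertwining m μ q)
  have hW : eval (contourPt x τ) (rename Sum.inl (∑ a, pderiv a (vdm X) ^ 2)) =
      vdm x ^ 2 * ∑ i, ∑ j ∈ Finset.Ioi i, 2 / (x i - x j) ^ 2 := by
    rw [eval_rename, ← sum_pderiv_vdm_sq (injective_of_vdm_ne_zero hvx)]
    have : contourPt x τ ∘ Sum.inl = x := rfl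
    rw [this]
    simp
  have hz : eval (contourPt x τ) (vdm contourVar) = vdm (contourPoint x τ) := by
    rw [map_vdm, eval_contourPt_contourVar]
  have hq' : kerCross k ^ m * vdm (fun a => X (Sum.inl a)) ^ (m + 2)
      * toContour k (step (vdm X) (fun i => μ i.castSucc) m m q) = kerDenom k ^ 2 * kerNum m q' := by
    have : toContour k (vdm X) = vdm contourVar := by
      have := map_vdm (toContour k).toRingHom (X : Fin k → _)
      simpa [toContour] using this
    rw [← hq, map_mul, map_pow, this, kerDenom, kerNum]
    ring
  rw [hq'] at h1
  simp only [map_add, map_sub, map_neg, map_sum, map_mul, map_pow, map_natCast, map_one, map_ofNat,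
    eval_C, hz] at h1 hW
  rw [hW] at h1
  have hpot : (∑ i : Fin (k + 1), ∑ j ∈ Finset.Ioi i, 2 * (m : ℂ) * ((m : ℂ) + 1) / (x i - x j) ^ 2) =
      (m : ℂ) * ((m : ℂ) + 1) * ∑ i, ∑ j ∈ Finset.Ioi i, 2 / (x i - x j) ^ 2 := by
    simp only [Finset.mul_sum]
    exact Finset.sum_congr rfl fun i _ => Finset.sum_congr rfl fun j _ => by ring
  rw [hpot]
  simp only [expQuot, ← Finset.sum_mul, ← Finset.sum_div]
  rw [pow_add]
  set B := eval (contourPt x τ) (kerDenom k) with hBdef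
  have hBe : B = vdm x * vdm (contourPoint x τ) := eval_kerDenom x τ
  generalize (∑ i, ∑ j ∈ Finset.Ioi i, 2 / (x i - x j) ^ 2) = W at *
  field_simp
  linear_combination h1 + (m : ℂ) * (m + 1) * W * eval (contourPt x τ) (kerNum m q)
    * (B + vdm x * vdm (contourPoint x τ)) * hBe

theorem neg_sum_integral_add {α ι κ : Type*} [Fintype ι] [Fintype κ] [MeasurableSpace α]
    {ν : Measure α} {f : ι → α → ℂ} {g h : α → ℂ} {b : κ → α → ℂ} (hf : ∀ i, Integrable (f i) ν)
    (hg : Integrable g ν) (hh : Integrable h ν) (hb : ∀ i, Integrable (b i) ν) {c : ℂ}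
    (H : ∀ t, -(∑ i, f i t) + c * g t = h t - 2 * ∑ i, b i t) (hb0 : ∀ i, ∫ t, b i t ∂ν = 0) :
    -(∑ i, ∫ t, f i t ∂ν) + c * ∫ t, g t ∂ν = ∫ t, h t ∂ν := by
  have h1 := integral_congr_ae (μ := ν) (Eventually.of_forall H)
  have hf' : Integrable (fun t => -∑ i, f i t) ν := (integrable_finsetSum _ fun i _ => hf i).neg
  rw [integral_add hf' (hg.const_mul c), integral_neg,
    integral_finsetSum _ fun i _ => hf i, integral_const_mul,
    integral_sub hh ((integrable_finsetSum _ fun i _ => hb i).const_mul 2), integral_const_mul,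
    integral_finsetSum _ fun i _ => hb i] at h1
  simpa only [hb0, Finset.sum_const_zero, mul_zero, sub_zero] using h1

/-- The pointwise intertwining identity is integrated, and Stokes' formula removes the total
derivatives. -/
theorem calogeroMoser_contourIntegral {m : ℕ} (hm : 1 ≤ m) {μ : Fin (k + 1) → ℂ}
    (hμ : ∀ i : Fin k, (μ i.castSucc - μ (Fin.last k)).re < 0) {q q' : MvPolynomial (Fin k) ℂ}
    (hq : vdm X ^ 2 * q' = step (vdm X) (fun i => μ i.castSucc) m m q) {x : Fin (k + 1) → ℂ}
    (hx : 0 < imDenom x) :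
    calogeroMoser (k + 1) m (contourIntegral μ (2 * m) (kerNum m q)) x
      + (∑ a, μ a ^ 2) * contourIntegral μ (2 * m) (kerNum m q) x =
    contourIntegral μ (2 * m) (kerNum m q') x := by
  rw [calogeroMoser]
  simp only [iteratedDeriv_two_contourIntegral hμ _ _ hx]
  rw [add_assoc, ← add_mul]
  exact neg_sum_integral_add (fun a => integrable_expQuot hμ _ _ hx) (integrable_expQuot hμ _ _ hx)
    (integrable_expQuot hμ _ _ hx) (fun a => integrable_expQuot hμ _ _ hx)
    (expQuot_kerNum_intertwining m μ hq hx)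
    (fun i => contourIntegral_dOp_inr hμ (2 * m + 1) i (X_inr_dvd_kerBdry hm μ q i) hx)

end Recursion

/-! ### The first term of the sequence of integrals -/

section LeadingTerms

variable {σ R ι : Type*} [CommRing R] {w : σ → ℕ}

theorem prod_sub_prod_mem_degLE (s : Finset ι) {d : ι → ℤ} {f u : ι → MvPolynomial σ R}
    (hf : ∀ j ∈ s, f j ∈ degLE R w (d j)) (hfu : ∀ j ∈ s, f j - u j ∈ degLE R w (d j - 1)) :
    ∏ j ∈ s, f j - ∏ j ∈ s, u j ∈ degLE R w (∑ j ∈ s, d j - 1) := by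
  classical
  induction s using Finset.induction_on with
  | empty => simp
  | insert a s ha ih =>
    have hs := fun j hj => hf j (Finset.mem_insert_of_mem hj)
    have hsu := fun j hj => hfu j (Finset.mem_insert_of_mem hj)
    have hu : ∏ j ∈ s, u j ∈ degLE R w (∑ j ∈ s, d j) := prod_mem_degLE s fun j hj => by
      have := sub_mem (hs j hj) (degLE_mono (by omega) (hsu j hj))
      rwa [sub_sub_cancel] at this
    rw [Finset.prod_insert ha, Finset.prod_insert ha, Finset.sum_insert ha]
    have : f a * ∏ j ∈ s, f j - u a * ∏ j ∈ s, u j =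
        f a * (∏ j ∈ s, f j - ∏ j ∈ s, u j) + (f a - u a) * ∏ j ∈ s, u j := by ring
    rw [this]
    exact add_mem
      (mul_mem_degLE_of_eq (hf a (Finset.mem_insert_self a s)) (ih hs hsu) (by ring))
      (mul_mem_degLE_of_eq (hfu a (Finset.mem_insert_self a s)) hu (by ring))

theorem pow_sub_pow_mem_degLE {d : ℤ} {f u : MvPolynomial σ R} (hf : f ∈ degLE R w d)
    (hfu : f - u ∈ degLE R w (d - 1)) (n : ℕ) : f ^ n - u ^ n ∈ degLE R w (n * d - 1) := by
  simpa using prod_sub_prod_mem_degLE (Finset.range n) (fun _ _ => hf) (fun _ _ => hfu)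

end LeadingTerms

/-! ### Top-degree part of the cross product -/

section Cross

variable {k : ℕ}

/-- Off the diagonal, the factors for `(i, j)` and `(j, i)` combine to `-(y i - y j) ^ 2`. -/
theorem prod_ite_sub {S : Type*} [CommRing S] {n : ℕ} (t y : Fin n → S) :
    ∏ i, ∏ j, (if j = i then t i else y i - y j) = (∏ i, t i) * ((-1) ^ n.choose 2 * vdm y ^ 2) := by
  have h := sum_sum_eq_sum_Ioi (A := Additive S)
    (fun i j => Additive.ofMul (if j = i then t i else y i - y j))
  have h' : ∏ i, ∏ j, (if j = i then t i else y i - y j) =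
      (∏ i, ∏ j ∈ Finset.Ioi i, ((if j = i then t i else y i - y j) *
        (if i = j then t j else y j - y i))) * ∏ i, (if i = i then t i else y i - y i) := h
  rw [h', mul_comm]
  simp only [if_true]
  congr 1
  have h2 : ∀ i, ∀ j ∈ Finset.Ioi i, ((if j = i then t i else y i - y j) *
      (if i = j then t j else y j - y i)) = -1 * (y i - y j) ^ 2 := by
    intro i j hj
    have hij := Finset.mem_Ioi.1 hj
    rw [if_neg hij.ne', if_neg hij.ne]
    ring
  rw [Finset.prod_congr rfl fun i _ => Finset.prod_congr rfl (h2 i)]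
  simp only [Finset.prod_mul_distrib, Finset.prod_const, Finset.prod_pow_eq_pow_sum,
    sum_card_Ioi, Finset.prod_pow]
  rfl

theorem vdm_castSucc {S : Type*} [CommRing S] {n : ℕ} (y : Fin (n + 1) → S) :
    vdm y = vdm (fun i : Fin n => y i.castSucc) * ∏ i : Fin n, (y i.castSucc - y (Fin.last n)) := by
  unfold vdm
  have hlast : Finset.Ioi (Fin.last n) = ∅ := by
    ext j
    simp [Fin.le_last]
  rw [Fin.prod_univ_castSucc, ← Finset.prod_mul_distrib, hlast, Finset.prod_empty, mul_one]
  have h : ∀ i : Fin n, Finset.Ioi i.castSucc =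
      Finset.cons (Fin.last n) ((Finset.Ioi i).map Fin.castSuccEmb) (by simp) := by
    intro i
    ext j
    refine Fin.lastCases ?_ (fun j => ?_) j
    · simp [Fin.castSucc_lt_last]
    · simpa using fun _ => Fin.le_last _
  simp only [h, Finset.prod_cons, Finset.prod_map]
  simp [mul_comm]

/-- The part of `A(z, x)` of top degree in `x`. -/
theorem kerCross_pow_sub_mem_degLE (m : ℕ) :
    kerCross k ^ m - ((∏ i : Fin k, X (Sum.inr i)) * rename Sum.inl ((-1) ^ k.choose 2 *
      (vdm X * vdm fun i : Fin k => X i.castSucc))) ^ m ∈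
      degLE ℂ (inlWeight (k + 1) (Fin k)) (m * (k * k) - 1) := by
  set w := inlWeight (k + 1) (Fin k)
  -- The diagonal factors `z_i - x_i = τ_i` have degree zero in `x`. In every other factor `τ_i` is
  -- of lower order, so the top degree is `k (k + 1) - k = k * k`.
  let u : Fin k × Fin (k + 1) → MvPolynomial (Fin (k + 1) ⊕ Fin k) ℂ := fun p =>
    if p.2 = p.1.castSucc then X (Sum.inr p.1) else X (Sum.inl p.1.castSucc) - X (Sum.inl p.2)
  let f : Fin k × Fin (k + 1) → MvPolynomial (Fin (k + 1) ⊕ Fin k) ℂ := fun p =>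
    contourVar p.1 - X (Sum.inl p.2)
  let d : Fin k × Fin (k + 1) → ℤ := fun p => if p.2 = p.1.castSucc then 0 else 1
  have hl : ∀ a, (X (Sum.inl a) : MvPolynomial (Fin (k + 1) ⊕ Fin k) ℂ) ∈ degLE ℂ w 1 := fun a => by
    simpa [w] using X_mem_degLE (R := ℂ) w (Sum.inl a)
  have hr : ∀ i, (X (Sum.inr i) : MvPolynomial (Fin (k + 1) ⊕ Fin k) ℂ) ∈ degLE ℂ w 0 := fun a => by
    simpa [w] using X_mem_degLE (R := ℂ) w (Sum.inr a)
  have hf : ∀ p ∈ Finset.univ, f p ∈ degLE ℂ w (d p) := by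
    rintro ⟨i, a⟩ -
    simp only [f, d, contourVar]
    split_ifs with h
    · rw [h, add_sub_cancel_left]
      exact hr i
    · exact sub_mem (add_mem (hl _) (degLE_mono (by norm_num) (hr i))) (hl _)
  have hfu : ∀ p ∈ Finset.univ, f p - u p ∈ degLE ℂ w (d p - 1) := by
    rintro ⟨i, a⟩ -
    simp only [f, d, u, contourVar]
    split_ifs with h
    · rw [h, add_sub_cancel_left, sub_self]
      exact zero_mem _
    · have : X (Sum.inl i.castSucc) + X (Sum.inr i) - X (Sum.inl a) -
          (X (Sum.inl i.castSucc) - X (Sum.inl a)) =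
          (X (Sum.inr i) : MvPolynomial (Fin (k + 1) ⊕ Fin k) ℂ) := by ring
      rw [this]
      exact hr i
  have hd : ∑ p, d p = k * k := by
    have : ∀ i : Fin k, ∑ a, (if a = i.castSucc then (0 : ℤ) else 1) = k := fun i => by
      have h1 : ∀ a : Fin (k + 1), (if a = i.castSucc then (0 : ℤ) else 1) =
          1 - if a = i.castSucc then 1 else 0 := fun a => by split_ifs <;> rfl
      simp [h1]
    rw [Fintype.sum_prod_type]
    simp [d, this]
  have hfp : ∏ p, f p = kerCross k := by
    rw [Fintype.prod_prod_type]
    rfl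
  have hup : ∏ p, u p = (∏ i : Fin k, X (Sum.inr i)) * rename Sum.inl ((-1) ^ k.choose 2 *
      (vdm X * vdm fun i : Fin k => X i.castSucc)) := by
    rw [Fintype.prod_prod_type]
    simp only [u, Fin.prod_univ_castSucc, Fin.castSucc_inj, (Fin.castSucc_ne_last _).symm, if_false,
      Finset.prod_mul_distrib, prod_ite_sub (fun i : Fin k => X (Sum.inr i))
        (fun i : Fin k => (X (Sum.inl i.castSucc) : MvPolynomial (Fin (k + 1) ⊕ Fin k) ℂ))]
    rw [vdm_castSucc X]
    simp only [map_mul, map_pow, map_neg, map_one, map_prod, map_sub, rename_X]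
    have : rename Sum.inl (vdm fun i : Fin k => (X i.castSucc : MvPolynomial (Fin (k + 1)) ℂ)) =
        vdm fun i : Fin k => (X (Sum.inl i.castSucc) : MvPolynomial (Fin (k + 1) ⊕ Fin k) ℂ) := by
      have := map_vdm (rename (R := ℂ) (Sum.inl : Fin (k + 1) → Fin (k + 1) ⊕ Fin k)).toRingHom
        fun i : Fin k => X i.castSucc
      simpa using this
    rw [this]
    ring
  have h1 := prod_mem_degLE Finset.univ hf
  have h2 := prod_sub_prod_mem_degLE Finset.univ hf hfu
  rw [hd, hfp] at h1
  rw [hd, hfp, hup] at h2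
  exact pow_sub_pow_mem_degLE h1 h2 m

end Cross

/-! ### Laplace transforms of polynomials -/

section Moments

theorem norm_pow_mul_cexp_le (n : ℕ) (b : ℂ) (t : ℝ) :
    ‖(t : ℂ) ^ n * Complex.exp (b * t)‖ ≤ (1 + |t|) ^ n * Real.exp (b.re * t) := by
  rw [norm_mul, norm_pow, Complex.norm_exp, Complex.norm_real, Real.norm_eq_abs]
  simp only [Complex.mul_re, Complex.ofReal_re, Complex.ofReal_im, mul_zero, sub_zero]
  gcongr
  linarith

theorem integrable_pow_mul_cexp (n : ℕ) {b : ℂ} (hb : b.re < 0) :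
    IntegrableOn (fun t : ℝ => (t : ℂ) ^ n * Complex.exp (b * t)) (Set.Ici 0) :=
  (integrableOn_pow_mul_exp n hb).mono' (Continuous.aestronglyMeasurable (by fun_prop))
    (Eventually.of_forall fun t => norm_pow_mul_cexp_le n b t)

/-- Integration by parts: `t ^ (n + 1) e^{bt}` vanishes at both ends. -/
theorem integral_pow_mul_cexp (n : ℕ) {b : ℂ} (hb : b.re < 0) :
    ∫ t : ℝ in Set.Ici 0, (t : ℂ) ^ n * Complex.exp (b * t) = n.factorial * ((-b) ^ (n + 1))⁻¹ := by
  have hb0 : b ≠ 0 := by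
    rintro rfl
    simp at hb
  have hlim : ∀ n, Tendsto (fun t : ℝ => (t : ℂ) ^ n * Complex.exp (b * t)) atTop (nhds 0) :=
    fun n => squeeze_zero_norm (norm_pow_mul_cexp_le n b) (tendsto_pow_mul_exp n hb)
  have hexp : ∀ t : ℝ, HasDerivAt (fun t : ℝ => Complex.exp (b * t)) (b * Complex.exp (b * t)) t :=
    fun t => by
      have h1 : HasDerivAt (fun s : ℂ => Complex.exp (b * s)) (b * Complex.exp (b * t)) t := by
        simpa [mul_comm] using ((hasDerivAt_id' (t : ℂ)).const_mul b).cexp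
      exact h1.comp_ofReal
  have hint := fun n => (integrable_pow_mul_cexp n hb).mono_set Set.Ioi_subset_Ici_self
  rw [integral_Ici_eq_integral_Ioi]
  induction n with
  | zero =>
    have h := integral_Ioi_of_hasDerivAt_of_tendsto' (a := 0) (fun t _ => hexp t)
      (by simpa [IntegrableOn] using (hint 0).const_mul b) (by simpa using hlim 0)
    rw [integral_const_mul] at h
    simp only [Complex.ofReal_zero, mul_zero, Complex.exp_zero, zero_sub] at h
    simp only [pow_zero, one_mul, Nat.factorial_zero, Nat.cast_one, zero_add, pow_one]
    field_simp
    linear_combination h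
  | succ n ih =>
    have hd : ∀ t : ℝ, HasDerivAt (fun t : ℝ => (t : ℂ) ^ (n + 1) * Complex.exp (b * t))
        (((n + 1 : ℕ) : ℂ) * ((t : ℂ) ^ n * Complex.exp (b * t))
          + b * ((t : ℂ) ^ (n + 1) * Complex.exp (b * t))) t := fun t => by
      have h1 : HasDerivAt (fun t : ℝ => (t : ℂ) ^ (n + 1)) (((n + 1 : ℕ) : ℂ) * (t : ℂ) ^ n) t := by
        simpa using (hasDerivAt_pow (n + 1) (t : ℂ)).comp_ofReal
      refine (h1.mul (hexp t)).congr_deriv ?_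
      ring
    have h := integral_Ioi_of_hasDerivAt_of_tendsto' (a := 0) (fun t _ => hd t)
      (((hint n).const_mul _).add ((hint (n + 1)).const_mul b)) (hlim (n + 1))
    rw [integral_add ((hint n).const_mul _) ((hint (n + 1)).const_mul b), integral_const_mul,
      integral_const_mul, ih] at h
    simp only [Complex.ofReal_zero, ne_eq, Nat.add_eq_zero_iff, one_ne_zero, and_false,
      not_false_eq_true, zero_pow, zero_mul, sub_zero] at h
    have hb1 : (-b) ^ (n + 1) ≠ 0 := pow_ne_zero _ (neg_ne_zero.2 hb0)
    rw [Nat.factorial_succ, pow_succ (-b) (n + 1)]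
    push_cast at h ⊢
    field_simp at h ⊢
    linear_combination h

variable {k : ℕ}

/-- The Laplace transform of a polynomial in the contour parameters. -/
def laplace (b : Fin k → ℂ) (P : MvPolynomial (Fin (k + 1) ⊕ Fin k) ℂ) :
    MvPolynomial (Fin (k + 1)) ℂ :=
  ∑ s ∈ P.support, C (coeff s P * ∏ i, ((s (Sum.inr i)).factorial * ((-b i) ^ (s (Sum.inr i) + 1))⁻¹))
    * ∏ a, X a ^ s (Sum.inl a)

theorem laplace_mem_degLE (b : Fin k → ℂ) {d : ℤ} {P : MvPolynomial (Fin (k + 1) ⊕ Fin k) ℂ}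
    (hP : P ∈ degLE ℂ (inlWeight (k + 1) (Fin k)) d) : laplace b P ∈ degLE ℂ 1 d := by
  refine sum_mem fun s hs => C_mul_mem_degLE _ (degLE_mono (hP s hs) ?_)
  rw [weight_inlWeight]
  push_cast
  exact prod_mem_degLE _ fun i _ => by
    simpa using pow_mem_degLE (X_mem_degLE (R := ℂ) 1 i) (s (Sum.inl i))

theorem integral_eval_mul_cexp {b : Fin k → ℂ} (hb : ∀ i, (b i).re < 0)
    (P : MvPolynomial (Fin (k + 1) ⊕ Fin k) ℂ) (x : Fin (k + 1) → ℂ) :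
    Integrable (fun τ => eval (contourPt x τ) P * Complex.exp (∑ i, b i * τ i)) (contourMeasure k) ∧
    ∫ τ, eval (contourPt x τ) P * Complex.exp (∑ i, b i * τ i) ∂contourMeasure k =
      eval x (laplace b P) := by
  have h1 : ∀ τ, eval (contourPt x τ) P * Complex.exp (∑ i, b i * τ i) =
      ∑ s ∈ P.support, coeff s P * (∏ a, x a ^ s (Sum.inl a)) *
        ∏ i, ((τ i : ℂ) ^ s (Sum.inr i) * Complex.exp (b i * τ i)) := fun τ => by
    rw [eval_eq', Finset.sum_mul]
    refine Finset.sum_congr rfl fun s _ => ?_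
    rw [Fintype.prod_sum_type, Finset.prod_mul_distrib, Complex.exp_sum]
    simp only [contourPt, Sum.elim_inl, Sum.elim_inr]
    ring
  have h2 : ∀ s : Fin (k + 1) ⊕ Fin k →₀ ℕ, Integrable (fun τ : Fin k → ℝ =>
      ∏ i, ((τ i : ℂ) ^ s (Sum.inr i) * Complex.exp (b i * τ i))) (contourMeasure k) := fun s =>
    Integrable.fintype_prod (f := fun i (t : ℝ) => (t : ℂ) ^ s (Sum.inr i) * Complex.exp (b i * t))
      fun i => integrable_pow_mul_cexp _ (hb i)
  simp only [h1]
  refine ⟨integrable_finsetSum _ fun s _ => (h2 s).const_mul _, ?_⟩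
  rw [integral_finsetSum _ fun s _ => (h2 s).const_mul _, laplace, map_sum]
  refine Finset.sum_congr rfl fun s _ => ?_
  rw [integral_const_mul, contourMeasure,
    integral_fintype_prod_eq_prod fun i (t : ℝ) => (t : ℂ) ^ s (Sum.inr i) * Complex.exp (b i * t)]
  simp only [integral_pow_mul_cexp _ (hb _), map_mul, eval_C, map_prod, map_pow, eval_X]
  ring

end Moments

/-! ### The integral formula -/

section Final

/-- Matches the degree `k * k` of `A(z,x)` in `x` with that of `A(x) A(x_1, …, x_k)`. -/
theorem choose_two_add (k : ℕ) : (k + 1).choose 2 + k.choose 2 = k * k := by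
  induction k with
  | zero => rfl
  | succ k ih =>
    have h1 := Nat.choose_succ_succ' (k + 1) 1
    have h2 := Nat.choose_succ_succ' k 1
    simp only [Nat.choose_one_right] at h1 h2
    norm_num at h1 h2
    rw [h1]
    nlinarith

variable {k : ℕ}

/-- The top part of `A(z,x) ^ m` in `x` is `∏ τ_i ^ m` times a polynomial in `x`; its moments are
the factors `m! (-b i)^{-(m+1)}`. Linearity of `laplace` is obtained from the integral it
represents. -/
theorem laplace_kerCross_sub_mem_degLE (m : ℕ) {b : Fin k → ℂ} (hb : ∀ i, (b i).re < 0) :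
    laplace b (kerCross k ^ m) - C (∏ i, ((m.factorial : ℂ) * ((-b i) ^ (m + 1))⁻¹)) *
      ((-1) ^ k.choose 2 * (vdm X * vdm fun i : Fin k => X i.castSucc)) ^ m ∈
      degLE ℂ 1 (m * (k * k) - 1) := by
  have h := laplace_mem_degLE b (kerCross_pow_sub_mem_degLE (k := k) m)
  convert h using 1
  refine MvPolynomial.funext fun x => ?_
  rw [← (integral_eval_mul_cexp hb _ x).2, map_sub, ← (integral_eval_mul_cexp hb _ x).2]
  have h2 := integral_eval_mul_cexp hb (((∏ i : Fin k, X (Sum.inr i)) * rename Sum.inl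
    ((-1) ^ k.choose 2 * (vdm X * vdm fun i : Fin k => X i.castSucc))) ^ m) x
  simp only [map_sub, sub_mul]
  rw [integral_sub (integral_eval_mul_cexp hb _ x).1 h2.1]
  congr 1
  set T : MvPolynomial (Fin (k + 1)) ℂ := (-1) ^ k.choose 2 * (vdm X * vdm fun i : Fin k => X i.castSucc)
  have h3 : ∀ τ, eval (contourPt x τ) (((∏ i : Fin k, X (Sum.inr i)) * rename Sum.inl T) ^ m) *
      Complex.exp (∑ i, b i * τ i) =
      eval x T ^ m * ∏ i, ((τ i : ℂ) ^ m * Complex.exp (b i * τ i)) := fun τ => by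
    have : contourPt x τ ∘ Sum.inl = x := rfl
    rw [map_pow, map_mul, eval_rename, this, Finset.prod_mul_distrib, Complex.exp_sum]
    simp only [map_prod, eval_X, contourPt, Sum.elim_inr, Finset.prod_pow]
    ring
  simp only [h3]
  rw [integral_const_mul, contourMeasure,
    integral_fintype_prod_eq_prod fun i (t : ℝ) => (t : ℂ) ^ m * Complex.exp (b i * t)]
  simp only [integral_pow_mul_cexp _ (hb _), map_mul, eval_C, map_pow]
  ring

theorem sum_kerExp_mul (μ x : Fin (k + 1) → ℂ) (τ : Fin k → ℝ) :
    ∑ a, kerExp μ a * contourPt x τ a =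
      ∑ a, μ a * x a + ∑ i, (μ i.castSucc - μ (Fin.last k)) * τ i := by
  simp [Fintype.sum_sum_type, kerExp, contourPt]

/-- The numerator `A(z) ^ (2 m)` cancels every `A(z)` in the denominator, leaving a polynomial times
an exponential. -/
theorem contourIntegral_first (m : ℕ) {μ : Fin (k + 1) → ℂ}
    (hμ : ∀ i : Fin k, (μ i.castSucc - μ (Fin.last k)).re < 0) {x : Fin (k + 1) → ℂ}
    (hx : 0 < imDenom x) :
    contourIntegral μ (2 * m) (kerNum m (vdm X ^ (2 * m))) x =
      expQuot (vdm X) μ m (laplace (fun i => μ i.castSucc - μ (Fin.last k)) (kerCross k ^ m)) x := by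
  have hpt : ∀ τ, expQuot (kerDenom k) (kerExp μ) (2 * m) (kerNum m (vdm X ^ (2 * m))) (contourPt x τ) =
      (Complex.exp (∑ a, μ a * x a) / vdm x ^ m) * (eval (contourPt x τ) (kerCross k ^ m) *
        Complex.exp (∑ i, (μ i.castSucc - μ (Fin.last k)) * τ i)) := fun τ => by
    have hB := eval_kerDenom_ne_zero hx τ
    have hz : eval (contourPt x τ) (toContour k (vdm X)) = vdm (contourPoint x τ) := by
      have := map_vdm (toContour k).toRingHom (X : Fin k → _)
      have h2 : toContour k (vdm X) = vdm contourVar := by simpa [toContour] using this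
      rw [h2, map_vdm, eval_contourPt_contourVar]
    have hvx : eval (contourPt x τ) (vdm fun a => X (Sum.inl a)) = vdm x := by
      rw [map_vdm]
      simp [contourPt]
    rw [eval_kerDenom] at hB
    have h1 : vdm x ≠ 0 := left_ne_zero_of_mul hB
    have h2 : vdm (contourPoint x τ) ≠ 0 := right_ne_zero_of_mul hB
    rw [expQuot, eval_kerDenom, kerNum, map_mul, map_mul, map_pow, map_pow, map_pow, map_pow, hz, hvx,
      sum_kerExp_mul, Complex.exp_add]
    field_simp
    ring
  rw [contourIntegral]
  simp only [hpt]
  rw [integral_const_mul, (integral_eval_mul_cexp hμ _ x).2, expQuot, eval_vdm_X]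
  ring

theorem calogeroMoser_congr {m : ℕ} {f g : (Fin (k + 1) → ℂ) → ℂ}
    (hfg : ∀ x, 0 < imDenom x → f x = g x) {x : Fin (k + 1) → ℂ} (hx : 0 < imDenom x) :
    calogeroMoser (k + 1) m f x = calogeroMoser (k + 1) m g x := by
  unfold calogeroMoser
  rw [hfg x hx]
  congr 2
  refine Finset.sum_congr rfl fun a _ => ?_
  refine Filter.EventuallyEq.iteratedDeriv_eq 2 ?_
  have hu : ContinuousAt (fun t => Function.update x a t) (x a) := by fun_prop
  have hpos : ∀ᶠ t in nhds (x a), 0 < imDenom (Function.update x a t) :=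
    (continuous_imDenom.continuousAt.comp hu).eventually (lt_mem_nhds (by simpa using hx))
  exact hpos.mono fun t ht => hfg _ ht

/-- Identities are known only on the open set `0 < imDenom x`. It contains a product of distinct
horizontal lines, which are infinite sets, and that is enough for polynomials. -/
theorem eq_zero_of_eval_eq_zero_of_imDenom_pos {p : MvPolynomial (Fin (k + 1)) ℂ}
    (h : ∀ x, 0 < imDenom x → eval x p = 0) : p = 0 := by
  refine MvPolynomial.funext_set (fun a : Fin (k + 1) => {z : ℂ | z.im = (a : ℕ)}) (fun a => ?_)
    fun x hx => ?_
  · refine Set.infinite_of_injective_forall_mem (f := fun n : ℕ => (⟨n, (a : ℕ)⟩ : ℂ))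
      (fun i j hij => ?_) fun n => rfl
    simpa using congrArg Complex.re hij
  · rw [map_zero]
    refine h x (imDenom_pos fun i j hij => ?_)
    rw [hx i (Set.mem_univ i), hx j (Set.mem_univ j)]
    exact fun h => hij (Fin.ext (by exact_mod_cast h))

theorem im_injective_of_imDenom_pos {x : Fin (k + 1) → ℂ} (hx : 0 < imDenom x) :
    Function.Injective x :=
  injective_of_vdm_ne_zero fun h => by
    have := abs_vdm_im_le x
    rw [h, norm_zero] at this
    have h0 : |vdm fun i => (x i).im| = 0 := le_antisymm this (abs_nonneg _)
    rw [imDenom, h0, zero_mul] at hx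
    exact lt_irrefl _ hx

/-- The numerators of the iterated integrals. -/
def iterStep (ν : Fin (k + 1) → ℂ) (m : ℕ) (p : MvPolynomial (Fin (k + 1)) ℂ) :
    ℕ → MvPolynomial (Fin (k + 1)) ℂ
  | 0 => p
  | j + 1 => step (vdm X) ν m (m + 2 * j) (iterStep ν m p j)

/-- Here the denominator exponent may grow by two at each step. The leading terms and the uniqueness
lemma make sense for every exponent, so quasi-invariance in `x` is not needed. -/
theorem iterStep_sub_mem_degLE (ν : Fin (k + 1) → ℂ) (m : ℕ) {p q : MvPolynomial (Fin (k + 1)) ℂ}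
    {e : ℤ} (hq : q ∈ degLE ℂ 1 e)
    (hp : p - vdm X ^ m * q ∈ degLE ℂ 1 (m * (k + 1).choose 2 + e - 1)) (j : ℕ) :
    iterStep ν m p j - vdm X ^ (m + 2 * j) * (C ((-2) ^ j) * (dirDeriv ν)^[j] q) ∈
      degLE ℂ 1 ((m + 2 * j : ℕ) * (k + 1).choose 2 + (e - j) - 1) ∧
    (dirDeriv ν)^[j] q ∈ degLE ℂ 1 (e - j) := by
  induction j with
  | zero => simpa [iterStep] using ⟨hp, hq⟩
  | succ j ih =>
    rw [Function.iterate_succ_apply']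
    refine ⟨?_, degLE_mono (by push_cast; omega) (dirDeriv_mem_degLE ν ih.2)⟩
    have h := step_top (isHomogeneous_vdm (u := (X : Fin (k + 1) → MvPolynomial _ ℂ)) fun i =>
      isHomogeneous_X ℂ i) ν m (m + 2 * j) (C_mul_mem_degLE ((-2) ^ j) ih.2) ih.1
    have h2 : -2 * dirDeriv ν (C ((-2) ^ j) * (dirDeriv ν)^[j] q) =
        C ((-2) ^ (j + 1)) * dirDeriv ν ((dirDeriv ν)^[j] q) := by
      rw [C_mul', map_smul, ← C_mul', pow_succ, C_mul, map_neg C, map_ofNat C]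
      ring
    rw [h2] at h
    exact degLE_mono (le_of_eq (by push_cast; ring)) h

theorem contourIntegral_berest {m : ℕ} (hm : 1 ≤ m) {μ : Fin (k + 1) → ℂ}
    (hμ : ∀ i : Fin k, (μ i.castSucc - μ (Fin.last k)).re < 0) {Q : ℕ → MvPolynomial (Fin k) ℂ}
    (h0 : Q 0 = vdm X ^ (2 * m))
    (hQ : ∀ j, vdm X ^ 2 * Q (j + 1) = step (vdm X) (fun i => μ i.castSucc) m m (Q j)) (j : ℕ)
    {x : Fin (k + 1) → ℂ} (hx : 0 < imDenom x) :
    contourIntegral μ (2 * m) (kerNum m (Q j)) x = expQuot (vdm X) μ (m + 2 * j)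
      (iterStep μ m (laplace (fun i => μ i.castSucc - μ (Fin.last k)) (kerCross k ^ m)) j) x := by
  induction j generalizing x with
  | zero => rw [h0, contourIntegral_first m hμ hx, iterStep, mul_zero, add_zero]
  | succ j ih =>
    rw [← calogeroMoser_contourIntegral hm hμ (hQ j) hx, calogeroMoser_congr (fun _ => ih) hx, ih hx,
      calogeroMoser_expQuot _ _ _ _ (im_injective_of_imDenom_pos hx)]
    rfl

theorem isBAPolynomial_baPolynomial (n : ℕ) {m : ℕ} (hm : 1 ≤ m) :
    IsBAPolynomial n m (baPolynomial n m) :=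
  Classical.epsilon_spec (existsUnique_isBAPolynomial n hm).exists

theorem step_specialize_baPolynomial {n m : ℕ} (hm : 1 ≤ m) {μ : Fin n → ℂ}
    (hμ : Function.Injective μ) : step (vdm X) μ m m (specialize μ (baPolynomial n m)) = 0 :=
  (isBAPolynomial_iff.1 (isBAPolynomial_baPolynomial n hm)).2 μ hμ

theorem specialize_baPolynomial_sub_mem_degLE {n m : ℕ} (hm : 1 ≤ m) (μ : Fin n → ℂ) :
    specialize μ (baPolynomial n m) - vdm X ^ m * C (vdm μ ^ m) ∈ degLE ℂ 1 (m * n.choose 2 - 1) := by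
  rw [← specialize_leadingTerm, ← map_sub]
  exact specialize_mem_degLE μ
    (mem_degLE_of_leading (isBAPolynomial_iff.1 (isBAPolynomial_baPolynomial n hm)).1)

/-- A solution of the Schroedinger equation is determined by its leading coefficient. -/
theorem eq_mul_specialize_baPolynomial {n m : ℕ} (hm : 1 ≤ m) {μ : Fin n → ℂ}
    (hμ : Function.Injective μ) (j : ℕ) {p : MvPolynomial (Fin n) ℂ} {c : ℂ}
    (hp : step (vdm X) μ m (m + j) p = 0)
    (hlead : p - vdm X ^ (m + j) * C (c * vdm μ ^ m) ∈ degLE ℂ 1 ((m + j : ℕ) * n.choose 2 - 1)) :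
    p = vdm X ^ j * (C c * specialize μ (baPolynomial n m)) := by
  refine sub_eq_zero.1 (eq_zero_of_step_eq_zero hμ (m := m) (M := m + j) ?_ ?_)
  · have hA := mem_degLE_of_isHomogeneous (isHomogeneous_vdm
      (u := (X : Fin n → MvPolynomial _ ℂ)) fun i => isHomogeneous_X ℂ i)
    have h := mul_mem_degLE (pow_mem_degLE hA j)
      (C_mul_mem_degLE c (specialize_baPolynomial_sub_mem_degLE hm μ))
    have h' := sub_mem hlead (degLE_mono (le_of_eq (by push_cast; ring)) h)
    convert h' using 1
    rw [C_mul, pow_add]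
    ring
  · rw [map_sub, hp, step_add_pow_mul, C_mul', map_smul, step_specialize_baPolynomial hm hμ]
    simp

theorem integrand_eq_expQuot {m : ℕ} {μ : Fin (k + 1) → ℂ} (hμ : Function.Injective μ) (c : ℂ)
    {x : Fin (k + 1) → ℂ} (hx : 0 < imDenom x) (τ : Fin k → ℝ) :
    expQuot (kerDenom k) (kerExp μ) (2 * m) (kerNum m (C c *
      specialize (fun i : Fin k => μ i.castSucc) (baPolynomial k m))) (contourPt x τ) =
      c * vdm (fun i : Fin k => μ i.castSucc) ^ m * integrand k m x μ (contourPoint x τ) := by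
  have hB := eval_kerDenom_ne_zero hx τ
  rw [eval_kerDenom] at hB
  have h1 : vdm x ≠ 0 := left_ne_zero_of_mul hB
  have h2 : vdm (contourPoint x τ) ≠ 0 := right_ne_zero_of_mul hB
  have h3 : vdm (fun i : Fin k => μ i.castSucc) ≠ 0 :=
    vdm_ne_zero (hμ.comp (Fin.castSucc_injective k))
  have hz : ∀ p, eval (contourPt x τ) (toContour k p) = eval (contourPoint x τ) p := fun p => by
    have h : (eval (contourPt x τ)).comp (toContour k).toRingHom = eval (contourPoint x τ) := by
      refine MvPolynomial.ringHom_ext (fun c => by simp [toContour, algebraMap_eq]) fun i => ?_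
      rw [← eval_contourPt_contourVar]
      simp [toContour]
    exact congrArg (fun f => f p) h
  have hvx : eval (contourPt x τ) (vdm fun a => X (Sum.inl a)) = vdm x := by
    rw [map_vdm]
    simp [contourPt]
  have hcr : eval (contourPt x τ) (kerCross k) = crossProd (contourPoint x τ) x := by
    simp only [kerCross, crossProd, map_prod, map_sub, ← eval_contourPt_contourVar, eval_X, contourPt,
      Sum.elim_inl]
  have hexp : ∑ a, kerExp μ a * contourPt x τ a = μ (Fin.last k) * ((∑ i, x i) -
      ∑ i, contourPoint x τ i) + ∑ i : Fin k, μ i.castSucc * contourPoint x τ i := by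
    rw [sum_kerExp_mul, Fin.sum_univ_castSucc, Fin.sum_univ_castSucc x]
    simp only [contourPoint, Finset.sum_add_distrib, mul_add, sub_mul, Finset.sum_sub_distrib,
      mul_sub, Finset.mul_sum]
    ring
  rw [expQuot, hexp, Complex.exp_add, integrand, baFunction, ansatz, ← eval_specialize, eval_kerDenom,
    kerNum, map_mul, map_mul, map_pow, map_pow, hz, hcr, hvx, map_mul, eval_C]
  field_simp
  ring

/-- Berest's sequence in `k` variables is transported by the integral, and its last nonzero term is
compared with the Baker-Akhiezer function in `k + 1` variables. -/
theorem integral_formula {m : ℕ} (hm : 1 ≤ m) {μ : Fin (k + 1) → ℂ} (hinj : Function.Injective μ)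
    (hμ : ∀ i : Fin k, (μ i.castSucc - μ (Fin.last k)).re < 0) {x : Fin (k + 1) → ℂ}
    (hx : 0 < imDenom x) :
    Integrable (fun τ => integrand k m x μ (contourPoint x τ)) (contourMeasure k) ∧
    ∫ τ, integrand k m x μ (contourPoint x τ) ∂contourMeasure k =
      constC k m μ * baFunction (k + 1) m x μ := by
  set μ' : Fin k → ℂ := fun i => μ i.castSucc with hμ'
  have hinj' : Function.Injective μ' := hinj.comp (Fin.castSucc_injective k)
  set N := m * k.choose 2 with hN
  obtain ⟨Q, hQ0, hQs, hQN, hQl⟩ := exists_berest_sequence hinj' hm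
  rw [← hN] at hQN hQl
  have ht : (-2 : ℂ) ^ N * N.factorial ≠ 0 :=
    mul_ne_zero (pow_ne_zero _ (by norm_num)) (Nat.cast_ne_zero.2 N.factorial_ne_zero)
  set t : ℂ := (-2 : ℂ) ^ N * N.factorial with htdef
  have hv : vdm μ ≠ 0 := vdm_ne_zero hinj
  have hv' : vdm μ' ≠ 0 := vdm_ne_zero hinj'
  have hQ : Q N = C t * specialize μ' (baPolynomial k m) := by
    rw [← one_mul (C t * _), ← pow_zero (vdm X)]
    exact eq_mul_specialize_baPolynomial hm hinj' 0 (by rw [add_zero, ← hQs, hQN, mul_zero])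
      (by simpa only [add_zero, htdef, mul_assoc, hN, Nat.cast_mul] using hQl)
  have hI := fun j x hx => contourIntegral_berest hm hμ hQ0 hQs j (x := x) hx
  set p := laplace (fun i => μ i.castSucc - μ (Fin.last k)) (kerCross k ^ m) with hp
  -- The next integral has zero numerator because `Q (N + 1) = 0`, so the `N`-th iterate solves the
  -- equation.
  have hstep : step (vdm X) μ m (m + 2 * N) (iterStep μ m p N) = 0 := by
    refine eq_zero_of_eval_eq_zero_of_imDenom_pos fun y hy => ?_
    have h := hI (N + 1) y hy
    have h0 : contourIntegral μ (2 * m) (kerNum m (Q (N + 1))) y = 0 := by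
      simp [hQN, kerNum, contourIntegral, expQuot]
    rw [h0] at h
    refine (expQuot_eq_zero_iff ?_).1 h.symm
    rw [eval_vdm_X]
    exact vdm_ne_zero (im_injective_of_imDenom_pos hy)
  set q : MvPolynomial (Fin (k + 1)) ℂ := C (constC k m μ) * vdm (fun i : Fin k => X i.castSucc) ^ m
  have hlead : p - vdm X ^ m * q ∈ degLE ℂ 1 (m * (k + 1).choose 2 + N - 1) := by
    have h := laplace_kerCross_sub_mem_degLE m hμ
    have e : (m : ℤ) * (k * k) - 1 = m * (k + 1).choose 2 + N - 1 := by
      have : ((k + 1).choose 2 : ℤ) + k.choose 2 = k * k := by exact_mod_cast choose_two_add k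
      rw [← this, hN]
      push_cast
      ring
    rw [e] at h
    convert h using 2
    simp only [q, constC, neg_sub, Finset.prod_mul_distrib, Finset.prod_const, Finset.card_univ,
      Fintype.card_fin, C_mul, map_pow, map_neg, map_one, mul_pow, ← pow_mul, mul_comm (k.choose 2) m]
    ring
  have hq : q ∈ degLE ℂ 1 N := by
    have hA := mem_degLE_of_isHomogeneous (isHomogeneous_vdm
      (u := fun i : Fin k => (X i.castSucc : MvPolynomial (Fin (k + 1)) ℂ)) fun i => isHomogeneous_X ℂ _)
    have := C_mul_mem_degLE (constC k m μ) (pow_mem_degLE hA m)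
    exact_mod_cast this
  have htop := (iterStep_sub_mem_degLE μ m hq hlead N).1
  -- `q` has degree `N`, so the `N` directional derivatives leave a constant, involving only the
  -- first `k` spectral parameters.
  have hdq : (dirDeriv μ)^[N] q = C (constC k m μ * (N.factorial * vdm μ' ^ m)) := by
    have : (dirDeriv μ)^[N] q = C (constC k m μ) *
        (dirDeriv μ)^[N] (vdm (fun i : Fin k => X i.castSucc) ^ m) := by
      simp only [q, C_mul', ← Module.End.coe_pow, map_smul]
    rw [this, dirDeriv_iterate_vdm_pow, ← C_mul]
  -- The `N` steps have raised the denominator by `A ^ (2 * N)`, which the numerator must therefore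
  -- contain. The division by `vdm μ ^ m` matches the normalization of the leading term in `k + 1`
  -- variables.
  have hR : iterStep μ m p N = vdm X ^ (2 * N) * (C (t * constC k m μ * vdm μ' ^ m / vdm μ ^ m) *
      specialize μ (baPolynomial (k + 1) m)) := by
    refine eq_mul_specialize_baPolynomial hm hinj (2 * N) hstep ?_
    rw [hdq, ← C_mul] at htop
    convert htop using 4
    · ring
    · rw [div_mul_cancel₀ _ (pow_ne_zero m hv), htdef]
      ring
  have hfin := hI N x hx
  rw [hR, expQuot_pow_mul _ _ _ _ _ (by
    rw [eval_vdm_X]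
    exact vdm_ne_zero (im_injective_of_imDenom_pos hx)), expQuot_C_mul] at hfin
  have hint := integrable_expQuot hμ (2 * m) (kerNum m (Q N)) hx
  rw [contourIntegral] at hfin
  have hpt : ∀ τ, expQuot (kerDenom k) (kerExp μ) (2 * m) (kerNum m (Q N)) (contourPt x τ) =
      t * vdm μ' ^ m * integrand k m x μ (contourPoint x τ) := fun τ => by
    rw [hQ]
    exact integrand_eq_expQuot hinj t hx τ
  simp only [hpt] at hfin hint
  have hc : t * vdm μ' ^ m ≠ 0 := mul_ne_zero ht (pow_ne_zero _ hv')
  constructor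
  · have := hint.const_mul (t * vdm μ' ^ m)⁻¹
    simpa only [← mul_assoc, inv_mul_cancel₀ hc, one_mul] using this
  · rw [integral_const_mul] at hfin
    refine mul_left_cancel₀ hc (hfin.trans ?_)
    rw [baFunction, ansatz_eq_expQuot, expQuot_C_mul]
    field_simp

end Final

end RationalBA
end
-- The main theorem
theorem mainTheorem3 (k m : ℕ) (hm : 1 ≤ m) :
    (∃! P, RationalBA.IsBAPolynomial k m P) ∧
    (∃! P, RationalBA.IsBAPolynomial (k + 1) m P) ∧
    ∀ x μ : Fin (k + 1) → ℂ,
      (∀ i j : Fin (k + 1), i ≠ j → (x i).im ≠ (x j).im) →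
      (∀ i j : Fin (k + 1), i < j → (μ i - μ j).re < 0) →
      MeasureTheory.IntegrableOn
        (fun τ : Fin k → ℝ => RationalBA.integrand k m x μ (RationalBA.contourPoint x τ))
        {τ : Fin k → ℝ | ∀ i, 0 ≤ τ i} ∧
      ∫ τ in {τ : Fin k → ℝ | ∀ i, 0 ≤ τ i},
          RationalBA.integrand k m x μ (RationalBA.contourPoint x τ)
        = RationalBA.constC k m μ * RationalBA.baFunction (k + 1) m x μ := by
  refine ⟨RationalBA.existsUnique_isBAPolynomial k hm,
    RationalBA.existsUnique_isBAPolynomial (k + 1) hm, fun x μ hx hμ => ?_⟩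
  -- Equal spectral parameters would make a real part both zero and negative.
  have hinj : Function.Injective μ := fun i j hij => by
    rcases lt_trichotomy i j with h | h | h
    · simpa [hij] using hμ i j h
    · exact h
    · simpa [hij] using hμ j i h
  have h := RationalBA.integral_formula hm hinj (fun i => hμ _ _ (Fin.castSucc_lt_last i))
    (RationalBA.imDenom_pos hx)
  rwa [← RationalBA.restrict_eq_contourMeasure] at h
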